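/- **The $\mathbb B_7$ family.** Let $e_1,e_2,e_3$ and $e_1',e_2',e_3'$ be left-invariant one-forms on the two factors of $SU(2)^2$ with $de_i=-e_j\wedge e_k$, $de_i'=-e_j'\wedge e_k'$ for $(i\,j\,k)$ cyclic, and set $e_i^\pm=\tfrac12(e_i\pm e_i')$. A member of the $\mathbb B_7$ family is given by $r_0>0$, $\bar a>\bar b$ with $64r_0(2\bar a+\bar b)=1$, and functions $a,b$, smooth on $[0,\infty)$, with $$a=r_0^3+\tfrac14r_0t^2+\bar a t^4+O(t^6),\qquad b=r_0^3+\tfrac14r_0t^2+\bar bt^4+O(t^6)\qquad(t\to0),$$ such that, with $p=-q=r_0^3$, the function $F(a,b)=4a^2(b-p)(b+q)-(b^2+pq)^2$ is positive for $t>0$ and, for $x_1=\dot a\dot b$, $x_2=\dot a^2$, $$\dot x_1=\frac{\partial_aF}{4\sqrt F},\quad \dot x_2=\frac{\partial_bF}{2\sqrt F},\quad \dot a=\frac{x_1x_2}{\sqrt{x_1^2x_2}},\quad \dot b=\frac{x_1^2}{\sqrt{x_1^2x_2}}\qquad(t>0).$$ It defines on $M=S^3\times\mathbb R^4$, whose principal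 orbits form $\mathbb R_{>0}\times SU(2)^2$, the $G_2$-structure $$\varphi=p\,e_1\wedge e_2\wedge e_3+q\,e_1'\wedge e_2'\wedge e_3'+d\big(a(e_1\wedge e_1'+e_2\wedge e_2')+b\,e_3\wedge e_3'\big)$$ with metric $dt^2+\sum_i\big(A_i^2(e_i^+)^2+B_i^2(e_i^-)^2\big)$, where $$A_1=A_2=\sqrt{\tfrac{(b-p)(2a-b-p)}{\dot a\dot b}},\quad A_3=\tfrac{b-p}{\dot a},\quad B_1=B_2=\sqrt{\tfrac{(b-p)(2a+b+p)}{\dot a\dot b}},\quad B_3=\tfrac{2\dot a\dot b}{b-p}.$$ Let $\ell=\lim_{t\to\infty}\sqrt[3]{2b^3/(3a^2)}>0$ be the size of the asymptotic circle fibre. **Invariant instantons on $P_1$.** Let $P_1=M\times SU(2)$ be the $SU(2)^2\times U(1)$-equivariant bundle on which the isotropy group $\Delta SU(2)$ of the singular orbit $\{t=0\}$ acts trivially on the fibre. Let $E_1,E_2,E_3$ be the basis of $\mathfrak{su}(2)$ with $[E_i,E_j]=E_k$ for $(i\,j\,k)$ cyclic. Invariant connections are written $$A=A_1f^+\sum_{i=1,2}E_i\otimes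 e_i^++B_1f^-\sum_{i=1,2}E_i\otimes e_i^-+A_3g^+E_3\otimes e_3^++B_3g^-E_3\otimes e_3^-$$ with $f^\pm,g^\pm$ functions of $t$. Such a connection is a $G_2$-instanton on $P_1$ over a set of orbits that contains the singular orbit if it extends smoothly over the singular orbit on $P_1$ and $F_A\wedge{*\varphi}=0$. **Theorem.** For every member of the $\mathbb B_7$ family: (1) The function $$H=\frac12\left(\frac2{A_3^2}+\frac1{B_1^2}-\frac{A_1^2+B_1^2+B_3^2}{A_1A_3B_1B_3}\right)$$ is strictly positive for all $t>0$, and has a strictly positive limit as $t\to0$. (2) Let $A$ be an invariant $G_2$-instanton on $P_1$ as above, defined for $0\le t<T$ for some $T>0$, with $f^+=f_1^+t+O(t^3)$ and $g^+=g_1^+t+O(t^3)$ as $t\to0$. Suppose that $g_1^+\le\tfrac12\ell^{-2}$, or that $f_1^+\ge0$ and $f_1^+\ge g_1^+$. Then $A$ extends to an invariant $G_2$-instanton on $P_1$ over all of $M$ with bounded curvature if and only if $f_1^+=0$. -/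

import Mathlib

open Set Filter Topology Asymptotics
open scoped ContDiff Quaternion

noncomputable section

/-! ## Invariant forms on `ℝ_{>0} × SU(2) × SU(2)` -/

namespace InvForm

/-- The left-invariant one-forms `c dt + ∑ xᵢ eᵢ + ∑ yᵢ eᵢ'` at a point of `ℝ_{>0} × SU(2)²`,
written as triples `(c, x, y)`. -/
abbrev Covec : Type := ℝ × (Fin 3 → ℝ) × (Fin 3 → ℝ)

/-- The algebra of left-invariant forms at a point of `ℝ_{>0} × SU(2)²`; the product is the wedge
product. -/
abbrev Form : Type := ExteriorAlgebra ℝ Covec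

/-- The one-form `dt`. -/
def dt : Form := ExteriorAlgebra.ι ℝ ((1, 0, 0) : Covec)

/-- The one-form `eᵢ` on the first factor `SU(2)`. -/
def e (i : Fin 3) : Form := ExteriorAlgebra.ι ℝ ((0, Pi.single i 1, 0) : Covec)

/-- The one-form `eᵢ'` on the second factor `SU(2)`. -/
def e' (i : Fin 3) : Form := ExteriorAlgebra.ι ℝ ((0, 0, Pi.single i 1) : Covec)

/-- `eᵢ⁺ = (eᵢ + eᵢ') / 2`. -/
def ePlus (i : Fin 3) : Form := (1 / 2 : ℝ) • (e i + e' i)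

/-- `eᵢ⁻ = (eᵢ - eᵢ') / 2`. -/
def eMinus (i : Fin 3) : Form := (1 / 2 : ℝ) • (e i - e' i)

/-- The vector field `∂ₜ`, as a functional on one-forms. -/
def vecT : Module.Dual ℝ Covec := LinearMap.fst ℝ ℝ ((Fin 3 → ℝ) × (Fin 3 → ℝ))

/-- The left-invariant vector field `Eᵢ` dual to `eᵢ`, as a functional on one-forms. -/
def vecE (i : Fin 3) : Module.Dual ℝ Covec :=
  (LinearMap.proj i).comp ((LinearMap.fst ℝ (Fin 3 → ℝ) (Fin 3 → ℝ)).comp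
    (LinearMap.snd ℝ ℝ ((Fin 3 → ℝ) × (Fin 3 → ℝ))))

/-- The left-invariant vector field `Eᵢ'` dual to `eᵢ'`, as a functional on one-forms. -/
def vecE' (i : Fin 3) : Module.Dual ℝ Covec :=
  (LinearMap.proj i).comp ((LinearMap.snd ℝ (Fin 3 → ℝ) (Fin 3 → ℝ)).comp
    (LinearMap.snd ℝ ℝ ((Fin 3 → ℝ) × (Fin 3 → ℝ))))

/-- Interior product of a vector with a form. -/
def contract (X : Module.Dual ℝ Covec) : Form →ₗ[ℝ] Form :=
  CliffordAlgebra.contractLeft (Q := (0 : QuadraticForm ℝ Covec)) X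

/-- The exterior derivative of a left-invariant form with constant coefficients: the unique
antiderivation with `d(dt) = 0`, `deᵢ = - eⱼ ∧ eₖ`, `deᵢ' = - eⱼ' ∧ eₖ'` for `(i j k)` cyclic
(indices in `Fin 3` are taken modulo 3). -/
def dInv (ψ : Form) : Form :=
  ∑ i : Fin 3, (-(e (i + 1) * e (i + 2)) * contract (vecE i) ψ
    + -(e' (i + 1) * e' (i + 2)) * contract (vecE' i) ψ)

/-- The Riemannian metric `dt² + ∑ (Aᵢ² (eᵢ⁺)² + Bᵢ² (eᵢ⁻)²)`, given as the isomorphism `♯` from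
one-forms to vectors, `♯ v = ∑ v(u) u` over the orthonormal frame `u = ∂ₜ`, `(Eᵢ + Eᵢ') / Aᵢ`,
`(Eᵢ - Eᵢ') / Bᵢ`. -/
def sharp (A B : Fin 3 → ℝ) : Covec →ₗ[ℝ] Module.Dual ℝ Covec :=
  vecT.smulRight vecT
    + ∑ i : Fin 3, (((A i ^ 2)⁻¹) • (vecE i + vecE' i).smulRight (vecE i + vecE' i)
      + ((B i ^ 2)⁻¹) • (vecE i - vecE' i).smulRight (vecE i - vecE' i))

/-- The algebra morphism that sends a product of one-forms `v₁ ∧ … ∧ vₖ` to the composition of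
contractions with `♯ v₁, …, ♯ vₖ`. -/
def contractHom (A B : Fin 3 → ℝ) : Form →ₐ[ℝ] Module.End ℝ Form :=
  ExteriorAlgebra.lift ℝ
    ⟨(CliffordAlgebra.contractLeft (Q := (0 : QuadraticForm ℝ Covec))).comp (sharp A B),
      fun v => LinearMap.ext fun ψ =>
        CliffordAlgebra.contractLeft_contractLeft (Q := (0 : QuadraticForm ℝ Covec))
          (sharp A B v) ψ⟩

/-- Interior product of a form `χ` with a form `ψ` through the metric: for `ψ = v₁ ∧ … ∧ vₖ`, this
is `ι_{♯vₖ} ⋯ ι_{♯v₁} χ`. -/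
def metricContract (A B : Fin 3 → ℝ) (ψ χ : Form) : Form :=
  contractHom A B (CliffordAlgebra.reverse (Q := (0 : QuadraticForm ℝ Covec)) ψ) χ

/-- The inner product of forms induced by the metric (products of distinct members of an
orthonormal coframe have length one). -/
def formInner (A B : Fin 3 → ℝ) (ψ χ : Form) : ℝ :=
  ExteriorAlgebra.algebraMapInv (metricContract A B ψ χ)

/-- The Riemannian volume form, in the orientation of
`dt ∧ (A₁e₁⁻ ∧ e₁⁺) ∧ (e₂⁻ ∧ e₂⁺) ∧ (e₃⁻ ∧ e₃⁺)`. -/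
def vol (A B : Fin 3 → ℝ) : Form :=
  (A 0 * B 0 * (A 1 * B 1) * (A 2 * B 2)) •
    (dt * (eMinus 0 * ePlus 0) * (eMinus 1 * ePlus 1) * (eMinus 2 * ePlus 2))

/-- The Hodge star: `χ ∧ ⋆ψ = ⟨χ, ψ⟩ vol` for forms `χ`, `ψ` of equal degree. -/
def hodge (A B : Fin 3 → ℝ) (ψ : Form) : Form := metricContract A B ψ (vol A B)

end InvForm

/-! ## The family of metrics -/

namespace B7

/-- `F(a, b) = 4a²(b - p)(b + q) - (b² + pq)²`. -/
def hitchinF (p q a b : ℝ) : ℝ := 4 * a ^ 2 * (b - p) * (b + q) - (b ^ 2 + p * q) ^ 2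

/-- A member of the `𝔹₇` family: a solution `(a, b)` on `[0, ∞)` of the Hitchin flow equations,
with `p = -q = r₀³`, parametrised by the arc-length `t` of a geodesic orthogonal to the principal
orbits, with the power series at the singular orbit `t = 0` that is determined by `r₀`, `ā`, `b̄`,
where `64 r₀ (2ā + b̄) = 1` and `ā > b̄`. -/
structure Metric where
  /-- scale -/
  r₀ : ℝ
  /-- the parameter `ā` -/
  aBar : ℝ
  /-- the parameter `b̄` -/
  bBar : ℝ
  /-- the function `a` -/
  a : ℝ → ℝ
  /-- the function `b` -/
  b : ℝ → ℝ
  r₀_pos : 0 < r₀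
  constraint : 64 * r₀ * (2 * aBar + bBar) = 1
  bBar_lt_aBar : bBar < aBar
  smooth_a : ContDiffOn ℝ ∞ a (Ici 0)
  smooth_b : ContDiffOn ℝ ∞ b (Ici 0)
  expansion_a : (fun t => a t - (r₀ ^ 3 + 1 / 4 * r₀ * t ^ 2 + aBar * t ^ 4))
    =O[𝓝[>] 0] (fun t => t ^ 6)
  expansion_b : (fun t => b t - (r₀ ^ 3 + 1 / 4 * r₀ * t ^ 2 + bBar * t ^ 4))
    =O[𝓝[>] 0] (fun t => t ^ 6)
  /-- non-degeneracy of the three-form on the principal orbits -/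
  nondegenerate : ∀ t, 0 < t → 0 < hitchinF (r₀ ^ 3) (-r₀ ^ 3) (a t) (b t)
  /-- the Hitchin flow for `x₁ = ȧḃ` -/
  flow_x₁ : ∀ t, 0 < t → HasDerivAt (fun s => deriv a s * deriv b s)
    (deriv (fun y => hitchinF (r₀ ^ 3) (-r₀ ^ 3) y (b t)) (a t)
      / (4 * √(hitchinF (r₀ ^ 3) (-r₀ ^ 3) (a t) (b t)))) t
  /-- the Hitchin flow for `x₂ = ȧ²` -/
  flow_x₂ : ∀ t, 0 < t → HasDerivAt (fun s => deriv a s ^ 2)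
    (deriv (fun y => hitchinF (r₀ ^ 3) (-r₀ ^ 3) (a t) y) (b t)
      / (2 * √(hitchinF (r₀ ^ 3) (-r₀ ^ 3) (a t) (b t)))) t
  /-- the Hitchin flow for `y₁ = a` -/
  flow_y₁ : ∀ t, 0 < t → HasDerivAt a
    ((deriv a t * deriv b t) * deriv a t ^ 2
      / √((deriv a t * deriv b t) ^ 2 * deriv a t ^ 2)) t
  /-- the Hitchin flow for `y₂ = b` -/
  flow_y₂ : ∀ t, 0 < t → HasDerivAt b
    ((deriv a t * deriv b t) ^ 2
      / √((deriv a t * deriv b t) ^ 2 * deriv a t ^ 2)) t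

namespace Metric

variable (S : Metric)

/-- The constant `p = r₀³`. -/
def p : ℝ := S.r₀ ^ 3

/-- The constant `q = -r₀³`. -/
def q : ℝ := -S.r₀ ^ 3

/-- The metric coefficient `A₁ = A₂`. -/
def A₁ (t : ℝ) : ℝ :=
  √((S.b t - S.p) * (2 * S.a t - S.b t - S.p) / (deriv S.a t * deriv S.b t))

/-- The metric coefficient `A₃`. -/
def A₃ (t : ℝ) : ℝ := (S.b t - S.p) / deriv S.a t

/-- The metric coefficient `B₁ = B₂`. -/
def B₁ (t : ℝ) : ℝ :=
  √((S.b t - S.p) * (2 * S.a t + S.b t + S.p) / (deriv S.a t * deriv S.b t))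

/-- The metric coefficient `B₃`. -/
def B₃ (t : ℝ) : ℝ := 2 * deriv S.a t * deriv S.b t / (S.b t - S.p)

/-- The coefficients `(A₁, A₂, A₃)` of the metric on the orbit `{t} × SU(2)²`. -/
def A (t : ℝ) : Fin 3 → ℝ := ![S.A₁ t, S.A₁ t, S.A₃ t]

/-- The coefficients `(B₁, B₂, B₃)` of the metric on the orbit `{t} × SU(2)²`. -/
def B (t : ℝ) : Fin 3 → ℝ := ![S.B₁ t, S.B₁ t, S.B₃ t]

open InvForm in
/-- The `G₂`-structure
`φ = p e₁∧e₂∧e₃ + q e₁'∧e₂'∧e₃' + d(a (e₁∧e₁' + e₂∧e₂') + b e₃∧e₃')` on the orbit at `t`, where `d`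
is the differential in seven dimensions, `d(c ψ) = ċ dt ∧ ψ + c dψ`. -/
def phi (t : ℝ) : Form :=
  S.p • (e 0 * e 1 * e 2) + S.q • (e' 0 * e' 1 * e' 2)
    + (deriv S.a t • (dt * (e 0 * e' 0 + e 1 * e' 1))
      + S.a t • dInv (e 0 * e' 0 + e 1 * e' 1))
    + (deriv S.b t • (dt * (e 2 * e' 2)) + S.b t • dInv (e 2 * e' 2))

/-- The four-form `⋆φ`. -/
def starPhi (t : ℝ) : InvForm.Form := InvForm.hodge (S.A t) (S.B t) (S.phi t)

/-- `ℓ` is the size of the asymptotic circle fibre, `ℓ = lim (2b³ / 3a²)^{1/3}`. -/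
def IsCircleLength (ℓ : ℝ) : Prop :=
  0 < ℓ ∧ Tendsto (fun t => (2 * S.b t ^ 3 / (3 * S.a t ^ 2)) ^ (1 / 3 : ℝ)) atTop (𝓝 ℓ)

/-- The function `H`. -/
def H (t : ℝ) : ℝ :=
  1 / 2 * (2 / S.A₃ t ^ 2 + 1 / S.B₁ t ^ 2
    - (S.A₁ t ^ 2 + S.B₁ t ^ 2 + S.B₃ t ^ 2) / (S.A₁ t * S.A₃ t * S.B₁ t * S.B₃ t))

end Metric

/-! ## Invariant connections -/

/-- The data of an `SU(2)² × U(1)`-invariant connection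
`A = A₁ f⁺ (∑_{i=1,2} Eᵢ ⊗ eᵢ⁺) + B₁ f⁻ (∑_{i=1,2} Eᵢ ⊗ eᵢ⁻) + A₃ g⁺ E₃ ⊗ e₃⁺ + B₃ g⁻ E₃ ⊗ e₃⁻`,
where `Eᵢ` is the basis of `su(2)` with `[Eᵢ, Eⱼ] = Eₖ` for `(i j k)` cyclic. -/
structure Connection where
  /-- the function `f⁺` -/
  fPlus : ℝ → ℝ
  /-- the function `f⁻` -/
  fMinus : ℝ → ℝ
  /-- the function `g⁺` -/
  gPlus : ℝ → ℝ
  /-- the function `g⁻` -/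
  gMinus : ℝ → ℝ

namespace Connection

variable (C : Connection) (S : Metric)

/-- The coefficient of `Eₖ ⊗ eₖ⁺`. -/
def coeffPlus (k : Fin 3) (t : ℝ) : ℝ :=
  (![S.A₁ t * C.fPlus t, S.A₁ t * C.fPlus t, S.A₃ t * C.gPlus t] : Fin 3 → ℝ) k

/-- The coefficient of `Eₖ ⊗ eₖ⁻`. -/
def coeffMinus (k : Fin 3) (t : ℝ) : ℝ :=
  (![S.B₁ t * C.fMinus t, S.B₁ t * C.fMinus t, S.B₃ t * C.gMinus t] : Fin 3 → ℝ) k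

open InvForm in
/-- The `Eₖ`-component of the connection on the orbit at `t`. -/
def form (k : Fin 3) (t : ℝ) : Form :=
  C.coeffPlus S k t • ePlus k + C.coeffMinus S k t • eMinus k

open InvForm in
/-- The `Eₖ`-component of the curvature `F_A = dA + ½ [A ∧ A]` on the orbit at `t`. -/
def curvature (k : Fin 3) (t : ℝ) : Form :=
  (dt * (deriv (C.coeffPlus S k) t • ePlus k + deriv (C.coeffMinus S k) t • eMinus k)
    + dInv (C.form S k t))
    + C.form S (k + 1) t * C.form S (k + 2) t

/-- `|F_A|²` on the orbit at `t`, for the metric of `S` and the invariant inner product on `su(2)`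
for which the `Eₖ` are orthonormal. -/
def curvatureNormSq (t : ℝ) : ℝ :=
  ∑ k : Fin 3, InvForm.formInner (S.A t) (S.B t) (C.curvature S k t) (C.curvature S k t)

/-- The curvature is bounded on `M` (equivalently, on the dense union of the principal orbits). -/
def HasBoundedCurvature : Prop := ∃ K : ℝ, ∀ t, 0 < t → C.curvatureNormSq S t ≤ K

/-- The `G₂`-instanton equation `F_A ∧ ⋆φ = 0` on the orbits with `t ∈ I`. -/
def SolvesInstantonEq (I : Set ℝ) : Prop :=
  ∀ t ∈ I, ∀ k : Fin 3, C.curvature S k t * S.starPhi t = 0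

/-- The connection as an explicit `su(2)`-valued one-form on `M = S³ × ℝ⁴`, with `ℝ⁴ = ℍ`, with `S³`
the unit quaternions and with `su(2) = Im ℍ`, `E₁ = i/2`, `E₂ = j/2`, `E₃ = k/2`. The group `SU(2)²`
acts on `M` by `(h₁, h₂) · (p, y) = (h₁ p h₂⁻¹, h₂ y)`, the group `U(1)` by right multiplication on
`y`, and `(t, g₁, g₂) ↦ (g₁ g₂⁻¹, t g₂)` identifies `ℝ_{>0} × SU(2)²` with the principal orbits.
Under this, `g₂⁻¹ dg₂ = ∑ eᵢ' ⊗ Eᵢ` becomes `Im (y⁻¹ dy)` and `g₁⁻¹ dg₁ = ∑ eᵢ ⊗ Eᵢ` becomes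
`y⁻¹ Im (p⁻¹ dp) y + Im (y⁻¹ dy)`. The formula makes sense for all `p ≠ 0`, where it is the
pull-back under `p ↦ p / |p|`. -/
def formOnM (p y v w : ℍ[ℝ]) : ℍ[ℝ] :=
  let m' : ℍ[ℝ] := (y⁻¹ * w).im
  let m : ℍ[ℝ] := y⁻¹ * (p⁻¹ * v).im * y + m'
  let cP := fun k => C.coeffPlus S k ‖y‖
  let cM := fun k => C.coeffMinus S k ‖y‖
  ⟨0,
    1 / 2 * (cP 0 * (m + m').imI + cM 0 * (m - m').imI),
    1 / 2 * (cP 1 * (m + m').imJ + cM 1 * (m - m').imJ),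
    1 / 2 * (cP 2 * (m + m').imK + cM 2 * (m - m').imK)⟩

/-- The connection is a smooth connection on the restriction of `P₁` to the orbits with
`t ∈ {0} ∪ I`, including the singular orbit `S³ × {0}`. The isotropy group of the singular orbit
acts trivially on the fibre, so `P₁` is the product bundle `M × SU(2)` (with `SU(2)²` acting on `M`
only), and a smooth connection is a smooth `su(2)`-valued one-form on `M`. -/
def SmoothOnP₁ (I : Set ℝ) : Prop :=
  ∃ 𝒜 : ℍ[ℝ] × ℍ[ℝ] → (ℍ[ℝ] × ℍ[ℝ] →L[ℝ] ℍ[ℝ]),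
    ContDiffOn ℝ ∞ 𝒜 {x | x.1 ≠ 0 ∧ (x.2 = 0 ∨ ‖x.2‖ ∈ I)} ∧
    ∀ p y : ℍ[ℝ], p ≠ 0 → y ≠ 0 → ‖y‖ ∈ I →
      ∀ v w : ℍ[ℝ], 𝒜 (p, y) (v, w) = C.formOnM S p y v w

/-- The connection is an invariant `G₂`-instanton on `P₁` over the orbits with `t ∈ {0} ∪ I`. -/
def IsInstantonOnP₁ (I : Set ℝ) : Prop := C.SmoothOnP₁ S I ∧ C.SolvesInstantonEq S I

/-- Two connections agree on the orbits with `t ∈ I`. -/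
def AgreeOn (D : Connection) (I : Set ℝ) : Prop :=
  EqOn C.fPlus D.fPlus I ∧ EqOn C.fMinus D.fMinus I ∧
    EqOn C.gPlus D.gPlus I ∧ EqOn C.gMinus D.gMinus I

/-- A connection given for `t ∈ (0, T)` extends to an invariant `G₂`-instanton on `P₁` over all of
`M`, with bounded curvature. -/
def ExtendsGlobally (T : ℝ) : Prop :=
  ∃ D : Connection, C.AgreeOn D (Ioo 0 T) ∧ D.IsInstantonOnP₁ S (Ioi 0) ∧ D.HasBoundedCurvature S

end Connection

end B7

end

/-! Write `P = A₁f⁺`, `Q = A₃g⁺`, `M = B₁f⁻`, `N = B₃g⁻` and `u = b - p`, `v = 2a - b - p`, `w = 2a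
+ b + p`, so that `F = u²vw`. The flow conserves `√F - 2ȧ²ḃ`, which vanishes at the singular orbit;
the resulting constraint `4ȧ⁴ḃ² = u²vw` makes every identity between metric coefficients algebraic
in `ȧ, ḃ, u, v, w`.

Positivity of `H`. The flow gives `(ȧ² - ȧḃ)˙ = 2u(a - b)w/√F`. Since `ā > b̄`, both `a > b` and `ȧ
> ḃ` hold near `t = 0`, and this equation propagates them to all `t` (`a_gt_b_and`). By the
constraint, `H` is a sum of positive multiples of `ȧ - ḃ` and `a - b` (`H_eq`).

Reduction. `F_A ∧ ⋆φ = 0` becomes a system of four equations for `P, M, Q, N` (`instanton_iff`),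
singular at `t = 0`. Smoothness on `P₁` keeps `M, N` bounded there, and bounded solutions have `M =
N = 0`. What remains is a linear homogeneous equation for `P` and `(Q/A₃²)˙ = -(f⁺)²/A₃`.

If `f₁⁺ = 0`, then `P = 0` and `Q = 2g₁⁺A₃²`. This abelian instanton exists on all of `M`, and its
curvature is bounded because `A₃ ≤ A₁` and `A₃ ≤ B₁`.

If `f₁⁺ ≠ 0`, then `P` never vanishes and `Q/A₃²` decreases strictly from `2g₁⁺`. The coefficient
`A₃` increases and stays at most `ℓ` (`A₃_le`). So once `Q/A₃² < ℓ⁻²`, there is `ε > 0` with `Q ≤ 1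
- ε` from then on; `P` outgrows `a`, and the curvature term `P²/(B₁B₃)²`, at least a constant times
`P²/a²`, is unbounded. It remains to bring `Q/A₃²` below `ℓ⁻²`. If `g₁⁺ ≤ ½ℓ⁻²` this is immediate.
If `f₁⁺ > 0` and `f₁⁺ ≥ g₁⁺`, then `Z = (f⁺ - g⁺)/A₃` satisfies `Ż = f⁺(Z + H)`, and `H > 0` gives
`f⁺ ≥ g⁺`; were `g⁺/A₃ = Q/A₃²` to stay at least `ℓ⁻²`, its derivative would be bounded above by a
negative constant for `t ≥ 1`, which is absurd. -/

noncomputable section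

open InvForm

/-! ### Wedge and contraction calculus in the frame `dt`, `eᵢ^±` -/

namespace InvForm

/-- The covector underlying `gen i`. -/
def genVec : Fin 7 → Covec :=
  ![(1, 0, 0),
    (0, (1 / 2 : ℝ) • Pi.single 0 1, -((1 / 2 : ℝ) • Pi.single 0 1)),
    (0, (1 / 2 : ℝ) • Pi.single 0 1, (1 / 2 : ℝ) • Pi.single 0 1),
    (0, (1 / 2 : ℝ) • Pi.single 1 1, -((1 / 2 : ℝ) • Pi.single 1 1)),
    (0, (1 / 2 : ℝ) • Pi.single 1 1, (1 / 2 : ℝ) • Pi.single 1 1),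
    (0, (1 / 2 : ℝ) • Pi.single 2 1, -((1 / 2 : ℝ) • Pi.single 2 1)),
    (0, (1 / 2 : ℝ) • Pi.single 2 1, (1 / 2 : ℝ) • Pi.single 2 1)]

/-- The one-forms `dt, e₁⁻, e₁⁺, e₂⁻, e₂⁺, e₃⁻, e₃⁺`. -/
def gen (i : Fin 7) : Form := ExteriorAlgebra.ι ℝ (genVec i)

/-- The frame dual to `gen`. -/
def dualVec : Fin 7 → Module.Dual ℝ Covec :=
  ![vecT, vecE 0 - vecE' 0, vecE 0 + vecE' 0, vecE 1 - vecE' 1, vecE 1 + vecE' 1,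
    vecE 2 - vecE' 2, vecE 2 + vecE' 2]

/-- The squared lengths of the one-forms `gen i`. -/
def lenSq (A B : Fin 3 → ℝ) : Fin 7 → ℝ :=
  ![1, (B 0 ^ 2)⁻¹, (A 0 ^ 2)⁻¹, (B 1 ^ 2)⁻¹, (A 1 ^ 2)⁻¹, (B 2 ^ 2)⁻¹, (A 2 ^ 2)⁻¹]

lemma dualVec_genVec (i j : Fin 7) : dualVec i (genVec j) = if i = j then 1 else 0 := by
  fin_cases i <;> fin_cases j <;>
    simp [dualVec, genVec, vecT, vecE, vecE'] <;> norm_num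

lemma sharp_genVec (A B : Fin 3 → ℝ) (i : Fin 7) :
    sharp A B (genVec i) = lenSq A B i • dualVec i := by
  fin_cases i <;>
    simp [sharp, lenSq, dualVec, genVec, vecT, vecE, vecE', Fin.sum_univ_three,
      LinearMap.add_apply, LinearMap.smul_apply, LinearMap.smulRight_apply] <;> norm_num

lemma dt_eq_gen : dt = gen 0 := rfl

lemma eMinus_eq_gen : eMinus 0 = gen 1 ∧ eMinus 1 = gen 3 ∧ eMinus 2 = gen 5 := by
  refine ⟨?_, ?_, ?_⟩ <;>
    simp [eMinus, gen, genVec, e, e', ← map_sub, ← map_smul]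

lemma ePlus_eq_gen : ePlus 0 = gen 2 ∧ ePlus 1 = gen 4 ∧ ePlus 2 = gen 6 := by
  refine ⟨?_, ?_, ?_⟩ <;>
    simp [ePlus, gen, genVec, e, e', ← map_add, ← map_smul]

lemma contract_gen_mul (i j : Fin 7) (x : Form) :
    contract (dualVec i) (gen j * x)
      = (if i = j then x else 0) - gen j * contract (dualVec i) x := by
  have h := CliffordAlgebra.contractLeft_ι_mul (Q := (0 : QuadraticForm ℝ Covec))
    (d := dualVec i) (genVec j) x
  rw [dualVec_genVec] at h
  refine h.trans ?_
  split_ifs <;> simp [contract, gen]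

lemma contract_gen (i j : Fin 7) :
    contract (dualVec i) (gen j) = if i = j then 1 else 0 := by
  have h := contract_gen_mul i j 1
  have h1 : contract (dualVec i) (1 : Form) = 0 :=
    CliffordAlgebra.contractLeft_one (Q := (0 : QuadraticForm ℝ Covec)) (dualVec i)
  simpa [h1] using h

lemma gen_mul_self (i : Fin 7) : gen i * gen i = 0 := ExteriorAlgebra.ι_sq_zero _

lemma gen_mul_self_mul (i : Fin 7) (x : Form) : gen i * (gen i * x) = 0 := by
  rw [← mul_assoc, gen_mul_self, zero_mul]

/-- With `gen_swap_mul` and `gen_mul_self_mul` this brings each monomial to increasing indices; the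
side condition makes the rewriting terminate. -/
lemma gen_swap {i j : Fin 7} (_ : j < i) : gen i * gen j = -(gen j * gen i) :=
  eq_neg_of_add_eq_zero_left (ExteriorAlgebra.ι_add_mul_swap _ _)

lemma gen_swap_mul {i j : Fin 7} (h : j < i) (x : Form) :
    gen i * (gen j * x) = -(gen j * (gen i * x)) := by
  rw [← mul_assoc, gen_swap h, neg_mul, mul_assoc]

lemma contractHom_gen (A B : Fin 3 → ℝ) (i : Fin 7) :
    contractHom A B (gen i) = lenSq A B i • contract (dualVec i) := by
  rw [contractHom, gen, ExteriorAlgebra.lift_ι_apply]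
  simp [sharp_genVec, contract]

lemma reverse_gen (i : Fin 7) :
    CliffordAlgebra.reverse (Q := (0 : QuadraticForm ℝ Covec)) (gen i) = gen i :=
  CliffordAlgebra.reverse_ι _

lemma metricContract_add_left (A B : Fin 3 → ℝ) (ψ ψ' χ : Form) :
    metricContract A B (ψ + ψ') χ = metricContract A B ψ χ + metricContract A B ψ' χ := by
  have : CliffordAlgebra.reverse (Q := (0 : QuadraticForm ℝ Covec)) (ψ + ψ')
    = CliffordAlgebra.reverse (Q := (0 : QuadraticForm ℝ Covec)) ψ
      + CliffordAlgebra.reverse (Q := (0 : QuadraticForm ℝ Covec)) ψ' := map_add _ _ _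
  rw [metricContract, this]
  exact congrArg (fun f : Module.End ℝ Form => f χ) (map_add (contractHom A B) _ _)

lemma metricContract_smul_left (A B : Fin 3 → ℝ) (r : ℝ) (ψ χ : Form) :
    metricContract A B (r • ψ) χ = r • metricContract A B ψ χ := by
  have : CliffordAlgebra.reverse (Q := (0 : QuadraticForm ℝ Covec)) (r • ψ)
    = r • CliffordAlgebra.reverse (Q := (0 : QuadraticForm ℝ Covec)) ψ := map_smul _ _ _
  rw [metricContract, this]
  exact congrArg (fun f : Module.End ℝ Form => f χ) (map_smul (contractHom A B) _ _)

/-- The frame is orthogonal, so `♯` only rescales each dual vector. Peeling off one factor at a time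
evaluates the Hodge star and inner products on monomials. -/
lemma metricContract_gen_mul (A B : Fin 3 → ℝ) (i : Fin 7) (ψ χ : Form) :
    metricContract A B (gen i * ψ) χ
      = lenSq A B i • metricContract A B ψ (contract (dualVec i) χ) := by
  have h1 : CliffordAlgebra.reverse (Q := (0 : QuadraticForm ℝ Covec)) (gen i * ψ)
    = CliffordAlgebra.reverse (Q := (0 : QuadraticForm ℝ Covec)) ψ * gen i := by
    rw [← reverse_gen i]
    simpa [reverse_gen] using
      CliffordAlgebra.reverse.map_mul (Q := (0 : QuadraticForm ℝ Covec)) (gen i) ψ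
  have h2 := map_mul (contractHom A B)
    (CliffordAlgebra.reverse (Q := (0 : QuadraticForm ℝ Covec)) ψ) (gen i)
  rw [metricContract, h1]
  refine (congrArg (fun f : Module.End ℝ Form => f χ) h2).trans ?_
  rw [contractHom_gen]
  simp [metricContract]

lemma metricContract_gen (A B : Fin 3 → ℝ) (i : Fin 7) (χ : Form) :
    metricContract A B (gen i) χ = lenSq A B i • contract (dualVec i) χ := by
  rw [metricContract, reverse_gen, contractHom_gen, LinearMap.smul_apply]

lemma e_eq_gen : e 0 = gen 2 + gen 1 ∧ e 1 = gen 4 + gen 3 ∧ e 2 = gen 6 + gen 5 := by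
  obtain ⟨h0, h1, h2⟩ := eMinus_eq_gen
  obtain ⟨k0, k1, k2⟩ := ePlus_eq_gen
  rw [← h0, ← h1, ← h2, ← k0, ← k1, ← k2]
  simp only [ePlus, eMinus]
  refine ⟨?_, ?_, ?_⟩ <;> module

lemma e'_eq_gen : e' 0 = gen 2 - gen 1 ∧ e' 1 = gen 4 - gen 3 ∧ e' 2 = gen 6 - gen 5 := by
  obtain ⟨h0, h1, h2⟩ := eMinus_eq_gen
  obtain ⟨k0, k1, k2⟩ := ePlus_eq_gen
  rw [← h0, ← h1, ← h2, ← k0, ← k1, ← k2]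
  simp only [ePlus, eMinus]
  refine ⟨?_, ?_, ?_⟩ <;> module

lemma contract_add (X Y : Module.Dual ℝ Covec) (ψ : Form) :
    contract (X + Y) ψ = contract X ψ + contract Y ψ := by
  simp [contract]

lemma contract_sub (X Y : Module.Dual ℝ Covec) (ψ : Form) :
    contract (X - Y) ψ = contract X ψ - contract Y ψ := by
  simp [contract]

/-- The exterior derivative in terms of `e_i^±`. -/
lemma dInv_eq_gen (ψ : Form) : dInv ψ =
    -((gen 4 * gen 6 + gen 3 * gen 5) * contract (dualVec 2) ψ)
      - (gen 4 * gen 5 + gen 3 * gen 6) * contract (dualVec 1) ψ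
      - (gen 6 * gen 2 + gen 5 * gen 1) * contract (dualVec 4) ψ
      - (gen 6 * gen 1 + gen 5 * gen 2) * contract (dualVec 3) ψ
      - (gen 2 * gen 4 + gen 1 * gen 3) * contract (dualVec 6) ψ
      - (gen 2 * gen 3 + gen 1 * gen 4) * contract (dualVec 5) ψ := by
  obtain ⟨h0, h1, h2⟩ := e_eq_gen
  obtain ⟨k0, k1, k2⟩ := e'_eq_gen
  have a2 : (0 : Fin 3) + 2 = 2 := rfl
  have a3 : (1 : Fin 3) + 1 = 2 := rfl
  have a4 : (1 : Fin 3) + 2 = 0 := rfl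
  have a5 : (2 : Fin 3) + 1 = 0 := rfl
  have a6 : (2 : Fin 3) + 2 = 1 := rfl
  simp only [dInv, Fin.sum_univ_three, zero_add, a2, a3, a4, a5, a6, h0, h1, h2, k0, k1, k2,
    dualVec, Matrix.cons_val, contract_add, contract_sub]
  simp only [mul_add, add_mul, mul_sub, sub_mul, neg_mul, neg_add, neg_sub]
  module

lemma dInv_gen : dInv (gen 2) = -(gen 4 * gen 6 + gen 3 * gen 5)
    ∧ dInv (gen 1) = -(gen 4 * gen 5 + gen 3 * gen 6)
    ∧ dInv (gen 4) = -(gen 6 * gen 2 + gen 5 * gen 1)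
    ∧ dInv (gen 3) = -(gen 6 * gen 1 + gen 5 * gen 2)
    ∧ dInv (gen 6) = -(gen 2 * gen 4 + gen 1 * gen 3)
    ∧ dInv (gen 5) = -(gen 2 * gen 3 + gen 1 * gen 4) := by
  refine ⟨?_, ?_, ?_, ?_, ?_, ?_⟩ <;> simp [dInv_eq_gen, contract_gen]

lemma dInv_add (ψ χ : Form) : dInv (ψ + χ) = dInv ψ + dInv χ := by
  simp only [dInv_eq_gen, map_add, mul_add]; abel

lemma dInv_smul (r : ℝ) (ψ : Form) : dInv (r • ψ) = r • dInv ψ := by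
  simp only [dInv_eq_gen, map_smul, mul_smul_comm]; module

end InvForm

/-! ### The `G₂`-form, its Hodge dual and `F_A ∧ ⋆φ` -/

namespace B7.Metric
open InvForm
variable (S : Metric)

/-- The `G₂`-structure in terms of `dt` and `e_i^±`. -/
lemma phi_eq_gen (t : ℝ) : S.phi t =
    (2 * deriv S.a t) • (gen 0 * (gen 1 * gen 2)) + (2 * deriv S.a t) • (gen 0 * (gen 3 * gen 4))
      + (2 * deriv S.b t) • (gen 0 * (gen 5 * gen 6))
      + (2 * (2 * S.a t + S.b t + S.p)) • (gen 1 * (gen 3 * gen 5))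
      - (2 * (S.b t - S.p)) • (gen 1 * (gen 4 * gen 6))
      - (2 * (S.b t - S.p)) • (gen 2 * (gen 3 * gen 6))
      - (2 * (2 * S.a t - S.b t - S.p)) • (gen 2 * (gen 4 * gen 5)) := by
  obtain ⟨h0, h1, h2⟩ := e_eq_gen
  obtain ⟨k0, k1, k2⟩ := e'_eq_gen
  have hq : S.q = -S.p := rfl
  simp only [phi, h0, h1, h2, k0, k1, k2, dt_eq_gen, dInv_eq_gen, hq]
  simp (discharger := decide) only [mul_add, add_mul, mul_sub, sub_mul, mul_assoc, map_add,
    gen_mul_self, gen_swap, gen_swap_mul, Fin.reduceEq, if_true, if_false, mul_neg, neg_mul,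
    mul_one, mul_zero, sub_zero, zero_sub, neg_neg, neg_zero, add_zero, zero_add, sub_neg_eq_add,
    neg_add, contract_gen_mul, contract_gen]
  module

end B7.Metric

namespace InvForm

lemma vol_eq_gen (A B : Fin 3 → ℝ) : vol A B = (A 0 * B 0 * (A 1 * B 1) * (A 2 * B 2)) •
    (gen 0 * (gen 1 * (gen 2 * (gen 3 * (gen 4 * (gen 5 * gen 6)))))) := by
  obtain ⟨h0, h1, h2⟩ := eMinus_eq_gen
  obtain ⟨k0, k1, k2⟩ := ePlus_eq_gen
  rw [vol, h0, h1, h2, k0, k1, k2, dt_eq_gen]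
  simp only [mul_assoc]

lemma metricContract_sub_left (A B : Fin 3 → ℝ) (ψ ψ' χ : Form) :
    metricContract A B (ψ - ψ') χ = metricContract A B ψ χ - metricContract A B ψ' χ := by
  rw [sub_eq_add_neg, ← neg_one_smul ℝ ψ', metricContract_add_left, metricContract_smul_left]
  module

/-- The four-form dual to the standard `G₂`-form. -/
def modelStar (A₁ A₃ B₁ B₃ : ℝ) : Form :=
  (A₁ * B₁ * (A₃ * B₃)) • (gen 3 * (gen 4 * (gen 5 * gen 6)))
    + (A₁ * B₁ * (A₃ * B₃)) • (gen 1 * (gen 2 * (gen 5 * gen 6)))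
    + (A₁ * B₁ * (A₁ * B₁)) • (gen 1 * (gen 2 * (gen 3 * gen 4)))
    - (A₁ * B₁ * B₃) • (gen 0 * (gen 2 * (gen 3 * gen 5)))
    - (A₁ * B₁ * B₃) • (gen 0 * (gen 1 * (gen 4 * gen 5)))
    - (B₁ * B₁ * A₃) • (gen 0 * (gen 1 * (gen 3 * gen 6)))
    + (A₁ * A₁ * A₃) • (gen 0 * (gen 2 * (gen 4 * gen 6)))

/-- Each coefficient is the product of the lengths of the three coframe members in its monomial, so
this is the standard `G₂`-form of the orthonormal coframe `dt`, `Bᵢeᵢ⁻`, `Aᵢeᵢ⁺`. -/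
lemma hodge_model {A₁ A₃ B₁ B₃ : ℝ} (hA₁ : A₁ ≠ 0) (hA₃ : A₃ ≠ 0) (hB₁ : B₁ ≠ 0) (hB₃ : B₃ ≠ 0) :
    hodge ![A₁, A₁, A₃] ![B₁, B₁, B₃]
      ((A₁ * B₁) • (gen 0 * (gen 1 * gen 2)) + (A₁ * B₁) • (gen 0 * (gen 3 * gen 4))
      + (A₃ * B₃) • (gen 0 * (gen 5 * gen 6))
      + (B₁ * B₁ * B₃) • (gen 1 * (gen 3 * gen 5))
      - (A₁ * A₃ * B₁) • (gen 1 * (gen 4 * gen 6))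
      - (A₁ * A₃ * B₁) • (gen 2 * (gen 3 * gen 6))
      - (A₁ * A₁ * B₃) • (gen 2 * (gen 4 * gen 5)))
    = modelStar A₁ A₃ B₁ B₃ := by
  simp only [hodge, vol_eq_gen, metricContract_add_left, metricContract_sub_left,
    metricContract_smul_left, metricContract_gen_mul, metricContract_gen, map_smul]
  simp only [contract_gen_mul, contract_gen, Fin.reduceEq, if_true, if_false, zero_sub, sub_zero,
    mul_neg, neg_neg, mul_zero, mul_one, map_neg, lenSq, Matrix.cons_val, modelStar,
    smul_smul]
  match_scalars <;> field_simp

/-- Contracting with the dual frame along one monomial kills the other and leaves a scalar. -/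
lemma gen_sixfold_independent {x y : ℝ} {j k l m : Fin 7} {i i' : Fin 7}
    (h0 : x • (gen 0 * (gen i * (gen j * (gen k * (gen l * gen m)))))
      + y • (gen 0 * (gen i' * (gen j * (gen k * (gen l * gen m))))) = 0)
    (hii : i ≠ i') (hi : 0 ≠ i ∧ 0 ≠ i') (h0j : 0 ≠ j ∧ 0 ≠ k ∧ 0 ≠ l ∧ 0 ≠ m)
    (hij : i ≠ j ∧ i ≠ k ∧ i ≠ l ∧ i ≠ m) (hij' : i' ≠ j ∧ i' ≠ k ∧ i' ≠ l ∧ i' ≠ m)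
    (hj : j ≠ k ∧ j ≠ l ∧ j ≠ m) (hk : k ≠ l ∧ k ≠ m) (hl : l ≠ m) : x = 0 ∧ y = 0 := by
  have key : ∀ z : ℝ, z • (1 : Form) = 0 → z = 0 := fun z hz => by
    simpa using hz
  constructor
  · have := congrArg (fun ψ => contract (dualVec m) (contract (dualVec l) (contract (dualVec k)
      (contract (dualVec j) (contract (dualVec i) (contract (dualVec 0) ψ)))))) h0
    simp [contract_gen_mul, contract_gen, hii, hi, h0j, hij, hj, hk, hl] at this
    exact this
  · have := congrArg (fun ψ => contract (dualVec m) (contract (dualVec l) (contract (dualVec k)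
      (contract (dualVec j) (contract (dualVec i') (contract (dualVec 0) ψ)))))) h0
    simp [contract_gen_mul, contract_gen, hii.symm, hi, h0j, hij', hj, hk, hl] at this
    exact this

/-- The `E_1`-component of `F_A ∧ ⋆φ`. -/
lemma curvature_mul_modelStar_fst (A₁ A₃ B₁ B₃ P M Q N dP dM : ℝ) :
    (gen 0 * (dP • gen 2 + dM • gen 1) + dInv (P • gen 2 + M • gen 1)
      + (P • gen 4 + M • gen 3) * (Q • gen 6 + N • gen 5)) * modelStar A₁ A₃ B₁ B₃
    = (A₁ * B₁ * (A₃ * B₃) * dP - A₁ * B₁ * B₃ * (P - P * Q) - A₁ * A₁ * A₃ * (M * N - P)) •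
        (gen 0 * (gen 2 * (gen 3 * (gen 4 * (gen 5 * (gen 6))))))
      + (A₁ * B₁ * (A₃ * B₃) * dM - A₁ * B₁ * B₃ * (M * Q - M) - B₁ * B₁ * A₃ * (P * N - M)) •
        (gen 0 * (gen 1 * (gen 3 * (gen 4 * (gen 5 * (gen 6)))))) := by
  obtain ⟨h1, h2, -⟩ := dInv_gen
  simp only [dInv_add, dInv_smul, h1, h2, modelStar]
  simp (discharger := decide) only [mul_add, add_mul, mul_sub, mul_assoc, gen_mul_self,
    gen_mul_self_mul, gen_swap, gen_swap_mul, mul_neg, neg_mul, mul_zero, neg_neg, neg_zero,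
    smul_mul_assoc, mul_smul_comm, smul_zero, add_zero, zero_add, smul_add,
    smul_neg, neg_add]
  match_scalars <;> ring

/-- The `E_2`-component of `F_A ∧ ⋆φ`. -/
lemma curvature_mul_modelStar_snd (A₁ A₃ B₁ B₃ P M Q N dP dM : ℝ) :
    (gen 0 * (dP • gen 4 + dM • gen 3) + dInv (P • gen 4 + M • gen 3)
      + (Q • gen 6 + N • gen 5) * (P • gen 2 + M • gen 1)) * modelStar A₁ A₃ B₁ B₃
    = (A₁ * B₁ * (A₃ * B₃) * dP - A₁ * B₁ * B₃ * (P - P * Q) - A₁ * A₁ * A₃ * (M * N - P)) •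
        (gen 0 * (gen 4 * (gen 1 * (gen 2 * (gen 5 * (gen 6))))))
      + (A₁ * B₁ * (A₃ * B₃) * dM - A₁ * B₁ * B₃ * (M * Q - M) - B₁ * B₁ * A₃ * (P * N - M)) •
        (gen 0 * (gen 3 * (gen 1 * (gen 2 * (gen 5 * (gen 6)))))) := by
  obtain ⟨-, -, h1, h2, -⟩ := dInv_gen
  simp only [dInv_add, dInv_smul, h1, h2, modelStar]
  simp (discharger := decide) only [mul_add, add_mul, mul_sub, mul_assoc, gen_mul_self,
    gen_mul_self_mul, gen_swap, gen_swap_mul, mul_neg, neg_mul, mul_zero, neg_neg, neg_zero,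
    smul_mul_assoc, mul_smul_comm, smul_zero, add_zero, zero_add, smul_add,
    smul_neg, neg_add]
  match_scalars <;> ring

/-- The `E_3`-component of `F_A ∧ ⋆φ`. -/
lemma curvature_mul_modelStar_trd (A₁ A₃ B₁ B₃ P M Q N dQ dN : ℝ) :
    (gen 0 * (dQ • gen 6 + dN • gen 5) + dInv (Q • gen 6 + N • gen 5)
      + (P • gen 2 + M • gen 1) * (P • gen 4 + M • gen 3)) * modelStar A₁ A₃ B₁ B₃
    = (A₁ * B₁ * (A₁ * B₁) * dQ - B₁ * B₁ * A₃ * (Q - P * P) - A₁ * A₁ * A₃ * (M * M - Q)) •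
        (gen 0 * (gen 6 * (gen 1 * (gen 2 * (gen 3 * (gen 4))))))
      + (A₁ * B₁ * (A₁ * B₁) * dN - 2 * (A₁ * B₁ * B₃) * (P * M - N)) •
        (gen 0 * (gen 5 * (gen 1 * (gen 2 * (gen 3 * (gen 4)))))) := by
  obtain ⟨-, -, -, -, h1, h2⟩ := dInv_gen
  simp only [dInv_add, dInv_smul, h1, h2, modelStar]
  simp (discharger := decide) only [mul_add, add_mul, mul_sub, mul_assoc, gen_mul_self,
    gen_mul_self_mul, gen_swap, gen_swap_mul, mul_neg, neg_mul, mul_zero, neg_neg, neg_zero,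
    smul_mul_assoc, mul_smul_comm, smul_zero, add_zero, zero_add, smul_add,
    smul_neg, neg_add]
  match_scalars <;> ring

/-- The indices are distinct, so the three monomials are mutually orthogonal and only the diagonal
terms survive. -/
lemma formInner_model (A B : Fin 3 → ℝ) (x y z : ℝ) {i j k l m : Fin 7}
    (h : 0 ≠ i ∧ 0 ≠ j ∧ 0 ≠ k ∧ 0 ≠ l ∧ 0 ≠ m) (hi : i ≠ j ∧ i ≠ k ∧ i ≠ l ∧ i ≠ m)
    (hj : j ≠ k ∧ j ≠ l ∧ j ≠ m) (hk : k ≠ l ∧ k ≠ m) (hl : l ≠ m) :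
    formInner A B (x • (gen 0 * gen i) + y • (gen j * gen k) + z • (gen l * gen m))
      (x • (gen 0 * gen i) + y • (gen j * gen k) + z • (gen l * gen m))
    = x ^ 2 * lenSq A B i + y ^ 2 * (lenSq A B j * lenSq A B k)
      + z ^ 2 * (lenSq A B l * lenSq A B m) := by
  obtain ⟨a1, a2, a3, a4, a5⟩ := h
  obtain ⟨b1, -, b3, -⟩ := hi
  obtain ⟨c1, c2, c3⟩ := hj
  simp [formInner, metricContract_add_left, metricContract_smul_left, metricContract_gen_mul,
    metricContract_gen, contract_gen_mul, contract_gen, a1, a2, a3, a4, a5, c1, c2, c3, hl,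
    a2.symm, a4.symm, b1.symm, b3.symm, c2.symm, hk.1.symm]
  simp [lenSq]
  ring

end InvForm

/-! ### Differentiating expansions at `0`, and monotonicity from derivatives -/

lemma eq_zero_of_pow_isBigO {c : ℝ} {n : ℕ}
    (h : (fun t : ℝ => c * t ^ n) =O[𝓝[>] 0] (fun t => t ^ (n + 1))) : c = 0 := by
  have h1 : (fun t : ℝ => t ^ (n + 1)) =o[𝓝[>] 0] (fun t => t ^ n) :=
    (Asymptotics.isLittleO_pow_pow (Nat.lt_succ_self n)).mono nhdsWithin_le_nhds
  have h2 : (fun _ : ℝ => c) =o[𝓝[>] 0] (fun _ => (1 : ℝ)) := by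
    have h3 := (h.trans_isLittleO h1).mul_isBigO (isBigO_refl (fun t : ℝ => (t ^ n)⁻¹) (𝓝[>] 0))
    refine h3.congr' ?_ ?_ <;>
    · filter_upwards [self_mem_nhdsWithin] with t ht
      have : t ≠ 0 := ne_of_gt ht
      field_simp
  simpa using (isLittleO_const_const_iff.1 h2)

lemma taylor_isBigO {g : ℝ → ℝ} (hg : ContDiffOn ℝ ∞ g (Icc 0 1)) (n : ℕ) :
    (fun t => g t - taylorWithinEval g n (Icc 0 1) 0 t) =O[𝓝[>] 0] (fun t => t ^ (n + 1)) := by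
  obtain ⟨C, hC⟩ := exists_taylor_mean_remainder_bound (n := n) zero_le_one
    (hg.of_le (by exact_mod_cast le_top))
  refine IsBigO.of_bound C ?_
  filter_upwards [Ioo_mem_nhdsGT (zero_lt_one' ℝ)] with t ht
  have := hC t (Ioo_subset_Icc_self ht)
  rw [sub_zero] at this
  rwa [Real.norm_of_nonneg (pow_nonneg ht.1.le _)]

lemma taylorWithinEval_eq {g : ℝ → ℝ} {s : Set ℝ} {n : ℕ}
    (h : ∀ k < n, iteratedDerivWithin k g s 0 = 0) (t : ℝ) :
    taylorWithinEval g n s 0 t = ((n.factorial : ℝ))⁻¹ * iteratedDerivWithin n g s 0 * t ^ n := by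
  rw [taylor_within_apply, Finset.sum_range_succ, Finset.sum_eq_zero]
  · simp; ring
  · intro k hk
    rw [h k (Finset.mem_range.1 hk), smul_zero]

lemma iteratedDerivWithin_eq_zero_of_isBigO {g : ℝ → ℝ} (hg : ContDiffOn ℝ ∞ g (Icc 0 1)) {n : ℕ}
    (h : g =O[𝓝[>] 0] (fun t => t ^ (n + 1))) :
    ∀ k ≤ n, iteratedDerivWithin k g (Icc 0 1) 0 = 0 := by
  intro k
  induction k using Nat.strong_induction_on with
  | _ k ih =>
    intro hk
    have h1 := taylor_isBigO hg k
    have h2 : (fun t : ℝ => t ^ (n + 1)) =O[𝓝[>] 0] (fun t => t ^ (k + 1)) :=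
      (IsBigO.of_bound 1 (by
        filter_upwards [Ioo_mem_nhdsGT (zero_lt_one' ℝ)] with t ht
        rw [one_mul, norm_pow, norm_pow, Real.norm_of_nonneg ht.1.le]
        exact pow_le_pow_of_le_one ht.1.le ht.2.le (by omega)))
    -- By induction the Taylor polynomial of order `k` is its top term alone, and it is now `O(t ^
    -- (k + 1))`.
    have h3 := (h.trans h2).sub h1
    simp only [sub_sub_cancel] at h3
    have h4 := eq_zero_of_pow_isBigO (h3.congr_left
      (taylorWithinEval_eq (fun j hj => ih j hj (by omega))))
    simpa [Nat.factorial_ne_zero] using h4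

/-- Smoothness up to `0` is what allows the estimate to be differentiated: the bound kills the
Taylor coefficients of `g` up to order `n + 1`, hence those of the derivative up to order `n`. -/
lemma deriv_isBigO_of_isBigO {g : ℝ → ℝ} (hg : ContDiffOn ℝ ∞ g (Ici 0)) {n : ℕ}
    (h : g =O[𝓝[>] 0] (fun t => t ^ (n + 2))) : deriv g =O[𝓝[>] 0] (fun t => t ^ (n + 1)) := by
  have hg' : ContDiffOn ℝ ∞ g (Icc 0 1) := hg.mono Icc_subset_Ici_self
  have hz := iteratedDerivWithin_eq_zero_of_isBigO hg' h
  have hd : ContDiffOn ℝ ∞ (derivWithin g (Icc 0 1)) (Icc 0 1) :=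
    hg'.derivWithin (uniqueDiffOn_Icc zero_lt_one) (by simp)
  have h1 := taylor_isBigO hd n
  have h2 : ∀ t, taylorWithinEval (derivWithin g (Icc 0 1)) n (Icc 0 1) 0 t = 0 := by
    intro t
    rw [taylor_within_apply]
    refine Finset.sum_eq_zero fun k hk => ?_
    rw [← iteratedDerivWithin_succ', hz _ (by simpa using hk), smul_zero]
  simp only [h2, sub_zero] at h1
  refine h1.congr' ?_ EventuallyEq.rfl
  filter_upwards [Ioo_mem_nhdsGT (zero_lt_one' ℝ)] with t ht
  exact derivWithin_of_mem_nhds (Icc_mem_nhds ht.1 ht.2)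

lemma tendsto_div_pow_of_isBigO {f : ℝ → ℝ} {k : ℝ} {n m : ℕ} (hnm : n < m)
    (h : (fun t => f t - k * t ^ n) =O[𝓝[>] 0] (fun t => t ^ m)) :
    Tendsto (fun t => f t / t ^ n) (𝓝[>] 0) (𝓝 k) := by
  have h1 : (fun t : ℝ => t ^ m) =o[𝓝[>] 0] (fun t => t ^ n) :=
    (Asymptotics.isLittleO_pow_pow hnm).mono nhdsWithin_le_nhds
  have h2 := (h.trans_isLittleO h1).tendsto_div_nhds_zero
  have h3 := h2.add_const k
  rw [zero_add] at h3
  refine h3.congr' ?_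
  filter_upwards [self_mem_nhdsWithin] with t ht
  have : t ≠ 0 := ne_of_gt ht
  field_simp
  ring

lemma monotoneOn_of_hasDerivAt {I : Set ℝ} (hI : Convex ℝ I) {f f' : ℝ → ℝ}
    (h : ∀ t ∈ I, HasDerivAt f (f' t) t) (h' : ∀ t ∈ I, 0 ≤ f' t) : MonotoneOn f I :=
  monotoneOn_of_deriv_nonneg hI (fun t ht => (h t ht).continuousAt.continuousWithinAt)
    (fun t ht => (h t (interior_subset ht)).differentiableAt.differentiableWithinAt)
    (fun t ht => by rw [(h t (interior_subset ht)).deriv]; exact h' t (interior_subset ht))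

lemma antitoneOn_of_hasDerivAt {I : Set ℝ} (hI : Convex ℝ I) {f f' : ℝ → ℝ}
    (h : ∀ t ∈ I, HasDerivAt f (f' t) t) (h' : ∀ t ∈ I, f' t ≤ 0) : AntitoneOn f I :=
  antitoneOn_of_deriv_nonpos hI (fun t ht => (h t ht).continuousAt.continuousWithinAt)
    (fun t ht => (h t (interior_subset ht)).differentiableAt.differentiableWithinAt)
    (fun t ht => by rw [(h t (interior_subset ht)).deriv]; exact h' t (interior_subset ht))

lemma eq_limit_of_hasDerivAt_zero {f : ℝ → ℝ} {T l : ℝ} (h : ∀ t ∈ Ioo 0 T, HasDerivAt f 0 t)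
    (hl : Tendsto f (𝓝[>] 0) (𝓝 l)) : ∀ t ∈ Ioo 0 T, f t = l := by
  intro t ht
  refine tendsto_nhds_unique (tendsto_const_nhds.congr' ?_) hl
  filter_upwards [Ioo_mem_nhdsGT (ht.1.trans ht.2)] with r hr
  refine le_antisymm ?_ ?_
  · rcases le_total t r with h1 | h1
    · exact monotoneOn_of_hasDerivAt (convex_Ioo 0 T) h (fun _ _ => le_rfl) ht hr h1
    · exact antitoneOn_of_hasDerivAt (convex_Ioo 0 T) h (fun _ _ => le_rfl) hr ht h1
  · rcases le_total t r with h1 | h1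
    · exact antitoneOn_of_hasDerivAt (convex_Ioo 0 T) h (fun _ _ => le_rfl) ht hr h1
    · exact monotoneOn_of_hasDerivAt (convex_Ioo 0 T) h (fun _ _ => le_rfl) hr ht h1

/-! ### The Hitchin flow: expansions, positivity and the Hamiltonian constraint -/

namespace B7.Metric
variable (S : Metric)

/-- `u = b - p`. -/
def u (t : ℝ) : ℝ := S.b t - S.p

/-- `v = 2a - b - p`. -/
def v (t : ℝ) : ℝ := 2 * S.a t - S.b t - S.p

/-- `w = 2a + b + p`. -/
def w (t : ℝ) : ℝ := 2 * S.a t + S.b t + S.p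

lemma p_pos : 0 < S.p := pow_pos S.r₀_pos 3

lemma hitchinF_eq (y z : ℝ) : hitchinF (S.r₀ ^ 3) (-S.r₀ ^ 3) y z
    = (z - S.p) ^ 2 * (2 * y - z - S.p) * (2 * y + z + S.p) := by
  simp only [hitchinF, p]; ring

lemma contDiffAt_a {t : ℝ} (ht : 0 < t) : ContDiffAt ℝ ∞ S.a t :=
  S.smooth_a.contDiffAt (Ici_mem_nhds ht)

lemma contDiffAt_b {t : ℝ} (ht : 0 < t) : ContDiffAt ℝ ∞ S.b t :=
  S.smooth_b.contDiffAt (Ici_mem_nhds ht)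

lemma contDiffAt_deriv {f : ℝ → ℝ} {t : ℝ} (hf : ContDiffAt ℝ ∞ f t) :
    ContDiffAt ℝ ∞ (deriv f) t := by
  have h := (hf.fderiv_right (m := ∞) (by simp)).clm_apply (contDiffAt_const (c := (1 : ℝ)))
  simpa using h

lemma hasDerivAt_a {t : ℝ} (ht : 0 < t) : HasDerivAt S.a (deriv S.a t) t :=
  ((S.contDiffAt_a ht).differentiableAt (by simp)).hasDerivAt

lemma hasDerivAt_b {t : ℝ} (ht : 0 < t) : HasDerivAt S.b (deriv S.b t) t :=
  ((S.contDiffAt_b ht).differentiableAt (by simp)).hasDerivAt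

lemma differentiableAt_deriv_a {t : ℝ} (ht : 0 < t) : DifferentiableAt ℝ (deriv S.a) t :=
  (contDiffAt_deriv (S.contDiffAt_a ht)).differentiableAt (by simp)

lemma differentiableAt_deriv_b {t : ℝ} (ht : 0 < t) : DifferentiableAt ℝ (deriv S.b) t :=
  (contDiffAt_deriv (S.contDiffAt_b ht)).differentiableAt (by simp)

/-! ### Behaviour at the singular orbit -/

lemma pow_isBigO_pow {m n : ℕ} (h : m ≤ n) :
    (fun t : ℝ => t ^ n) =O[𝓝[>] 0] (fun t => t ^ m) :=
  IsBigO.of_bound 1 (by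
    filter_upwards [Ioo_mem_nhdsGT (zero_lt_one' ℝ)] with t ht
    rw [one_mul, norm_pow, norm_pow, Real.norm_of_nonneg ht.1.le]
    exact pow_le_pow_of_le_one ht.1.le ht.2.le h)

lemma expansion_u : (fun t => S.u t - S.r₀ / 4 * t ^ 2) =O[𝓝[>] 0] (fun t => t ^ 4) := by
  have h := (S.expansion_b.trans (pow_isBigO_pow (show 4 ≤ 6 by norm_num))).add
    (isBigO_const_mul_self S.bBar (fun t : ℝ => t ^ 4) (𝓝[>] 0))
  refine h.congr_left fun t => ?_
  simp only [u, p]; ring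

lemma expansion_a_sub : (fun t => (S.a t - S.p) - S.r₀ / 4 * t ^ 2) =O[𝓝[>] 0] (fun t => t ^ 4) := by
  have h := (S.expansion_a.trans (pow_isBigO_pow (show 4 ≤ 6 by norm_num))).add
    (isBigO_const_mul_self S.aBar (fun t : ℝ => t ^ 4) (𝓝[>] 0))
  refine h.congr_left fun t => ?_
  simp only [p]; ring

lemma expansion_a_sub_b : (fun t => (S.a t - S.b t) - (S.aBar - S.bBar) * t ^ 4)
    =O[𝓝[>] 0] (fun t => t ^ 6) := by
  refine (S.expansion_a.sub S.expansion_b).congr_left fun t => ?_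
  ring

/-- Supplies the leading terms of `ȧ`, `ḃ` and `ȧ - ḃ` from those of `a`, `b` and `a - b`. -/
lemma expansion_deriv {f : ℝ → ℝ} (hf : ContDiffOn ℝ ∞ f (Ici 0)) {c k : ℝ} {n m : ℕ}
    (h : (fun t => f t - c - k * t ^ (n + 1)) =O[𝓝[>] 0] (fun t => t ^ (m + 2))) :
    (fun t => deriv f t - k * (n + 1) * t ^ n) =O[𝓝[>] 0] (fun t => t ^ (m + 1)) := by
  have h1 := deriv_isBigO_of_isBigO (g := fun t => f t - c - k * t ^ (n + 1))
    ((hf.sub contDiffOn_const).sub (by fun_prop)) h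
  refine h1.congr' ?_ EventuallyEq.rfl
  filter_upwards [self_mem_nhdsWithin] with t ht
  have hd := ((hf.contDiffAt (Ici_mem_nhds ht)).differentiableAt (by simp)).hasDerivAt
  refine (((hd.sub_const c).sub ((hasDerivAt_pow (n + 1) t).const_mul k)).deriv).trans ?_
  push_cast; simp; ring

lemma tendsto_u : Tendsto (fun t => S.u t / t ^ 2) (𝓝[>] 0) (𝓝 (S.r₀ / 4)) :=
  tendsto_div_pow_of_isBigO (by norm_num) S.expansion_u

lemma tendsto_v : Tendsto (fun t => S.v t / t ^ 2) (𝓝[>] 0) (𝓝 (S.r₀ / 4)) := by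
  refine tendsto_div_pow_of_isBigO (m := 4) (by norm_num) ?_
  refine ((S.expansion_a_sub.const_mul_left 2).sub S.expansion_u).congr_left fun t => ?_
  simp only [u, v]; ring

lemma tendsto_a : Tendsto S.a (𝓝[>] 0) (𝓝 S.p) := by
  have h1 := tendsto_div_pow_of_isBigO (n := 0) (k := 0) (m := 2) (f := fun t => S.a t - S.p)
    (by norm_num) (by
      have := (S.expansion_a_sub.trans (pow_isBigO_pow (show 2 ≤ 4 by norm_num))).add
        (isBigO_const_mul_self (S.r₀ / 4) (fun t : ℝ => t ^ 2) (𝓝[>] 0))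
      simpa using this)
  simpa using h1.add_const S.p

lemma tendsto_u_zero : Tendsto S.u (𝓝[>] 0) (𝓝 0) := by
  have h2 : Tendsto (fun t : ℝ => t ^ 2) (𝓝[>] 0) (𝓝 0) :=
    tendsto_nhdsWithin_of_tendsto_nhds (by simpa using (continuous_pow 2).tendsto (0 : ℝ))
  have h := S.tendsto_u.mul h2
  rw [mul_zero] at h
  refine h.congr' ?_
  filter_upwards [self_mem_nhdsWithin] with t ht
  have : t ≠ 0 := ne_of_gt ht
  field_simp

lemma tendsto_w : Tendsto S.w (𝓝[>] 0) (𝓝 (4 * S.p)) := by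
  have h := ((S.tendsto_a.const_mul 2).add S.tendsto_u_zero).add_const (2 * S.p)
  refine (h.congr fun t => ?_).trans (by rw [show 2 * S.p + 0 + 2 * S.p = 4 * S.p by ring])
  simp only [u, w]; ring

lemma tendsto_deriv_a : Tendsto (fun t => deriv S.a t / t) (𝓝[>] 0) (𝓝 (S.r₀ / 2)) := by
  have h := expansion_deriv S.smooth_a (c := S.p) (k := S.r₀ / 4) (n := 1) (m := 2)
    S.expansion_a_sub
  have h2 := tendsto_div_pow_of_isBigO (by norm_num) h
  simp only [pow_one] at h2
  convert h2 using 2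
  push_cast; ring

lemma tendsto_deriv_b : Tendsto (fun t => deriv S.b t / t) (𝓝[>] 0) (𝓝 (S.r₀ / 2)) := by
  have h := expansion_deriv S.smooth_b (c := S.p) (k := S.r₀ / 4) (n := 1) (m := 2)
    S.expansion_u
  have h2 := tendsto_div_pow_of_isBigO (by norm_num) h
  simp only [pow_one] at h2
  convert h2 using 2
  push_cast; ring

lemma tendsto_a_sub_b :
    Tendsto (fun t => (S.a t - S.b t) / t ^ 4) (𝓝[>] 0) (𝓝 (S.aBar - S.bBar)) :=
  tendsto_div_pow_of_isBigO (by norm_num) S.expansion_a_sub_b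

lemma tendsto_deriv_a_sub_deriv_b :
    Tendsto (fun t => (deriv S.a t - deriv S.b t) / t ^ 3) (𝓝[>] 0)
      (𝓝 (4 * (S.aBar - S.bBar))) := by
  have h := expansion_deriv (S.smooth_a.sub S.smooth_b) (c := 0) (k := S.aBar - S.bBar) (n := 3)
    (m := 4) (by simpa using S.expansion_a_sub_b)
  have h2 := tendsto_div_pow_of_isBigO (by norm_num) h
  have h3 : (S.aBar - S.bBar) * (((3 : ℕ) : ℝ) + 1) = 4 * (S.aBar - S.bBar) := by push_cast; ring
  rw [h3] at h2
  refine h2.congr' ?_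
  filter_upwards [self_mem_nhdsWithin] with t ht
  have h4 : deriv (fun x => S.a x - S.b x) t = deriv S.a t - deriv S.b t :=
    ((S.hasDerivAt_a ht).sub (S.hasDerivAt_b ht)).deriv
  rw [h4]

/-! ### Positivity -/

lemma eventually_pos_of_tendsto_div {f : ℝ → ℝ} {k : ℝ} {n : ℕ} (hk : 0 < k)
    (h : Tendsto (fun t => f t / t ^ n) (𝓝[>] 0) (𝓝 k)) : ∀ᶠ t in 𝓝[>] 0, 0 < f t := by
  filter_upwards [h.eventually_const_lt hk, self_mem_nhdsWithin] with t h1 ht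
  exact (div_pos_iff_of_pos_right (pow_pos ht n)).1 h1

/-- The flow equation writes `ḃ` as a square divided by a square root. -/
lemma deriv_b_nonneg {t : ℝ} (ht : 0 < t) : 0 ≤ deriv S.b t := by
  rw [(S.flow_y₂ t ht).deriv]; positivity

lemma u_pos {t : ℝ} (ht : 0 < t) : 0 < S.u t := by
  have hm : MonotoneOn S.b (Ioi 0) := monotoneOn_of_hasDerivAt (convex_Ioi 0)
    (fun s hs => S.hasDerivAt_b hs) (fun s hs => S.deriv_b_nonneg hs)
  have h1 := eventually_pos_of_tendsto_div (by have := S.r₀_pos; positivity) S.tendsto_u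
  obtain ⟨s, h2, h3⟩ := (h1.and (Ioo_mem_nhdsGT ht)).exists
  exact h2.trans_le (sub_le_sub_right (hm h3.1 ht h3.2.le) _)

lemma b_gt {t : ℝ} (ht : 0 < t) : S.p < S.b t := sub_pos.1 (S.u_pos ht)

lemma vw_pos {t : ℝ} (ht : 0 < t) : 0 < S.v t * S.w t := by
  have h := S.nondegenerate t ht
  rw [hitchinF_eq, mul_assoc] at h
  exact (pos_iff_pos_of_mul_pos h).1 (pow_pos (S.u_pos ht) 2)

/-- `a` starts near `p > 0`. At a zero of `a` one would have `vw = -(b + p)² ≤ 0`, against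
non-degeneracy. -/
lemma a_pos {t : ℝ} (ht : 0 < t) : 0 < S.a t := by
  by_contra hneg
  have h1 := S.tendsto_a.eventually_const_lt S.p_pos
  obtain ⟨s, h2, h3⟩ := (h1.and (Ioo_mem_nhdsGT ht)).exists
  obtain ⟨r, hr, hr0⟩ := intermediate_value_Icc' h3.2.le
    (fun x hx => (S.hasDerivAt_a (h3.1.trans_le hx.1)).continuousAt.continuousWithinAt)
    (show (0 : ℝ) ∈ Icc (S.a t) (S.a s) from ⟨not_lt.1 hneg, h2.le⟩)
  have h4 := S.vw_pos (h3.1.trans_le hr.1)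
  simp only [v, w, hr0] at h4
  nlinarith [sq_nonneg (S.b r + S.p)]

lemma w_pos {t : ℝ} (ht : 0 < t) : 0 < S.w t := by
  have h1 := S.a_pos ht
  have h2 := S.b_gt ht
  have h3 := S.p_pos
  simp only [w]; linarith

lemma v_pos {t : ℝ} (ht : 0 < t) : 0 < S.v t :=
  (pos_iff_pos_of_mul_pos (S.vw_pos ht)).2 (S.w_pos ht)

/-- `√F`. -/
def sqrtF (t : ℝ) : ℝ := √(hitchinF (S.r₀ ^ 3) (-S.r₀ ^ 3) (S.a t) (S.b t))

lemma sqrtF_pos {t : ℝ} (ht : 0 < t) : 0 < S.sqrtF t := Real.sqrt_pos.2 (S.nondegenerate t ht)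

lemma sqrtF_sq {t : ℝ} (ht : 0 < t) : S.sqrtF t ^ 2 = S.u t ^ 2 * S.v t * S.w t := by
  rw [sqrtF, Real.sq_sqrt (S.nondegenerate t ht).le, hitchinF_eq]; rfl

lemma deriv_hitchinF_fst (y z : ℝ) :
    HasDerivAt (fun y => hitchinF (S.r₀ ^ 3) (-S.r₀ ^ 3) y z) (8 * y * (z - S.p) ^ 2) y := by
  have h := (((hasDerivAt_pow 2 y).const_mul 4).mul_const
    ((z - S.r₀ ^ 3) * (z + -S.r₀ ^ 3))).sub_const ((z ^ 2 + S.r₀ ^ 3 * -S.r₀ ^ 3) ^ 2)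
  refine (h.congr_deriv ?_).congr_of_eventuallyEq (Eventually.of_forall fun x => ?_)
  · simp only [p]; ring
  · simp only [hitchinF]; ring

lemma deriv_hitchinF_snd (y z : ℝ) :
    HasDerivAt (fun z => hitchinF (S.r₀ ^ 3) (-S.r₀ ^ 3) y z)
      (4 * (z - S.p) * (2 * y ^ 2 - z * (z + S.p))) z := by
  have h1 := (((hasDerivAt_id z).sub_const S.p).pow 2).const_mul (4 * y ^ 2)
  have h2 := (((hasDerivAt_id z).pow 2).sub_const (S.p ^ 2)).pow 2
  refine ((h1.sub h2).congr_deriv ?_).congr_of_eventuallyEq (Eventually.of_forall fun x => ?_)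
  · simp; ring
  · simp [hitchinF, p]; ring

/-- The flow equation for `x₁ = ȧḃ`. -/
lemma hasDerivAt_x₁ {t : ℝ} (ht : 0 < t) : HasDerivAt (fun s => deriv S.a s * deriv S.b s)
    (2 * S.a t * S.u t ^ 2 / S.sqrtF t) t := by
  refine (S.flow_x₁ t ht).congr_deriv ?_
  rw [(S.deriv_hitchinF_fst _ _).deriv]
  have := (S.sqrtF_pos ht).ne'
  rw [sqrtF] at *
  simp only [u]
  field_simp; ring

/-- The flow equation for `x₂ = ȧ²`. -/
lemma hasDerivAt_x₂ {t : ℝ} (ht : 0 < t) : HasDerivAt (fun s => deriv S.a s ^ 2)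
    (2 * S.u t * (2 * S.a t ^ 2 - S.b t * (S.b t + S.p)) / S.sqrtF t) t := by
  refine (S.flow_x₂ t ht).congr_deriv ?_
  rw [(S.deriv_hitchinF_snd _ _).deriv]
  have := (S.sqrtF_pos ht).ne'
  rw [sqrtF] at *
  simp only [u]
  field_simp; ring

lemma eventually_deriv_pos : ∀ᶠ t in 𝓝[>] 0, 0 < deriv S.a t ∧ 0 < deriv S.b t := by
  have h0 : 0 < S.r₀ / 2 := half_pos S.r₀_pos
  exact (eventually_pos_of_tendsto_div (n := 1) h0 (by simpa using S.tendsto_deriv_a)).and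
    (eventually_pos_of_tendsto_div (n := 1) h0 (by simpa using S.tendsto_deriv_b))

lemma monotoneOn_x₁ : MonotoneOn (fun s => deriv S.a s * deriv S.b s) (Ioi 0) :=
  monotoneOn_of_hasDerivAt (convex_Ioi 0) (fun _ hs => S.hasDerivAt_x₁ hs)
    (fun t ht => by
      have := S.a_pos ht
      have := S.sqrtF_pos ht
      positivity)

/-- `ȧḃ` is nondecreasing and positive near the singular orbit. -/
lemma x₁_pos {t : ℝ} (ht : 0 < t) : 0 < deriv S.a t * deriv S.b t := by
  obtain ⟨s, h2, h3⟩ := (S.eventually_deriv_pos.and (Ioo_mem_nhdsGT ht)).exists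
  exact (mul_pos h2.1 h2.2).trans_le (S.monotoneOn_x₁ h3.1 ht h3.2.le)

lemma deriv_b_pos {t : ℝ} (ht : 0 < t) : 0 < deriv S.b t :=
  (S.deriv_b_nonneg ht).lt_of_ne fun h => by simpa [← h] using S.x₁_pos ht

lemma deriv_a_pos {t : ℝ} (ht : 0 < t) : 0 < deriv S.a t :=
  (pos_iff_pos_of_mul_pos (S.x₁_pos ht)).2 (S.deriv_b_pos ht)

/-- Conservation of the Hamiltonian: `√F = 2 ȧ² ḃ`. -/
lemma sqrtF_eq {t : ℝ} (ht : 0 < t) : S.sqrtF t = 2 * deriv S.a t ^ 2 * deriv S.b t := by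
  -- The difference of the two sides has zero derivative by the flow equations, and both sides tend
  -- to `0` at the singular orbit.
  have key : ∀ r ∈ Ioo 0 (t + 1),
      HasDerivAt (fun s => S.sqrtF s - 2 * deriv S.a s ^ 2 * deriv S.b s) 0 r := by
    clear ht
    intro t ht
    have ht := ht.1
    have hF : HasDerivAt (fun s => hitchinF (S.r₀ ^ 3) (-S.r₀ ^ 3) (S.a s) (S.b s))
        (8 * S.a t * S.u t ^ 2 * deriv S.a t
          + 4 * S.u t * (2 * S.a t ^ 2 - S.b t * (S.b t + S.p)) * deriv S.b t) t := by
      have ha := S.hasDerivAt_a ht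
      have hb := S.hasDerivAt_b ht
      have h := (((hb.sub_const S.p).pow 2).mul (((ha.const_mul 2).sub hb).sub_const S.p)).mul
        (((ha.const_mul 2).add hb).add_const S.p)
      refine (h.congr_deriv ?_).congr_of_eventuallyEq (Eventually.of_forall fun x => ?_)
      · simp [u]; ring
      · simp [hitchinF_eq]
    have hs := hF.sqrt (S.nondegenerate t ht).ne'
    have hX := (S.differentiableAt_deriv_a ht).hasDerivAt
    have hY := (S.differentiableAt_deriv_b ht).hasDerivAt
    have e1 := (hX.mul hY).unique (S.hasDerivAt_x₁ ht)
    have e2 := (hX.pow 2).unique (S.hasDerivAt_x₂ ht)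
    refine (hs.sub (((hX.pow 2).const_mul 2).mul hY)).congr_deriv ?_
    have hne := (S.sqrtF_pos ht).ne'
    change _ / (2 * S.sqrtF t) - _ = 0
    rw [e2]
    -- The second derivative of `b` enters only through `ȧḃ`. It is isolated as `2ȧ²b̈ = 2ȧ(ȧḃ)˙ -
    -- ḃ(ȧ²)˙`, where both derivatives are known.
    have e3 : deriv S.a t * (2 * deriv S.a t * deriv (deriv S.b) t)
      = deriv S.a t * (2 * (2 * S.a t * S.u t ^ 2 / S.sqrtF t))
        - deriv S.b t * (2 * S.u t * (2 * S.a t ^ 2 - S.b t * (S.b t + S.p)) / S.sqrtF t) := by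
      rw [← e1, ← e2]; simp; ring
    have e4 : 2 * deriv S.a t ^ 2 * deriv (deriv S.b) t
      = deriv S.a t * (2 * deriv S.a t * deriv (deriv S.b) t) := by ring
    simp only [Pi.pow_apply]
    rw [e4, e3]
    field_simp
    ring
  have hlim : Tendsto (fun s => S.sqrtF s - 2 * deriv S.a s ^ 2 * deriv S.b s) (𝓝[>] 0) (𝓝 0) := by
    have hid : Tendsto (fun t : ℝ => t) (𝓝[>] 0) (𝓝 0) :=
      tendsto_nhdsWithin_of_tendsto_nhds tendsto_id
    have hz : ∀ {f : ℝ → ℝ} {k : ℝ}, Tendsto (fun t => f t / t) (𝓝[>] 0) (𝓝 k) →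
        Tendsto f (𝓝[>] 0) (𝓝 0) := by
      intro f k hf
      have h := hf.mul hid
      rw [mul_zero] at h
      refine h.congr' ?_
      filter_upwards [self_mem_nhdsWithin] with t ht
      have : t ≠ 0 := ne_of_gt ht
      field_simp
    have hb : Tendsto S.b (𝓝[>] 0) (𝓝 S.p) := by simpa [u] using S.tendsto_u_zero.add_const S.p
    have h1 : Tendsto S.sqrtF (𝓝[>] 0) (𝓝 0) := by
      have h := (((S.tendsto_u_zero.pow 2).mul
        (((S.tendsto_a.const_mul 2).sub hb).sub_const S.p)).mul S.tendsto_w).sqrt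
      simp only [ne_eq, OfNat.ofNat_ne_zero, not_false_eq_true, zero_pow, zero_mul,
        Real.sqrt_zero] at h
      refine h.congr fun s => ?_
      simp only [sqrtF, hitchinF_eq]; rfl
    have h2 := (((hz S.tendsto_deriv_a).pow 2).const_mul 2).mul (hz S.tendsto_deriv_b)
    simpa using h1.sub h2
  have := eq_limit_of_hasDerivAt_zero key hlim t ⟨ht, lt_add_one t⟩
  linarith

/-- `4 ȧ⁴ ḃ² = u² v w`. -/
lemma constraint_sq {t : ℝ} (ht : 0 < t) :
    4 * deriv S.a t ^ 4 * deriv S.b t ^ 2 = S.u t ^ 2 * S.v t * S.w t := by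
  rw [← S.sqrtF_sq ht, S.sqrtF_eq ht]; ring

end B7.Metric

/-! ### Metric coefficients along the flow -/

namespace B7.Metric
variable (S : Metric)

lemma b_eq (t : ℝ) : S.b t = (S.w t - S.v t) / 2 - S.p := by simp only [v, w]; ring

lemma a_eq (t : ℝ) : S.a t = (S.w t + S.v t) / 4 := by simp only [v, w]; ring

lemma u_eq (t : ℝ) : S.u t = (S.w t - S.v t) / 2 - 2 * S.p := by simp only [u, v, w]; ring

lemma hasDerivAt_u {t : ℝ} (ht : 0 < t) : HasDerivAt S.u (deriv S.b t) t :=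
  (S.hasDerivAt_b ht).sub_const _

lemma hasDerivAt_v {t : ℝ} (ht : 0 < t) : HasDerivAt S.v (2 * deriv S.a t - deriv S.b t) t :=
  (((S.hasDerivAt_a ht).const_mul 2).sub (S.hasDerivAt_b ht)).sub_const _

lemma hasDerivAt_deriv_a {t : ℝ} (ht : 0 < t) : HasDerivAt (deriv S.a)
    (S.u t * (2 * S.a t ^ 2 - S.b t * (S.b t + S.p))
      / (2 * deriv S.a t ^ 3 * deriv S.b t)) t := by
  have hX := (S.differentiableAt_deriv_a ht).hasDerivAt
  have e := (hX.pow 2).unique (S.hasDerivAt_x₂ ht)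
  have h1 := S.deriv_a_pos ht
  have h2 := S.deriv_b_pos ht
  refine hX.congr_deriv ?_
  rw [S.sqrtF_eq ht] at e
  simp only [Nat.cast_ofNat, Nat.add_one_sub_one, pow_one] at e
  have h3 : deriv (deriv S.a) t = (2 * deriv S.a t * deriv (deriv S.a) t) / (2 * deriv S.a t) := by
    field_simp
  rw [h3, e]
  field_simp

lemma hasDerivAt_x₁' {t : ℝ} (ht : 0 < t) : HasDerivAt (fun s => deriv S.a s * deriv S.b s)
    (S.a t * S.u t ^ 2 / (deriv S.a t ^ 2 * deriv S.b t)) t := by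
  refine (S.hasDerivAt_x₁ ht).congr_deriv ?_
  rw [S.sqrtF_eq ht]
  have h1 := S.deriv_a_pos ht
  have h2 := S.deriv_b_pos ht
  field_simp

lemma A₃_pos {t : ℝ} (ht : 0 < t) : 0 < S.A₃ t := div_pos (S.u_pos ht) (S.deriv_a_pos ht)

lemma B₃_pos {t : ℝ} (ht : 0 < t) : 0 < S.B₃ t := by
  have h1 := S.deriv_a_pos ht
  have h2 := S.deriv_b_pos ht
  exact div_pos (by positivity) (S.u_pos ht)

lemma A₁_sq {t : ℝ} (ht : 0 < t) :
    S.A₁ t ^ 2 = S.u t * S.v t / (deriv S.a t * deriv S.b t) :=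
  Real.sq_sqrt (div_nonneg (mul_nonneg (S.u_pos ht).le (S.v_pos ht).le) (S.x₁_pos ht).le)

lemma B₁_sq {t : ℝ} (ht : 0 < t) :
    S.B₁ t ^ 2 = S.u t * S.w t / (deriv S.a t * deriv S.b t) :=
  Real.sq_sqrt (div_nonneg (mul_nonneg (S.u_pos ht).le (S.w_pos ht).le) (S.x₁_pos ht).le)

lemma A₁_pos {t : ℝ} (ht : 0 < t) : 0 < S.A₁ t :=
  Real.sqrt_pos.2 (div_pos (mul_pos (S.u_pos ht) (S.v_pos ht)) (S.x₁_pos ht))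

lemma B₁_pos {t : ℝ} (ht : 0 < t) : 0 < S.B₁ t :=
  Real.sqrt_pos.2 (div_pos (mul_pos (S.u_pos ht) (S.w_pos ht)) (S.x₁_pos ht))

/-- Squared, this is the Hamiltonian constraint. With the products below it identifies the
coefficients of `φ` with those of the standard `G₂`-form. -/
lemma A₁_mul_B₁ {t : ℝ} (ht : 0 < t) : S.A₁ t * S.B₁ t = 2 * deriv S.a t := by
  have h1 := S.deriv_a_pos ht
  have h2 := S.deriv_b_pos ht
  refine (pow_left_inj₀ (mul_pos (S.A₁_pos ht) (S.B₁_pos ht)).le (by positivity)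
    (two_ne_zero)).1 ?_
  rw [mul_pow, S.A₁_sq ht, S.B₁_sq ht]
  field_simp
  linear_combination -S.constraint_sq ht

lemma A₃_mul_B₃ {t : ℝ} (ht : 0 < t) : S.A₃ t * S.B₃ t = 2 * deriv S.b t := by
  have h1 := S.deriv_a_pos ht
  have h3 : S.b t - S.p ≠ 0 := (S.u_pos ht).ne'
  rw [A₃, B₃]
  field_simp

lemma A₁_mul_A₃_mul_B₁ {t : ℝ} (ht : 0 < t) : S.A₁ t * S.A₃ t * S.B₁ t = 2 * S.u t := by
  have h1 := S.deriv_a_pos ht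
  rw [mul_right_comm, S.A₁_mul_B₁ ht, A₃, u]
  field_simp

lemma B₁_mul_B₁_mul_B₃ {t : ℝ} (ht : 0 < t) : S.B₁ t * S.B₁ t * S.B₃ t = 2 * S.w t := by
  have h1 := S.deriv_a_pos ht
  have h2 := S.deriv_b_pos ht
  have h3 : S.b t - S.p ≠ 0 := (S.u_pos ht).ne'
  rw [← sq, S.B₁_sq ht, B₃, u]
  field_simp

lemma A₁_mul_A₁_mul_B₃ {t : ℝ} (ht : 0 < t) : S.A₁ t * S.A₁ t * S.B₃ t = 2 * S.v t := by
  have h1 := S.deriv_a_pos ht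
  have h2 := S.deriv_b_pos ht
  have h3 : S.b t - S.p ≠ 0 := (S.u_pos ht).ne'
  rw [← sq, S.A₁_sq ht, B₃, u]
  field_simp

/-- In this logarithmic form the derivative has an evident sign, since `v ≤ w`, and it equals half
the linear coefficient in the equation for `Q`. This is why `Q/A₃²` is the natural variable. -/
lemma hasDerivAt_A₃ {t : ℝ} (ht : 0 < t) : HasDerivAt S.A₃
    (S.A₃ t * (deriv S.b t / 2 * (1 / S.v t - 1 / S.w t))) t := by
  have h1 := S.deriv_a_pos ht
  have h2 := S.deriv_b_pos ht
  have hu := S.u_pos ht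
  have hv := S.v_pos ht
  have hw := S.w_pos ht
  have hc := S.constraint_sq ht
  refine ((S.hasDerivAt_u ht).div (S.hasDerivAt_deriv_a ht) h1.ne').congr_deriv ?_
  have hA : S.A₃ t = S.u t / deriv S.a t := rfl
  have hb := S.b_eq t
  have hu' := S.u_eq t
  rw [hA, S.a_eq]
  generalize deriv S.a t = X at *
  generalize deriv S.b t = Y at *
  generalize S.u t = U at *
  generalize S.v t = V at *
  generalize S.w t = W at *
  generalize S.b t = b at *
  -- The left side is the second derivative of `a`. The constraint `4X⁴Y² = U²VW` eliminates `X` and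
  -- `Y`, leaving an identity in `U, V, W` and `p`.
  have e : U * (2 * ((W + V) / 4) ^ 2 - b * (b + S.p)) / (2 * X ^ 3 * Y)
      = X / U * (Y - U * (Y / 2 * (1 / V - 1 / W))) := by
    rw [div_eq_iff (by positivity)]
    have e2 : X / U * (Y - U * (Y / 2 * (1 / V - 1 / W))) * (2 * X ^ 3 * Y)
      = (4 * X ^ 4 * Y ^ 2) / (2 * U) * (1 - U / 2 * (1 / V - 1 / W)) := by
      field_simp
      ring
    rw [e2, hc, hb]
    field_simp
    rw [hu']
    ring
  rw [e]
  field_simp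
  ring

lemma hasDerivAt_A₁ {t : ℝ} (ht : 0 < t) : HasDerivAt S.A₁
    (S.A₁ t * (1 / 2 * (deriv S.b t / S.u t + (2 * deriv S.a t - deriv S.b t) / S.v t
      - 4 * S.a t * deriv S.a t / (S.v t * S.w t)))) t := by
  have h1 := S.deriv_a_pos ht
  have h2 := S.deriv_b_pos ht
  have hu := S.u_pos ht
  have hv := S.v_pos ht
  have hw := S.w_pos ht
  have hc := S.constraint_sq ht
  have hA := S.A₁_pos ht
  have hA2 := S.A₁_sq ht
  have h := ((S.hasDerivAt_u ht).mul (S.hasDerivAt_v ht)).div (S.hasDerivAt_x₁' ht)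
    (S.x₁_pos ht).ne'
  have h' := h.sqrt (div_pos (mul_pos hu hv) (S.x₁_pos ht)).ne'
  refine h'.congr_deriv ?_
  change _ / (2 * S.A₁ t) = _
  rw [div_eq_iff (by positivity)]
  have e1 : S.A₁ t * (1 / 2 * (deriv S.b t / S.u t + (2 * deriv S.a t - deriv S.b t) / S.v t
      - 4 * S.a t * deriv S.a t / (S.v t * S.w t))) * (2 * S.A₁ t)
      = S.A₁ t ^ 2 * (deriv S.b t / S.u t + (2 * deriv S.a t - deriv S.b t) / S.v t
      - 4 * S.a t * deriv S.a t / (S.v t * S.w t)) := by ring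
  rw [e1, hA2]
  simp only [Pi.mul_apply]
  have e2 : S.a t * S.u t ^ 2 / (deriv S.a t ^ 2 * deriv S.b t)
      = 4 * S.a t * deriv S.a t ^ 2 * deriv S.b t / (S.v t * S.w t) := by
    rw [div_eq_div_iff (by positivity) (by positivity)]
    linear_combination -S.a t * hc
  rw [e2]
  field_simp

/-! ### The inequality `b < a` and positivity of `H` -/

/-- The hypothesis `ā > b̄` gives both inequalities near `0`. As long as `a > b`, the quantity `ȧ(ȧ
- ḃ)` does not decrease, so `ȧ > ḃ` persists and `a - b` cannot return to zero. -/
lemma a_gt_b_and {t : ℝ} (ht : 0 < t) : S.b t < S.a t ∧ deriv S.b t < deriv S.a t := by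
  have hΔ : 0 < S.aBar - S.bBar := sub_pos.2 S.bBar_lt_aBar
  have hev := (eventually_pos_of_tendsto_div hΔ S.tendsto_a_sub_b).and
    (eventually_pos_of_tendsto_div (by positivity) S.tendsto_deriv_a_sub_deriv_b)
  obtain ⟨s, ⟨h1, h2⟩, h3⟩ := (hev.and (Ioo_mem_nhdsGT ht)).exists
  have hs : 0 < s := h3.1
  -- The difference of the flows of `x₂` and `x₁` factors, as `2a² - b(b + p) - a(b - p) = (a -
  -- b)(2a + b + p)`.
  have hE : ∀ r, 0 < r → HasDerivAt (fun r => deriv S.a r ^ 2 - deriv S.a r * deriv S.b r)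
      (2 * S.u r / S.sqrtF r * ((S.a r - S.b r) * S.w r)) r := fun r hr =>
    ((S.hasDerivAt_x₂ hr).sub (S.hasDerivAt_x₁ hr)).congr_deriv (by simp only [u, w]; ring)
  have hconc : ∀ r, s ≤ r → (∀ x ∈ Ico s r, 0 < S.a x - S.b x) →
      0 < deriv S.a r - deriv S.b r ∧ S.a s - S.b s ≤ S.a r - S.b r := by
    intro r hsr hpos
    have step : ∀ x ∈ Icc s r, 0 < deriv S.a x - deriv S.b x := by
      intro x hx
      have hc : ContinuousOn (fun r => deriv S.a r ^ 2 - deriv S.a r * deriv S.b r) (Icc s r) :=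
        fun y hy => (hE y (hs.trans_le hy.1)).continuousAt.continuousWithinAt
      have hm : MonotoneOn (fun r => deriv S.a r ^ 2 - deriv S.a r * deriv S.b r) (Icc s r) := by
        refine monotoneOn_of_deriv_nonneg (convex_Icc s r) hc ?_ ?_
        · rw [interior_Icc]
          exact fun y hy => (hE y (hs.trans hy.1)).differentiableAt.differentiableWithinAt
        · rw [interior_Icc]
          intro y hy
          rw [(hE y (hs.trans hy.1)).deriv]
          have a1 := hpos y (Ioo_subset_Ico_self hy)
          have a2 := S.w_pos (hs.trans hy.1)
          have a3 := S.u_pos (hs.trans hy.1)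
          have a4 := S.sqrtF_pos (hs.trans hy.1)
          positivity
      have h4 := hm ⟨le_rfl, hsr⟩ hx hx.1
      have h5 : 0 < deriv S.a s * (deriv S.a s - deriv S.b s) := mul_pos (S.deriv_a_pos hs) h2
      have h6 : 0 < deriv S.a x * (deriv S.a x - deriv S.b x) := by
        simp only at h4
        nlinarith
      exact (pos_iff_pos_of_mul_pos h6).1 (S.deriv_a_pos (hs.trans_le hx.1))
    refine ⟨step r ⟨hsr, le_rfl⟩, ?_⟩
    exact monotoneOn_of_hasDerivAt (convex_Icc s r) (f := fun x => S.a x - S.b x)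
      (fun x hx => (S.hasDerivAt_a (hs.trans_le hx.1)).sub (S.hasDerivAt_b (hs.trans_le hx.1)))
      (fun x hx => (step x hx).le) ⟨le_rfl, hsr⟩ ⟨hsr, le_rfl⟩ hsr
  have hall : ∀ x, s ≤ x → 0 < S.a x - S.b x := by
    by_contra! hne
    obtain ⟨x, hx, hx'⟩ := hne
    have hcont : ContinuousOn (fun x => S.a x - S.b x) (Icc s x) := fun y hy =>
      ((S.hasDerivAt_a (hs.trans_le hy.1)).sub
        (S.hasDerivAt_b (hs.trans_le hy.1))).continuousAt.continuousWithinAt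
    have hclosed : IsClosed (Icc s x ∩ (fun x => S.a x - S.b x) ⁻¹' Iic 0) :=
      hcont.preimage_isClosed_of_isClosed isClosed_Icc isClosed_Iic
    have hcpt : IsCompact (Icc s x ∩ (fun x => S.a x - S.b x) ⁻¹' Iic 0) :=
      isCompact_Icc.of_isClosed_subset hclosed inter_subset_left
    -- At the first `r` with `a ≤ b`, the inequality `a > b` holds on `[s, r)`, so `a - b` is at
    -- least its positive value at `s`: a contradiction.
    obtain ⟨r, ⟨hr, hr'⟩, hleast⟩ := hcpt.exists_isLeast ⟨x, ⟨hx, le_rfl⟩, hx'⟩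
    have h4 := (hconc r hr.1 fun y hy => by
      by_contra hcon
      exact absurd (hleast ⟨⟨hy.1, hy.2.le.trans hr.2⟩, not_lt.1 hcon⟩) (not_le.2 hy.2)).2
    exact absurd (h1.trans_le h4) (not_lt.2 hr')
  have h7 := (hconc t h3.2.le fun x hx => hall x hx.1).1
  exact ⟨sub_pos.1 (hall t h3.2.le), sub_pos.1 h7⟩

/-- The constraint clears the square roots and turns the subtraction in `H` into the differences `ȧ
- ḃ` and `a - b`, whose signs are known. -/
lemma H_eq {t : ℝ} (ht : 0 < t) : S.H t = deriv S.a t *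
    ((deriv S.a t - deriv S.b t) * (S.a t + S.p) * S.v t + deriv S.a t * (S.a t - S.b t) * S.w t)
      / (S.u t ^ 2 * S.v t * S.w t) := by
  have h1 := S.deriv_a_pos ht
  have h2 := S.deriv_b_pos ht
  have hu := S.u_pos ht
  have hv := S.v_pos ht
  have hw := S.w_pos ht
  have hc := S.constraint_sq ht
  have e1 : S.B₃ t ^ 2 = (2 * deriv S.a t * deriv S.b t / S.u t) ^ 2 := rfl
  have e2 : S.A₃ t ^ 2 = (S.u t / deriv S.a t) ^ 2 := rfl
  have e3 : S.A₁ t * S.A₃ t * S.B₁ t * S.B₃ t = 4 * deriv S.a t * deriv S.b t := by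
    linear_combination S.A₃ t * S.B₃ t * S.A₁_mul_B₁ ht + 2 * deriv S.a t * S.A₃_mul_B₃ ht
  rw [H, e3, S.A₁_sq ht, S.B₁_sq ht, e1, e2]
  have hb : S.b t = (S.w t - S.v t) / 2 - S.p := S.b_eq t
  have hp : S.p = ((S.w t - S.v t) / 2 - S.u t) / 2 := by rw [S.u_eq]; ring
  rw [hb, hp, S.a_eq]
  have e4 : (S.u t * S.v t / (deriv S.a t * deriv S.b t) + S.u t * S.w t / (deriv S.a t * deriv S.b t)
      + (2 * deriv S.a t * deriv S.b t / S.u t) ^ 2) / (4 * deriv S.a t * deriv S.b t)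
      = (S.v t + S.w t) * deriv S.a t ^ 2 / (S.u t * S.v t * S.w t)
        + deriv S.a t * deriv S.b t / S.u t ^ 2 := by
    have : S.u t * S.v t / (deriv S.a t * deriv S.b t) + S.u t * S.w t / (deriv S.a t * deriv S.b t)
      = 4 * (deriv S.a t * deriv S.b t) * ((S.v t + S.w t) * deriv S.a t ^ 2
        / (S.u t * S.v t * S.w t)) := by
      field_simp
      linear_combination -hc
    rw [this]
    field_simp
    ring
  rw [e4]
  field_simp
  ring

lemma H_pos {t : ℝ} (ht : 0 < t) : 0 < S.H t := by
  have h1 := S.deriv_a_pos ht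
  have hu := S.u_pos ht
  have hv := S.v_pos ht
  have hw := S.w_pos ht
  have ha := S.a_pos ht
  have hp := S.p_pos
  have h3 := sub_pos.2 (S.a_gt_b_and ht).1
  have h4 := sub_pos.2 (S.a_gt_b_and ht).2
  rw [S.H_eq ht]
  positivity

/-- Numerator and denominator in `H_eq` are both of exact order `t⁶`. The numerator's leading
coefficient comes from `a - b ∼ (ā - b̄)t⁴` and `ȧ - ḃ ∼ 4(ā - b̄)t³`. -/
lemma tendsto_H : Tendsto S.H (𝓝[>] 0) (𝓝 (32 * (S.aBar - S.bBar) / S.r₀)) := by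
  have hr := S.r₀_pos
  have hp := S.p_pos
  have hn := (S.tendsto_deriv_a_sub_deriv_b.mul (S.tendsto_a.add_const S.p)).mul S.tendsto_v
  have hn' := (S.tendsto_deriv_a.mul S.tendsto_a_sub_b).mul S.tendsto_w
  have hd := ((S.tendsto_u.pow 2).mul S.tendsto_v).mul S.tendsto_w
  have h := (S.tendsto_deriv_a.mul (hn.add hn')).div hd (by positivity)
  have e : S.r₀ / 2 * (4 * (S.aBar - S.bBar) * (S.p + S.p) * (S.r₀ / 4)
      + S.r₀ / 2 * (S.aBar - S.bBar) * (4 * S.p)) / ((S.r₀ / 4) ^ 2 * (S.r₀ / 4) * (4 * S.p))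
      = 32 * (S.aBar - S.bBar) / S.r₀ := by
    field_simp; ring
  rw [e] at h
  refine h.congr' ?_
  filter_upwards [self_mem_nhdsWithin] with t ht
  have h0 : t ≠ 0 := ne_of_gt ht
  have hu := (S.u_pos ht).ne'
  have hv := (S.v_pos ht).ne'
  have hw := (S.w_pos ht).ne'
  rw [S.H_eq ht]
  simp only [Pi.div_apply]
  field_simp

end B7.Metric

/-! ### The instanton equation as a system of ordinary differential equations -/

namespace B7

lemma Metric.starPhi_eq (S : Metric) {t : ℝ} (ht : 0 < t) :
    S.starPhi t = modelStar (S.A₁ t) (S.A₃ t) (S.B₁ t) (S.B₃ t) := by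
  have h1 := S.A₁_mul_B₁ ht
  have h2 := S.A₃_mul_B₃ ht
  have h3 : S.A₁ t * S.A₃ t * S.B₁ t = 2 * (S.b t - S.p) := S.A₁_mul_A₃_mul_B₁ ht
  have h4 : S.B₁ t * S.B₁ t * S.B₃ t = 2 * (2 * S.a t + S.b t + S.p) := S.B₁_mul_B₁_mul_B₃ ht
  have h5 : S.A₁ t * S.A₁ t * S.B₃ t = 2 * (2 * S.a t - S.b t - S.p) := S.A₁_mul_A₁_mul_B₃ ht
  rw [Metric.starPhi, Metric.phi_eq_gen, ← h1, ← h2, ← h3, ← h4, ← h5]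
  exact hodge_model (S.A₁_pos ht).ne' (S.A₃_pos ht).ne' (S.B₁_pos ht).ne' (S.B₃_pos ht).ne'

namespace Connection
variable (C : Connection) (S : Metric)

lemma curvature_fst (t : ℝ) : C.curvature S 0 t =
    gen 0 * (deriv (C.coeffPlus S 0) t • gen 2 + deriv (C.coeffMinus S 0) t • gen 1)
      + dInv (C.coeffPlus S 0 t • gen 2 + C.coeffMinus S 0 t • gen 1)
      + (C.coeffPlus S 0 t • gen 4 + C.coeffMinus S 0 t • gen 3)
        * (C.coeffPlus S 2 t • gen 6 + C.coeffMinus S 2 t • gen 5) := by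
  obtain ⟨h0, h1, h2⟩ := eMinus_eq_gen
  obtain ⟨k0, k1, k2⟩ := ePlus_eq_gen
  rw [← h0, ← h1, ← h2, ← k0, ← k1, ← k2, ← dt_eq_gen]
  rfl

lemma curvature_snd (t : ℝ) : C.curvature S 1 t =
    gen 0 * (deriv (C.coeffPlus S 0) t • gen 4 + deriv (C.coeffMinus S 0) t • gen 3)
      + dInv (C.coeffPlus S 0 t • gen 4 + C.coeffMinus S 0 t • gen 3)
      + (C.coeffPlus S 2 t • gen 6 + C.coeffMinus S 2 t • gen 5)
        * (C.coeffPlus S 0 t • gen 2 + C.coeffMinus S 0 t • gen 1) := by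
  obtain ⟨h0, h1, h2⟩ := eMinus_eq_gen
  obtain ⟨k0, k1, k2⟩ := ePlus_eq_gen
  rw [← h0, ← h1, ← h2, ← k0, ← k1, ← k2, ← dt_eq_gen]
  rfl

lemma curvature_trd (t : ℝ) : C.curvature S 2 t =
    gen 0 * (deriv (C.coeffPlus S 2) t • gen 6 + deriv (C.coeffMinus S 2) t • gen 5)
      + dInv (C.coeffPlus S 2 t • gen 6 + C.coeffMinus S 2 t • gen 5)
      + (C.coeffPlus S 0 t • gen 2 + C.coeffMinus S 0 t • gen 1)
        * (C.coeffPlus S 0 t • gen 4 + C.coeffMinus S 0 t • gen 3) := by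
  obtain ⟨h0, h1, h2⟩ := eMinus_eq_gen
  obtain ⟨k0, k1, k2⟩ := ePlus_eq_gen
  rw [← h0, ← h1, ← h2, ← k0, ← k1, ← k2, ← dt_eq_gen]
  rfl

/-- The instanton equation as a system of ordinary differential equations. -/
lemma instanton_iff {t : ℝ} (ht : 0 < t) :
    (∀ k : Fin 3, C.curvature S k t * S.starPhi t = 0) ↔
    deriv (C.coeffPlus S 0) t = deriv S.a t *
        ((C.coeffPlus S 0 t - C.coeffPlus S 0 t * C.coeffPlus S 2 t) / S.u t
          + (C.coeffMinus S 0 t * C.coeffMinus S 2 t - C.coeffPlus S 0 t) / S.w t) ∧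
    deriv (C.coeffMinus S 0) t = deriv S.a t *
        ((C.coeffMinus S 0 t * C.coeffPlus S 2 t - C.coeffMinus S 0 t) / S.u t
          + (C.coeffPlus S 0 t * C.coeffMinus S 2 t - C.coeffMinus S 0 t) / S.v t) ∧
    deriv (C.coeffPlus S 2) t = deriv S.b t *
        ((C.coeffPlus S 2 t - C.coeffPlus S 0 t ^ 2) / S.v t
          + (C.coeffMinus S 0 t ^ 2 - C.coeffPlus S 2 t) / S.w t) ∧
    deriv (C.coeffMinus S 2) t = 2 * deriv S.b t / S.u t *
        (C.coeffPlus S 0 t * C.coeffMinus S 0 t - C.coeffMinus S 2 t) := by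
  have h1 := S.deriv_a_pos ht
  have h2 := S.deriv_b_pos ht
  have hu := S.u_pos ht
  have hv := S.v_pos ht
  have hw := S.w_pos ht
  have hc := S.constraint_sq ht
  have k1 := S.A₁_mul_B₁ ht
  have k2 := S.A₃_mul_B₃ ht
  have k3 : S.B₃ t = 2 * deriv S.a t * deriv S.b t / S.u t := rfl
  -- By the constraint, division by `v` or `w` replaces the square roots in `A₁` and `B₁`.
  have k4 : S.A₁ t * S.A₁ t * S.A₃ t = 4 * deriv S.a t ^ 2 * deriv S.b t / S.w t := by
    rw [← sq, S.A₁_sq ht, show S.A₃ t = S.u t / deriv S.a t from rfl]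
    field_simp
    linear_combination -hc
  have k5 : S.B₁ t * S.B₁ t * S.A₃ t = 4 * deriv S.a t ^ 2 * deriv S.b t / S.v t := by
    rw [← sq, S.B₁_sq ht, show S.A₃ t = S.u t / deriv S.a t from rfl]
    field_simp
    linear_combination -hc
  rw [S.starPhi_eq ht]
  have hall : ∀ p : Fin 3 → Prop, (∀ k, p k) ↔ p 0 ∧ p 1 ∧ p 2 := fun p => by
    simp [Fin.forall_fin_succ]
  rw [hall, curvature_fst, curvature_snd, curvature_trd, curvature_mul_modelStar_fst,
    curvature_mul_modelStar_snd, curvature_mul_modelStar_trd, k1, k2, k4, k5, k3]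
  generalize C.coeffPlus S 0 t = P
  generalize C.coeffMinus S 0 t = M
  generalize C.coeffPlus S 2 t = Q
  generalize C.coeffMinus S 2 t = N
  generalize deriv (C.coeffPlus S 0) t = dP
  generalize deriv (C.coeffMinus S 0) t = dM
  generalize deriv (C.coeffPlus S 2) t = dQ
  generalize deriv (C.coeffMinus S 2) t = dN
  generalize deriv S.a t = X at *
  generalize deriv S.b t = Y at *
  generalize S.u t = U at *
  generalize S.v t = V at *
  generalize S.w t = W at *
  have e1 : 2 * X * (2 * Y) * dP - 2 * X * (2 * X * Y / U) * (P - P * Q)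
      - 4 * X ^ 2 * Y / W * (M * N - P)
      = 4 * X * Y * (dP - X * ((P - P * Q) / U + (M * N - P) / W)) := by ring
  have e2 : 2 * X * (2 * Y) * dM - 2 * X * (2 * X * Y / U) * (M * Q - M)
      - 4 * X ^ 2 * Y / V * (P * N - M)
      = 4 * X * Y * (dM - X * ((M * Q - M) / U + (P * N - M) / V)) := by ring
  have e3 : 2 * X * (2 * X) * dQ - 4 * X ^ 2 * Y / V * (Q - P * P)
      - 4 * X ^ 2 * Y / W * (M * M - Q)
      = 4 * X ^ 2 * (dQ - Y * ((Q - P ^ 2) / V + (M ^ 2 - Q) / W)) := by ring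
  have e4 : 2 * X * (2 * X) * dN - 2 * (2 * X * (2 * X * Y / U)) * (P * M - N)
      = 4 * X ^ 2 * (dN - 2 * Y / U * (P * M - N)) := by ring
  rw [e1, e2, e3, e4]
  constructor
  -- By `U(1)`-symmetry the `E₂`-component repeats the equations of the `E₁`-component.
  · rintro ⟨a1, -, a3⟩
    obtain ⟨b1, b2⟩ := gen_sixfold_independent a1 (by decide) (by decide) (by decide) (by decide)
      (by decide) (by decide) (by decide) (by decide)
    obtain ⟨b3, b4⟩ := gen_sixfold_independent a3 (by decide) (by decide) (by decide) (by decide)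
      (by decide) (by decide) (by decide) (by decide)
    have c1 : 4 * X * Y ≠ 0 := by positivity
    have c2 : 4 * X ^ 2 ≠ 0 := by positivity
    exact ⟨sub_eq_zero.1 ((mul_eq_zero.1 b1).resolve_left c1),
      sub_eq_zero.1 ((mul_eq_zero.1 b2).resolve_left c1),
      sub_eq_zero.1 ((mul_eq_zero.1 b3).resolve_left c2),
      sub_eq_zero.1 ((mul_eq_zero.1 b4).resolve_left c2)⟩
  · rintro ⟨a1, a2, a3, a4⟩
    rw [sub_eq_zero.2 a1, sub_eq_zero.2 a2, sub_eq_zero.2 a3, sub_eq_zero.2 a4]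
    simp

/-- The curvature of a connection with `f⁻ = g⁻ = 0`. -/
lemma curvatureNormSq_eq {t : ℝ} (hM : C.coeffMinus S 0 t = 0) (hN : C.coeffMinus S 2 t = 0)
    (hdM : deriv (C.coeffMinus S 0) t = 0) (hdN : deriv (C.coeffMinus S 2) t = 0) :
    C.curvatureNormSq S t =
      2 * (deriv (C.coeffPlus S 0) t ^ 2 / S.A₁ t ^ 2
        + (C.coeffPlus S 0 t * C.coeffPlus S 2 t - C.coeffPlus S 0 t) ^ 2
          / (S.A₁ t ^ 2 * S.A₃ t ^ 2)
        + C.coeffPlus S 0 t ^ 2 / (S.B₁ t ^ 2 * S.B₃ t ^ 2))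
      + (deriv (C.coeffPlus S 2) t ^ 2 / S.A₃ t ^ 2
        + (C.coeffPlus S 0 t ^ 2 - C.coeffPlus S 2 t) ^ 2 / (S.A₁ t ^ 2 * S.A₁ t ^ 2)
        + C.coeffPlus S 2 t ^ 2 / (S.B₁ t ^ 2 * S.B₁ t ^ 2)) := by
  obtain ⟨h2, h1, h4, h3, h6, h5⟩ := dInv_gen
  have e0 : C.curvature S 0 t = deriv (C.coeffPlus S 0) t • (gen 0 * gen 2)
      + (C.coeffPlus S 0 t * C.coeffPlus S 2 t - C.coeffPlus S 0 t) • (gen 4 * gen 6)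
      + (-C.coeffPlus S 0 t) • (gen 3 * gen 5) := by
    rw [curvature_fst, hM, hN, hdM]
    simp only [zero_smul, add_zero, dInv_smul, h2, mul_smul_comm, smul_mul_assoc]
    module
  have e1 : C.curvature S 1 t = deriv (C.coeffPlus S 0) t • (gen 0 * gen 4)
      + (C.coeffPlus S 0 t * C.coeffPlus S 2 t - C.coeffPlus S 0 t) • (gen 6 * gen 2)
      + (-C.coeffPlus S 0 t) • (gen 5 * gen 1) := by
    rw [curvature_snd, hM, hN, hdM]
    simp only [zero_smul, add_zero, dInv_smul, h4, mul_smul_comm, smul_mul_assoc]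
    module
  have e2 : C.curvature S 2 t = deriv (C.coeffPlus S 2) t • (gen 0 * gen 6)
      + (C.coeffPlus S 0 t ^ 2 - C.coeffPlus S 2 t) • (gen 2 * gen 4)
      + (-C.coeffPlus S 2 t) • (gen 1 * gen 3) := by
    rw [curvature_trd, hM, hN, hdN]
    simp only [zero_smul, add_zero, dInv_smul, h6, mul_smul_comm, smul_mul_assoc]
    module
  rw [curvatureNormSq, Fin.sum_univ_three, e0, e1, e2]
  rw [formInner_model _ _ _ _ _ (by decide) (by decide) (by decide) (by decide) (by decide),
    formInner_model _ _ _ _ _ (by decide) (by decide) (by decide) (by decide) (by decide),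
    formInner_model _ _ _ _ _ (by decide) (by decide) (by decide) (by decide) (by decide)]
  simp only [lenSq, Metric.A, Metric.B, Matrix.cons_val]
  field_simp
  ring

end Connection

/-! ### Smoothness over the singular orbit, read off on a slice -/

lemma contDiff_imI : ContDiff ℝ ∞ (fun q : ℍ[ℝ] => q.imI) :=
  (LinearMap.toContinuousLinearMap (IsLinearMap.mk' (fun q : ℍ[ℝ] => q.imI)
    ⟨fun _ _ => rfl, fun _ _ => rfl⟩)).contDiff

lemma contDiff_imK : ContDiff ℝ ∞ (fun q : ℍ[ℝ] => q.imK) :=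
  (LinearMap.toContinuousLinearMap (IsLinearMap.mk' (fun q : ℍ[ℝ] => q.imK)
    ⟨fun _ _ => rfl, fun _ _ => rfl⟩)).contDiff

lemma contDiff_quaternion_coe : ContDiff ℝ ∞ (fun t : ℝ => (t : ℍ[ℝ])) :=
  (Algebra.linearMap ℝ ℍ[ℝ]).toContinuousLinearMap.contDiff

namespace Connection
variable (C : Connection) (S : Metric)

/-- On the slice `p = 1`, `y = t` the conjugation by `y` is trivial, and directions in `ℍ` are
scaled by `t⁻¹`. -/
lemma formOnM_real {t : ℝ} (ht : 0 < t) (v w : ℍ[ℝ]) :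
    (C.formOnM S 1 (t : ℍ[ℝ]) v w).imI
      = 1 / 2 * (C.coeffPlus S 0 t * (v.imI + 2 * (t⁻¹ * w.imI)) + C.coeffMinus S 0 t * v.imI) ∧
    (C.formOnM S 1 (t : ℍ[ℝ]) v w).imK
      = 1 / 2 * (C.coeffPlus S 2 t * (v.imK + 2 * (t⁻¹ * w.imK)) + C.coeffMinus S 2 t * v.imK) := by
  have h0 : t ≠ 0 := ht.ne'
  have hn : ‖(t : ℍ[ℝ])‖ = t := by rw [Quaternion.norm_coe, Real.norm_of_nonneg ht.le]
  have hi : ((t : ℍ[ℝ]))⁻¹ = ((t⁻¹ : ℝ) : ℍ[ℝ]) := (Quaternion.coe_inv t).symm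
  simp only [formOnM, hn, hi, inv_one, one_mul]
  constructor <;> simp [-Quaternion.coe_inv] <;> field_simp <;> ring

/-- The quaternion `i`. -/
def quatI : ℍ[ℝ] := ⟨0, 1, 0, 0⟩

/-- The quaternion `k`. -/
def quatK : ℍ[ℝ] := ⟨0, 0, 0, 1⟩

variable {C S} {I : Set ℝ}

/-- The functions of one variable that a smooth connection gives on the slice `p = 1`, `y = t`. -/
lemma SmoothOnP₁.exists_slice (hC : C.SmoothOnP₁ S I) (hI : I ⊆ Ioi 0) (v w : ℍ[ℝ]) :
    ∃ g : ℝ → ℍ[ℝ], ContDiffOn ℝ ∞ g (insert 0 I) ∧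
      ∀ t ∈ I, g t = C.formOnM S 1 (t : ℍ[ℝ]) v w := by
  obtain ⟨𝒜, h1, h2⟩ := hC
  have hnorm : ∀ t ∈ I, ‖(t : ℍ[ℝ])‖ = t := fun t ht => by
    rw [Quaternion.norm_coe, Real.norm_of_nonneg (le_of_lt (hI ht))]
  refine ⟨fun t => 𝒜 (1, (t : ℍ[ℝ])) (v, w), ?_, fun t ht => ?_⟩
  · have h3 : ContDiffOn ℝ ∞ (fun t : ℝ => 𝒜 (1, (t : ℍ[ℝ]))) (insert 0 I) := by
      refine h1.comp (f := fun t : ℝ => ((1 : ℍ[ℝ]), (t : ℍ[ℝ])))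
        (contDiff_const.prodMk contDiff_quaternion_coe).contDiffOn ?_
      rintro t (rfl | ht)
      · simp
      · refine ⟨one_ne_zero, Or.inr ?_⟩
        simp only [hnorm t ht, ht]
    exact h3.clm_apply contDiffOn_const
  · refine h2 1 (t : ℍ[ℝ]) one_ne_zero ?_ ?_ v w
    · intro h
      have := hnorm t ht
      rw [h, norm_zero] at this
      exact absurd this (ne_of_lt (hI ht))
    · rw [hnorm t ht]; exact ht

/-- Testing on the vectors `(0, i)` and `(0, k)` gives `P/t` and `Q/t`, so these are smooth up to
`0`. Testing on `(i, 0)` and `(k, 0)` gives `(P + M)/2` and `(Q + N)/2`, hence `M` and `N`. -/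
lemma SmoothOnP₁.exists_data (hC : C.SmoothOnP₁ S I) (hI : I ⊆ Ioi 0) :
    ∃ g₁ g₂ g₃ g₄ : ℝ → ℝ, (ContDiffOn ℝ ∞ g₁ (insert 0 I) ∧ ContDiffOn ℝ ∞ g₂ (insert 0 I) ∧
      ContDiffOn ℝ ∞ g₃ (insert 0 I) ∧ ContDiffOn ℝ ∞ g₄ (insert 0 I)) ∧
      ∀ t ∈ I, C.coeffPlus S 0 t = t * g₁ t ∧ C.coeffPlus S 2 t = t * g₂ t ∧
        C.coeffMinus S 0 t = g₃ t ∧ C.coeffMinus S 2 t = g₄ t := by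
  obtain ⟨a, ha, ha'⟩ := hC.exists_slice hI 0 quatI
  obtain ⟨b, hb, hb'⟩ := hC.exists_slice hI 0 quatK
  obtain ⟨c, hc, hc'⟩ := hC.exists_slice hI quatI 0
  obtain ⟨d, hd, hd'⟩ := hC.exists_slice hI quatK 0
  refine ⟨fun t => (a t).imI, fun t => (b t).imK, fun t => 2 * (c t).imI - t * (a t).imI,
    fun t => 2 * (d t).imK - t * (b t).imK, ⟨contDiff_imI.comp_contDiffOn ha,
      contDiff_imK.comp_contDiffOn hb,
      (contDiffOn_const.mul (contDiff_imI.comp_contDiffOn hc)).sub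
        (contDiffOn_id.mul (contDiff_imI.comp_contDiffOn ha)),
      (contDiffOn_const.mul (contDiff_imK.comp_contDiffOn hd)).sub
        (contDiffOn_id.mul (contDiff_imK.comp_contDiffOn hb))⟩, fun t ht => ?_⟩
  have h0 : 0 < t := hI ht
  have e1 : (a t).imI = 1 / 2 * (C.coeffPlus S 0 t * (0 + 2 * (t⁻¹ * 1))
      + C.coeffMinus S 0 t * 0) := by
    rw [ha' t ht]; exact (formOnM_real C S h0 0 quatI).1
  have e2 : (b t).imK = 1 / 2 * (C.coeffPlus S 2 t * (0 + 2 * (t⁻¹ * 1))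
      + C.coeffMinus S 2 t * 0) := by
    rw [hb' t ht]; exact (formOnM_real C S h0 0 quatK).2
  have e3 : (c t).imI = 1 / 2 * (C.coeffPlus S 0 t * (1 + 2 * (t⁻¹ * 0))
      + C.coeffMinus S 0 t * 1) := by
    rw [hc' t ht]; exact (formOnM_real C S h0 quatI 0).1
  have e4 : (d t).imK = 1 / 2 * (C.coeffPlus S 2 t * (1 + 2 * (t⁻¹ * 0))
      + C.coeffMinus S 2 t * 1) := by
    rw [hd' t ht]; exact (formOnM_real C S h0 quatK 0).2
  have h1 : t ≠ 0 := h0.ne'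
  refine ⟨?_, ?_, ?_, ?_⟩
  · change _ = t * (a t).imI
    rw [e1]; field_simp; ring
  · change _ = t * (b t).imK
    rw [e2]; field_simp; ring
  · change _ = 2 * (c t).imI - t * (a t).imI
    rw [e1, e3]; field_simp; ring
  · change _ = 2 * (d t).imK - t * (b t).imK
    rw [e2, e4]; field_simp; ring

/-- Regularity of the coefficients of a smooth connection, on the principal orbits and at the
singular orbit. -/
lemma SmoothOnP₁.regularity (hC : C.SmoothOnP₁ S I) (hI : I ⊆ Ioi 0) (hIo : IsOpen I)
    (hI0 : I ∈ 𝓝[>] 0) :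
    (∀ t ∈ I, ∀ k : Fin 3, DifferentiableAt ℝ (C.coeffPlus S k) t ∧
      DifferentiableAt ℝ (C.coeffMinus S k) t) ∧
    Tendsto (C.coeffPlus S 0) (𝓝[>] 0) (𝓝 0) ∧ Tendsto (C.coeffPlus S 2) (𝓝[>] 0) (𝓝 0) ∧
    ∃ m n, Tendsto (C.coeffMinus S 0) (𝓝[>] 0) (𝓝 m) ∧
      Tendsto (C.coeffMinus S 2) (𝓝[>] 0) (𝓝 n) := by
  obtain ⟨g₁, g₂, g₃, g₄, ⟨h1, h2, h3, h4⟩, h⟩ := hC.exists_data hI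
  have hlim : ∀ {g : ℝ → ℝ}, ContDiffOn ℝ ∞ g (insert 0 I) →
      Tendsto g (𝓝[>] 0) (𝓝 (g 0)) := fun {g} hg => by
    have := (hg.continuousOn 0 (mem_insert 0 I)).tendsto
    refine this.mono_left ?_
    rw [nhdsWithin_le_iff]
    exact mem_of_superset hI0 (subset_insert 0 I)
  have hdiff : ∀ {g : ℝ → ℝ}, ContDiffOn ℝ ∞ g (insert 0 I) → ∀ t ∈ I, DifferentiableAt ℝ g t :=
    fun {g} hg t ht => (hg.contDiffAt (mem_of_superset (hIo.mem_nhds ht)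
      (subset_insert 0 I))).differentiableAt (by simp)
  have hid : Tendsto (fun t : ℝ => t) (𝓝[>] 0) (𝓝 0) :=
    tendsto_nhdsWithin_of_tendsto_nhds tendsto_id
  have hP : ∀ t ∈ I, DifferentiableAt ℝ (C.coeffPlus S 0) t := fun t ht =>
    (differentiableAt_id.mul (hdiff h1 t ht)).congr_of_eventuallyEq
      (eventually_of_mem (hIo.mem_nhds ht) fun s hs => (h s hs).1)
  have hQ : ∀ t ∈ I, DifferentiableAt ℝ (C.coeffPlus S 2) t := fun t ht =>
    (differentiableAt_id.mul (hdiff h2 t ht)).congr_of_eventuallyEq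
      (eventually_of_mem (hIo.mem_nhds ht) fun s hs => (h s hs).2.1)
  have hM : ∀ t ∈ I, DifferentiableAt ℝ (C.coeffMinus S 0) t := fun t ht =>
    (hdiff h3 t ht).congr_of_eventuallyEq
      (eventually_of_mem (hIo.mem_nhds ht) fun s hs => (h s hs).2.2.1)
  have hN : ∀ t ∈ I, DifferentiableAt ℝ (C.coeffMinus S 2) t := fun t ht =>
    (hdiff h4 t ht).congr_of_eventuallyEq
      (eventually_of_mem (hIo.mem_nhds ht) fun s hs => (h s hs).2.2.2)
  refine ⟨fun t ht k => ?_, ?_, ?_, g₃ 0, g₄ 0, ?_, ?_⟩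
  · fin_cases k
    · exact ⟨hP t ht, hM t ht⟩
    · exact ⟨hP t ht, hM t ht⟩
    · exact ⟨hQ t ht, hN t ht⟩
  · have := hid.mul (hlim h1)
    rw [zero_mul] at this
    exact this.congr' (eventually_of_mem hI0 fun s hs => (h s hs).1.symm)
  · have := hid.mul (hlim h2)
    rw [zero_mul] at this
    exact this.congr' (eventually_of_mem hI0 fun s hs => (h s hs).2.1.symm)
  · exact (hlim h3).congr' (eventually_of_mem hI0 fun s hs => (h s hs).2.2.1.symm)
  · exact (hlim h4).congr' (eventually_of_mem hI0 fun s hs => (h s hs).2.2.2.symm)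

end Connection
end B7

/-! ### Uniqueness from differential inequalities -/

/-- A nonnegative function with `|E'| ≤ k E` on an interval vanishes everywhere if it vanishes
somewhere. -/
lemma eq_zero_of_abs_deriv_le {I : Set ℝ} (hI : Convex ℝ I) {E E' k : ℝ → ℝ}
    (hd : ∀ t ∈ I, HasDerivAt E (E' t) t) (hk : ContinuousOn k I)
    (hle : ∀ t ∈ I, |E' t| ≤ k t * E t) (h0 : ∀ t ∈ I, 0 ≤ E t) {a b : ℝ} (ha : a ∈ I)
    (hb : b ∈ I) (hE : E a = 0) : E b = 0 := by
  have hexp : ∀ c t : ℝ, HasDerivAt (fun s => Real.exp (c * s)) (Real.exp (c * t) * c) t :=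
    fun c t => by simpa using ((hasDerivAt_id t).const_mul c).exp
  rcases le_total a b with hab | hab
  · have hsub : Icc a b ⊆ I := hI.ordConnected.out ha hb
    obtain ⟨K, hK⟩ := isCompact_Icc.exists_bound_of_continuousOn (hk.mono hsub)
    -- Grönwall's argument forwards in time; the other case runs backwards with the opposite
    -- exponent.
    have hanti := antitoneOn_of_hasDerivAt (convex_Icc a b) (f := fun s => E s * Real.exp (-K * s))
      (fun t ht => (hd t (hsub ht)).mul (hexp (-K) t)) (fun t ht => by
        have h1 := (le_abs_self _).trans (hle t (hsub ht))
        have h2 := mul_le_mul_of_nonneg_right ((le_abs_self _).trans (hK t ht)) (h0 t (hsub ht))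
        have h3 := Real.exp_pos (-K * t)
        nlinarith)
    have h4 := hanti ⟨le_rfl, hab⟩ ⟨hab, le_rfl⟩ hab
    simp only [hE, zero_mul] at h4
    exact le_antisymm (nonpos_of_mul_nonpos_left h4 (Real.exp_pos _)) (h0 b hb)
  · have hsub : Icc b a ⊆ I := hI.ordConnected.out hb ha
    obtain ⟨K, hK⟩ := isCompact_Icc.exists_bound_of_continuousOn (hk.mono hsub)
    have hmono := monotoneOn_of_hasDerivAt (convex_Icc b a) (f := fun s => E s * Real.exp (K * s))
      (fun t ht => (hd t (hsub ht)).mul (hexp K t)) (fun t ht => by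
        have h1 := (neg_le_abs _).trans (hle t (hsub ht))
        have h2 := mul_le_mul_of_nonneg_right ((le_abs_self _).trans (hK t ht)) (h0 t (hsub ht))
        have h3 := Real.exp_pos (K * t)
        nlinarith)
    have h4 := hmono ⟨le_rfl, hab⟩ ⟨hab, le_rfl⟩ hab
    simp only [hE, zero_mul] at h4
    exact le_antisymm (nonpos_of_mul_nonpos_left h4 (Real.exp_pos _)) (h0 b hb)

lemma nonpos_of_antitoneOn_of_tendsto {E : ℝ → ℝ} {δ : ℝ} (hE : AntitoneOn E (Ioo 0 δ))
    {l : ℝ} (hl : Tendsto E (𝓝[>] 0) (𝓝 l)) : ∀ t ∈ Ioo 0 δ, E t ≤ l := by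
  intro t ht
  refine ge_of_tendsto hl ?_
  filter_upwards [Ioo_mem_nhdsGT ht.1] with r hr
  exact hE ⟨hr.1, hr.2.trans ht.2⟩ ht hr.2.le

/-! ### Singular coefficients at `t = 0` and the vanishing of `f⁻`, `g⁻` -/

namespace B7

namespace Metric
variable (S : Metric)

lemma continuousAt_deriv_a {t : ℝ} (ht : 0 < t) : ContinuousAt (deriv S.a) t :=
  (S.differentiableAt_deriv_a ht).continuousAt

lemma continuousAt_deriv_b {t : ℝ} (ht : 0 < t) : ContinuousAt (deriv S.b) t :=
  (S.differentiableAt_deriv_b ht).continuousAt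

lemma continuousAt_u {t : ℝ} (ht : 0 < t) : ContinuousAt S.u t := (S.hasDerivAt_u ht).continuousAt

lemma continuousAt_v {t : ℝ} (ht : 0 < t) : ContinuousAt S.v t := (S.hasDerivAt_v ht).continuousAt

lemma continuousAt_w {t : ℝ} (ht : 0 < t) : ContinuousAt S.w t :=
  (((S.hasDerivAt_a ht).const_mul 2).add (S.hasDerivAt_b ht)).continuousAt.add continuousAt_const

lemma tendsto_mul_deriv_div {f g : ℝ → ℝ} {k l : ℝ} (hl : l ≠ 0)
    (hf : Tendsto (fun t => f t / t) (𝓝[>] 0) (𝓝 k))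
    (hg : Tendsto (fun t => g t / t ^ 2) (𝓝[>] 0) (𝓝 l)) :
    Tendsto (fun t => t * (f t / g t)) (𝓝[>] 0) (𝓝 (k / l)) := by
  refine (hf.div hg hl).congr' ?_
  filter_upwards [self_mem_nhdsWithin] with t ht
  have h0 : t ≠ 0 := ne_of_gt ht
  simp only [Pi.div_apply]
  by_cases hgt : g t = 0
  · simp [hgt]
  · field_simp

lemma tendsto_deriv_a_div_u :
    Tendsto (fun t => t * (deriv S.a t / S.u t)) (𝓝[>] 0) (𝓝 2) := by
  have h := S.r₀_pos
  have := tendsto_mul_deriv_div (by positivity) S.tendsto_deriv_a S.tendsto_u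
  rwa [show S.r₀ / 2 / (S.r₀ / 4) = 2 by field_simp; norm_num] at this

lemma tendsto_deriv_a_div_v :
    Tendsto (fun t => t * (deriv S.a t / S.v t)) (𝓝[>] 0) (𝓝 2) := by
  have h := S.r₀_pos
  have := tendsto_mul_deriv_div (by positivity) S.tendsto_deriv_a S.tendsto_v
  rwa [show S.r₀ / 2 / (S.r₀ / 4) = 2 by field_simp; norm_num] at this

lemma tendsto_deriv_b_div_u :
    Tendsto (fun t => t * (deriv S.b t / S.u t)) (𝓝[>] 0) (𝓝 2) := by
  have h := S.r₀_pos
  have := tendsto_mul_deriv_div (by positivity) S.tendsto_deriv_b S.tendsto_u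
  rwa [show S.r₀ / 2 / (S.r₀ / 4) = 2 by field_simp; norm_num] at this

lemma tendsto_A₃_div : Tendsto (fun t => S.A₃ t / t) (𝓝[>] 0) (𝓝 (1 / 2)) := by
  have h := S.r₀_pos
  have := S.tendsto_u.div S.tendsto_deriv_a (by positivity)
  rw [show S.r₀ / 4 / (S.r₀ / 2) = 1 / 2 by field_simp; norm_num] at this
  refine this.congr' ?_
  filter_upwards [self_mem_nhdsWithin] with t ht
  have h0 : t ≠ 0 := ne_of_gt ht
  have h1 := (S.deriv_a_pos ht).ne'
  rw [show S.A₃ t = S.u t / deriv S.a t from rfl]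
  simp only [Pi.div_apply]
  field_simp

lemma tendsto_A₁_div : Tendsto (fun t => S.A₁ t / t) (𝓝[>] 0) (𝓝 (1 / 2)) := by
  have h := S.r₀_pos
  have := ((S.tendsto_u.mul S.tendsto_v).div (S.tendsto_deriv_a.mul S.tendsto_deriv_b)
    (by positivity)).sqrt
  rw [show S.r₀ / 4 * (S.r₀ / 4) / (S.r₀ / 2 * (S.r₀ / 2)) = (1 / 2) ^ 2 by field_simp; norm_num,
    Real.sqrt_sq (by norm_num)] at this
  refine this.congr' ?_
  filter_upwards [self_mem_nhdsWithin] with t ht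
  have h0 : 0 < t := ht
  have h1 := S.deriv_a_pos ht
  have h2 := S.deriv_b_pos ht
  rw [← Real.sqrt_sq (div_pos (S.A₁_pos ht) h0).le, div_pow, S.A₁_sq ht]
  simp only [Pi.div_apply]
  congr 1
  field_simp

end Metric

namespace Connection
variable {C : Connection} {S : Metric} {I : Set ℝ}

/-- On `P₁` the coefficients `f⁻`, `g⁻` of an instanton vanish. -/
lemma IsInstantonOnP₁.coeffMinus_eq_zero (hC : C.IsInstantonOnP₁ S I) (hI : I ⊆ Ioi 0)
    (hIo : IsOpen I) (hI0 : I ∈ 𝓝[>] 0) (hIc : Convex ℝ I) :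
    ∀ t ∈ I, C.coeffMinus S 0 t = 0 ∧ C.coeffMinus S 2 t = 0 := by
  obtain ⟨hdiff, hP0, hQ0, m, n, hM0, hN0⟩ := hC.1.regularity hI hIo hI0
  have hode := fun t ht => (C.instanton_iff S (hI ht)).1 (hC.2 t ht)
  set P := C.coeffPlus S 0 with hP
  set Q := C.coeffPlus S 2 with hQ
  set M := C.coeffMinus S 0 with hM
  set N := C.coeffMinus S 2 with hN
  let c₁ : ℝ → ℝ := fun t => 2 * deriv S.a t * ((Q t - 1) / S.u t - 1 / S.v t)
  let c₂ : ℝ → ℝ := fun t => 2 * deriv S.a t * P t / S.v t + 4 * deriv S.b t * P t / S.u t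
  let c₃ : ℝ → ℝ := fun t => -(4 * deriv S.b t / S.u t)
  let E' : ℝ → ℝ := fun t => c₁ t * M t ^ 2 + c₂ t * (M t * N t) + c₃ t * N t ^ 2
  have hE : ∀ t ∈ I, HasDerivAt (fun s => M s ^ 2 + N s ^ 2) (E' t) t := by
    intro t ht
    have h1 := (hdiff t ht 0).2.hasDerivAt
    have h2 := (hdiff t ht 2).2.hasDerivAt
    rw [← hM, (hode t ht).2.1] at h1
    rw [← hN, (hode t ht).2.2.2] at h2
    refine ((h1.pow 2).add (h2.pow 2)).congr_deriv ?_
    simp only [E', c₁, c₂, c₃]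
    simp
    ring
  have hlim : Tendsto (fun t => t * (M t ^ 2 + N t ^ 2)) (𝓝[>] 0) (𝓝 0) := by
    have hid : Tendsto (fun t : ℝ => t) (𝓝[>] 0) (𝓝 0) :=
      tendsto_nhdsWithin_of_tendsto_nhds tendsto_id
    simpa using hid.mul ((hM0.pow 2).add (hN0.pow 2))
  -- As `t → 0` the leading part of `t * E'` is `-8M² - 8N²`, and the cross term carries the factor
  -- `P → 0`. Hence `t(M² + N²)` is nonincreasing; it tends to `0` because `M` and `N` are bounded,
  -- so `M` and `N` vanish near `0`.
  have hnear : ∀ᶠ t in 𝓝[>] 0, (M t ^ 2 + N t ^ 2) + t * E' t ≤ 0 := by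
    filter_upwards [self_mem_nhdsWithin,
      S.tendsto_deriv_a_div_u.eventually_const_lt (show (1 : ℝ) < 2 by norm_num),
      S.tendsto_deriv_a_div_v.eventually_const_lt (show (1 : ℝ) < 2 by norm_num),
      S.tendsto_deriv_a_div_v.eventually_lt_const (show (2 : ℝ) < 3 by norm_num),
      S.tendsto_deriv_b_div_u.eventually_const_lt (show (1 : ℝ) < 2 by norm_num),
      S.tendsto_deriv_b_div_u.eventually_lt_const (show (2 : ℝ) < 3 by norm_num),
      hP0.eventually_const_lt (show (-(1 / 10) : ℝ) < 0 by norm_num),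
      hP0.eventually_lt_const (show (0 : ℝ) < 1 / 10 by norm_num),
      hQ0.eventually_lt_const (show (0 : ℝ) < 1 / 10 by norm_num)]
      with t ht h1 h2 h3 h4 h5 h6 h7 h8
    have e : t * E' t = 2 * (t * (deriv S.a t / S.u t)) * (Q t - 1) * M t ^ 2
        - 2 * (t * (deriv S.a t / S.v t)) * M t ^ 2
        + (2 * (t * (deriv S.a t / S.v t)) + 4 * (t * (deriv S.b t / S.u t))) * P t * (M t * N t)
        - 4 * (t * (deriv S.b t / S.u t)) * N t ^ 2 := by
      simp only [E', c₁, c₂, c₃]; ring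
    rw [e]
    generalize t * (deriv S.a t / S.u t) = α at *
    generalize t * (deriv S.a t / S.v t) = β at *
    generalize t * (deriv S.b t / S.u t) = γ at *
    -- With `β, γ < 3` and `|P| ≤ 1/10` the factor is `18 · (1/10) · (1/2) = 9/10`. The diagonal
    -- terms contribute at most `-2M² - 4N²`, which absorbs this and the extra `M² + N²`.
    have i1 : |(2 * β + 4 * γ) * P t * (M t * N t)| ≤ 9 / 10 * (M t ^ 2 + N t ^ 2) := by
      rw [abs_mul, abs_mul]
      have j1 : |2 * β + 4 * γ| ≤ 18 := abs_le.2 ⟨by linarith, by linarith⟩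
      have j2 : |P t| ≤ 1 / 10 := abs_le.2 ⟨h6.le, h7.le⟩
      have j3 : |M t * N t| ≤ (M t ^ 2 + N t ^ 2) / 2 :=
        abs_le.2 ⟨by nlinarith [sq_nonneg (M t + N t)], by nlinarith [sq_nonneg (M t - N t)]⟩
      calc _ ≤ 18 * (1 / 10) * ((M t ^ 2 + N t ^ 2) / 2) := by gcongr
        _ = _ := by ring
    have i2 := (le_abs_self _).trans i1
    have i3 : 2 * α * (Q t - 1) * M t ^ 2 ≤ 0 :=
      mul_nonpos_of_nonpos_of_nonneg (mul_nonpos_of_nonneg_of_nonpos (by linarith) (by linarith))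
        (sq_nonneg _)
    have i4 := mul_le_mul_of_nonneg_right h2.le (sq_nonneg (M t))
    have i5 := mul_le_mul_of_nonneg_right h4.le (sq_nonneg (N t))
    nlinarith [sq_nonneg (M t), sq_nonneg (N t)]
  obtain ⟨δ, hδ, hδ'⟩ := mem_nhdsGT_iff_exists_Ioo_subset.1 (hnear.and hI0)
  have hδ0 : (0 : ℝ) < δ := hδ
  have hanti : AntitoneOn (fun t => t * (M t ^ 2 + N t ^ 2)) (Ioo 0 δ) :=
    antitoneOn_of_hasDerivAt (convex_Ioo 0 δ)
      (fun t ht => (hasDerivAt_id t).mul (hE t (hδ' ht).2))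
      (fun t ht => by simpa using (hδ' ht).1)
  have hmid : δ / 2 ∈ Ioo 0 δ := ⟨by linarith, by linarith⟩
  have hz : M (δ / 2) ^ 2 + N (δ / 2) ^ 2 = 0 := by
    have h1 := nonpos_of_antitoneOn_of_tendsto hanti hlim _ hmid
    refine le_antisymm ?_ (by positivity)
    exact nonpos_of_mul_nonpos_right h1 hmid.1
  have hcont : ContinuousOn (fun t => |c₁ t| + |c₂ t| + |c₃ t|) I := by
    intro t ht
    have ht0 : 0 < t := hI ht
    have k1 := S.continuousAt_deriv_a ht0
    have k2 := S.continuousAt_deriv_b ht0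
    have k3 := S.continuousAt_u ht0
    have k4 := S.continuousAt_v ht0
    have k5 : ContinuousAt P t := (hdiff t ht 0).1.continuousAt
    have k6 : ContinuousAt Q t := (hdiff t ht 2).1.continuousAt
    have k7 := (S.u_pos ht0).ne'
    have k8 := (S.v_pos ht0).ne'
    refine ContinuousAt.continuousWithinAt ?_
    simp only [c₁, c₂, c₃]
    fun_prop (disch := assumption)
  intro t ht
  -- Away from `0` the system for `(M, N)` is linear with continuous coefficients, so vanishing at
  -- one point spreads over `I`.
  have := eq_zero_of_abs_deriv_le hIc hE hcont (fun s _ => ?_) (fun s _ => by positivity)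
    (hδ' hmid).2 ht hz
  · constructor <;> nlinarith [sq_nonneg (M t), sq_nonneg (N t)]
  · have j3 : |M s * N s| ≤ M s ^ 2 + N s ^ 2 :=
      abs_le.2 ⟨by nlinarith [sq_nonneg (M s + N s)], by nlinarith [sq_nonneg (M s - N s)]⟩
    have j1 : |M s ^ 2| ≤ M s ^ 2 + N s ^ 2 := by rw [abs_of_nonneg (sq_nonneg _)]; nlinarith
    have j2 : |N s ^ 2| ≤ M s ^ 2 + N s ^ 2 := by rw [abs_of_nonneg (sq_nonneg _)]; nlinarith
    calc |E' s| ≤ |c₁ s * M s ^ 2| + |c₂ s * (M s * N s)| + |c₃ s * N s ^ 2| := abs_add_three _ _ _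
      _ = |c₁ s| * |M s ^ 2| + |c₂ s| * |M s * N s| + |c₃ s| * |N s ^ 2| := by
        simp only [abs_mul]
      _ ≤ |c₁ s| * (M s ^ 2 + N s ^ 2) + |c₂ s| * (M s ^ 2 + N s ^ 2)
          + |c₃ s| * (M s ^ 2 + N s ^ 2) := by gcongr
      _ = _ := by ring

end Connection

/-! ### The reduced system for `f⁺`, `g⁺`, and the case `f₁⁺ = 0` -/

namespace Connection
variable {C : Connection} {S : Metric} {I : Set ℝ}

/-- The instanton equation on `P₁` for `A₁ f⁺` and `A₃ g⁺`. -/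
lemma IsInstantonOnP₁.hasDerivAt (hC : C.IsInstantonOnP₁ S I) (hI : I ⊆ Ioi 0)
    (hIo : IsOpen I) (hI0 : I ∈ 𝓝[>] 0) (hIc : Convex ℝ I) {t : ℝ} (ht : t ∈ I) :
    HasDerivAt (C.coeffPlus S 0) (deriv S.a t * ((1 - C.coeffPlus S 2 t) / S.u t - 1 / S.w t)
      * C.coeffPlus S 0 t) t ∧
    HasDerivAt (C.coeffPlus S 2) (deriv S.b t *
      ((C.coeffPlus S 2 t - C.coeffPlus S 0 t ^ 2) / S.v t - C.coeffPlus S 2 t / S.w t)) t := by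
  obtain ⟨hM, hN⟩ := hC.coeffMinus_eq_zero hI hIo hI0 hIc t ht
  have hdiff := (hC.1.regularity hI hIo hI0).1 t ht
  obtain ⟨h1, -, h3, -⟩ := (C.instanton_iff S (hI ht)).1 (hC.2 t ht)
  refine ⟨(hdiff 0).1.hasDerivAt.congr_deriv ?_, (hdiff 2).1.hasDerivAt.congr_deriv ?_⟩
  · rw [h1, hM]; ring
  · rw [h3, hM]; ring

/-- The equation for `g⁺ / A₃`. -/
lemma IsInstantonOnP₁.hasDerivAt_div (hC : C.IsInstantonOnP₁ S I) (hI : I ⊆ Ioi 0)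
    (hIo : IsOpen I) (hI0 : I ∈ 𝓝[>] 0) (hIc : Convex ℝ I) {t : ℝ} (ht : t ∈ I) :
    HasDerivAt (fun s => C.coeffPlus S 2 s / S.A₃ s ^ 2)
      (-(deriv S.b t * C.coeffPlus S 0 t ^ 2 / (S.v t * S.A₃ t ^ 2))) t := by
  have h1 := (hC.hasDerivAt hI hIo hI0 hIc ht).2
  have ht0 : 0 < t := hI ht
  have h3 := S.A₃_pos ht0
  have hv := S.v_pos ht0
  have hw := S.w_pos ht0
  refine (h1.div ((S.hasDerivAt_A₃ ht0).pow 2) (pow_pos h3 2).ne').congr_deriv ?_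
  simp only [Pi.pow_apply]
  field_simp
  simp
  ring

lemma coeffPlus_zero_apply (t : ℝ) : C.coeffPlus S 0 t = S.A₁ t * C.fPlus t := rfl

lemma coeffPlus_two_apply (t : ℝ) : C.coeffPlus S 2 t = S.A₃ t * C.gPlus t := rfl

lemma tendsto_fPlus_div {f : ℝ → ℝ} {f₁ : ℝ}
    (hf : (fun t => f t - f₁ * t) =O[𝓝[>] 0] (fun t => t ^ 3)) :
    Tendsto (fun t => f t / t) (𝓝[>] 0) (𝓝 f₁) := by
  have := tendsto_div_pow_of_isBigO (n := 1) (k := f₁) (m := 3) (by norm_num) (by simpa using hf)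
  simpa using this

/-- The quotient is `g⁺/A₃`, and `A₃ ∼ t/2`; this is the source of the factor `2`. -/
lemma tendsto_coeffPlus_two_div {g₁ : ℝ}
    (hg : (fun t => C.gPlus t - g₁ * t) =O[𝓝[>] 0] (fun t => t ^ 3)) :
    Tendsto (fun s => C.coeffPlus S 2 s / S.A₃ s ^ 2) (𝓝[>] 0) (𝓝 (2 * g₁)) := by
  have h := (tendsto_fPlus_div hg).div S.tendsto_A₃_div (by norm_num)
  rw [show g₁ / (1 / 2) = 2 * g₁ by ring] at h
  refine h.congr' ?_
  filter_upwards [self_mem_nhdsWithin] with t ht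
  have h0 : t ≠ 0 := ne_of_gt ht
  have := (S.A₃_pos ht).ne'
  rw [coeffPlus_two_apply]
  simp only [Pi.div_apply]
  field_simp

/-- Uniqueness for the linear homogeneous equation of `A₁f⁺`. -/
lemma IsInstantonOnP₁.coeffPlus_eq_zero_of_eq_zero (hC : C.IsInstantonOnP₁ S I) (hI : I ⊆ Ioi 0)
    (hIo : IsOpen I) (hI0 : I ∈ 𝓝[>] 0) (hIc : Convex ℝ I) {r : ℝ} (hr : r ∈ I)
    (h0 : C.coeffPlus S 0 r = 0) : ∀ t ∈ I, C.coeffPlus S 0 t = 0 := by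
  intro t ht
  let κ : ℝ → ℝ := fun t => deriv S.a t * ((1 - C.coeffPlus S 2 t) / S.u t - 1 / S.w t)
  have hE : ∀ t ∈ I, HasDerivAt (fun s => C.coeffPlus S 0 s ^ 2)
      (2 * κ t * C.coeffPlus S 0 t ^ 2) t := fun t ht =>
    ((hC.hasDerivAt hI hIo hI0 hIc ht).1.pow 2).congr_deriv (by simp [κ]; ring)
  have hcont : ContinuousOn (fun t => |2 * κ t|) I := by
    intro t ht
    have ht0 : 0 < t := hI ht
    have k1 := S.continuousAt_deriv_a ht0
    have k3 := S.continuousAt_u ht0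
    have k4 := S.continuousAt_w ht0
    have k6 : ContinuousAt (C.coeffPlus S 2) t :=
      (hC.hasDerivAt hI hIo hI0 hIc ht).2.continuousAt
    have k7 := (S.u_pos ht0).ne'
    have k8 := (S.w_pos ht0).ne'
    refine ContinuousAt.continuousWithinAt ?_
    simp only [κ]
    fun_prop (disch := assumption)
  have := eq_zero_of_abs_deriv_le hIc hE hcont (fun s _ => by
    rw [abs_mul, abs_of_nonneg (sq_nonneg (C.coeffPlus S 0 s))]) (fun s _ => sq_nonneg _) hr ht
    (by simp [h0])
  exact pow_eq_zero_iff (two_ne_zero) |>.1 this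

/-- If `f₁⁺ = 0`, then `f⁺ = 0`. -/
lemma IsInstantonOnP₁.coeffPlus_zero_eq_zero (hC : C.IsInstantonOnP₁ S I) (hI : I ⊆ Ioi 0)
    (hIo : IsOpen I) (hI0 : I ∈ 𝓝[>] 0) (hIc : Convex ℝ I)
    (hf : C.fPlus =O[𝓝[>] 0] (fun t => t ^ 3)) : ∀ t ∈ I, C.coeffPlus S 0 t = 0 := by
  have hQ0 := (hC.1.regularity hI hIo hI0).2.2.1
  let κ : ℝ → ℝ := fun t => deriv S.a t * ((1 - C.coeffPlus S 2 t) / S.u t - 1 / S.w t)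
  -- The equation for `P` is thus `tṖ = (2 + o(1))P`, whereas `f⁺ = O(t³)` makes `P` of order `t⁴`.
  have hκ : Tendsto (fun t => t * κ t) (𝓝[>] 0) (𝓝 2) := by
    have hX : Tendsto (fun t => t * (deriv S.a t / S.w t)) (𝓝[>] 0) (𝓝 0) := by
      have hid : Tendsto (fun t : ℝ => t) (𝓝[>] 0) (𝓝 0) :=
        tendsto_nhdsWithin_of_tendsto_nhds tendsto_id
      have hp := S.p_pos
      have := (hid.mul hid).mul (S.tendsto_deriv_a.div S.tendsto_w (by positivity))
      rw [mul_zero, zero_mul] at this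
      refine this.congr' ?_
      filter_upwards [self_mem_nhdsWithin] with t ht
      have h0 : t ≠ 0 := ne_of_gt ht
      have := (S.w_pos ht).ne'
      simp only [Pi.div_apply]
      field_simp
    have h := (S.tendsto_deriv_a_div_u.mul (hQ0.const_sub 1)).sub hX
    rw [sub_zero, sub_zero, mul_one] at h
    refine h.congr fun t => ?_
    simp only [κ]; ring
  have hz : Tendsto (fun t => C.coeffPlus S 0 t ^ 2 / t ^ 5) (𝓝[>] 0) (𝓝 0) := by
    have h1 := tendsto_div_pow_of_isBigO (n := 2) (k := 0) (m := 3) (by norm_num)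
      (by simpa using hf)
    have hid : Tendsto (fun t : ℝ => t) (𝓝[>] 0) (𝓝 0) :=
      tendsto_nhdsWithin_of_tendsto_nhds tendsto_id
    have h2 := ((S.tendsto_A₁_div.mul h1).pow 2).mul hid
    rw [mul_zero] at h2
    refine h2.congr' ?_
    filter_upwards [self_mem_nhdsWithin] with t ht
    have h0 : t ≠ 0 := ne_of_gt ht
    rw [coeffPlus_zero_apply]
    field_simp
  obtain ⟨δ, hδ, hδ'⟩ := mem_nhdsGT_iff_exists_Ioo_subset.1
    ((hκ.eventually_lt_const (show (2 : ℝ) < 5 / 2 by norm_num)).and hI0)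
  have hδ0 : (0 : ℝ) < δ := hδ
  -- The exponent `5` exceeds `2 · 2`, so the quotient is nonincreasing near `0`, yet it is small
  -- enough for the quotient to tend to `0`.
  have hanti : AntitoneOn (fun t => C.coeffPlus S 0 t ^ 2 / t ^ 5) (Ioo 0 δ) := by
    refine antitoneOn_of_hasDerivAt (convex_Ioo 0 δ)
      (f' := fun t => 2 * C.coeffPlus S 0 t ^ 2 / t ^ 6 * (t * κ t - 5 / 2))
      (fun t ht => ?_) (fun t ht => ?_)
    · have h0 : t ≠ 0 := ht.1.ne'
      refine (((hC.hasDerivAt hI hIo hI0 hIc (hδ' ht).2).1.pow 2).div (hasDerivAt_pow 5 t)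
        (pow_ne_zero 5 h0)).congr_deriv ?_
      rw [show deriv S.a t * ((1 - C.coeffPlus S 2 t) / S.u t - 1 / S.w t) = κ t from rfl]
      simp only [Pi.pow_apply]
      field_simp
      push_cast
      simp
      ring
    · have h1 := ht.1
      have h2 : t * κ t < 5 / 2 := (hδ' ht).1
      exact mul_nonpos_of_nonneg_of_nonpos (by positivity) (by linarith)
  have hmid : δ / 2 ∈ Ioo 0 δ := ⟨by linarith, by linarith⟩
  have h1 := nonpos_of_antitoneOn_of_tendsto hanti hz _ hmid
  have h2 : C.coeffPlus S 0 (δ / 2) ^ 2 ≤ 0 := by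
    rwa [div_le_iff₀ (by positivity), zero_mul] at h1
  exact hC.coeffPlus_eq_zero_of_eq_zero hI hIo hI0 hIc (hδ' hmid).2
    (pow_eq_zero_iff two_ne_zero |>.1 (le_antisymm h2 (sq_nonneg _)))

/-- The abelian instanton. -/
lemma IsInstantonOnP₁.coeffPlus_two_eq {T : ℝ} (hT : 0 < T) (hC : C.IsInstantonOnP₁ S (Ioo 0 T))
    {g₁ : ℝ} (hf : C.fPlus =O[𝓝[>] 0] (fun t => t ^ 3))
    (hg : (fun t => C.gPlus t - g₁ * t) =O[𝓝[>] 0] (fun t => t ^ 3)) :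
    ∀ t ∈ Ioo 0 T, C.coeffPlus S 2 t = 2 * g₁ * S.A₃ t ^ 2 := by
  have hP := hC.coeffPlus_zero_eq_zero (fun t ht => ht.1) isOpen_Ioo (Ioo_mem_nhdsGT hT)
    (convex_Ioo 0 T) hf
  intro t ht
  have h := eq_limit_of_hasDerivAt_zero (fun s hs => (hC.hasDerivAt_div (fun t ht => ht.1)
    isOpen_Ioo (Ioo_mem_nhdsGT hT) (convex_Ioo 0 T) hs).congr_deriv (by rw [hP s hs]; simp))
    (tendsto_coeffPlus_two_div hg) t ht
  rwa [div_eq_iff (pow_pos (S.A₃_pos ht.1) 2).ne'] at h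

end Connection

/-! ### The abelian instanton and global extension -/

lemma contDiff_im : ContDiff ℝ ∞ (fun q : ℍ[ℝ] => q.im) :=
  (LinearMap.toContinuousLinearMap (IsLinearMap.mk' (fun q : ℍ[ℝ] => q.im)
    ⟨fun x y => by ext <;> simp, fun c x => by ext <;> simp⟩)).contDiff

lemma contDiffAt_quaternion_inv {q : ℍ[ℝ]} (hq : q ≠ 0) :
    ContDiffAt ℝ ∞ (fun q : ℍ[ℝ] => q⁻¹) q := by
  have h := contDiffAt_ringInverse ℝ (n := ∞) (Units.mk0 q hq)
  simpa [Ring.inverse_eq_inv'] using h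

lemma Metric.contDiffAt_A₃ (S : Metric) {t : ℝ} (ht : 0 < t) : ContDiffAt ℝ ∞ S.A₃ t :=
  ((S.contDiffAt_b ht).sub contDiffAt_const).div (Metric.contDiffAt_deriv (S.contDiffAt_a ht))
    (S.deriv_a_pos ht).ne'

namespace Connection
variable (C : Connection) (S : Metric)

/-- The abelian instanton with `g⁺ = 2 g₁ A₃`. -/
def abelian (S : Metric) (g₁ : ℝ) : Connection := ⟨0, 0, fun t => 2 * g₁ * S.A₃ t, 0⟩

variable (g₁ : ℝ)

lemma abelian_coeffs : (abelian S g₁).coeffPlus S 0 = 0 ∧ (abelian S g₁).coeffPlus S 1 = 0 ∧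
    (abelian S g₁).coeffPlus S 2 = (fun t => 2 * g₁ * S.A₃ t ^ 2) ∧
    ∀ k, (abelian S g₁).coeffMinus S k = 0 := by
  refine ⟨?_, ?_, ?_, fun k => ?_⟩
  · ext t; simp [coeffPlus, abelian]
  · ext t; simp [coeffPlus, abelian]
  · ext t; simp [coeffPlus, abelian]; ring
  · ext t; fin_cases k <;> simp [coeffMinus, abelian]

/-- The abelian instanton on `M`, outside the singular orbit, as a linear map. -/
def abelianForm (x : ℍ[ℝ] × ℍ[ℝ]) : ℍ[ℝ] × ℍ[ℝ] →L[ℝ] ℍ[ℝ] :=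
  LinearMap.toContinuousLinearMap (IsLinearMap.mk' (fun z : ℍ[ℝ] × ℍ[ℝ] =>
      (1 / 2 * (2 * g₁ * S.A₃ ‖x.2‖ ^ 2) * (x.2⁻¹ * (x.1⁻¹ * z.1).im * x.2 + (x.2⁻¹ * z.2).im
        + (x.2⁻¹ * z.2).im).imK) • quatK)
    { map_add := fun z z' => by
        simp only [Prod.fst_add, Prod.snd_add, mul_add, add_mul, Quaternion.im_add,
          Quaternion.imK_add]
        module
      map_smul := fun c z => by
        simp only [Prod.smul_fst, Prod.smul_snd, mul_smul_comm, smul_mul_assoc, Quaternion.im_smul,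
          Quaternion.imK_add, Quaternion.imK_smul, smul_eq_mul]
        module })

lemma formOnM_abelian (x z : ℍ[ℝ] × ℍ[ℝ]) :
    (abelian S g₁).formOnM S x.1 x.2 z.1 z.2 = abelianForm S g₁ x z := by
  obtain ⟨h0, h1, h2, h3⟩ := abelian_coeffs S g₁
  change _ = (1 / 2 * (2 * g₁ * S.A₃ ‖x.2‖ ^ 2) * (x.2⁻¹ * (x.1⁻¹ * z.1).im * x.2
    + (x.2⁻¹ * z.2).im + (x.2⁻¹ * z.2).im).imK) • quatK
  simp only [formOnM, h0, h1, h2, h3, Pi.zero_apply, zero_mul, add_zero, mul_zero]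
  generalize (x.2⁻¹ * (x.1⁻¹ * z.1).im * x.2 + (x.2⁻¹ * z.2).im + (x.2⁻¹ * z.2).im).imK = r
  have k0 : quatK.re = 0 := rfl
  have k1 : quatK.imI = 0 := rfl
  have k2 : quatK.imJ = 0 := rfl
  have k3 : quatK.imK = 1 := rfl
  ext
  · simp [k0]
  · simp [k1]
  · simp [k2]
  · simp [k3, mul_assoc]

lemma contDiffOn_abelianForm :
    ContDiffOn ℝ ∞ (abelianForm S g₁) {x | x.1 ≠ 0 ∧ x.2 ≠ 0} := by
  rw [contDiffOn_clm_apply]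
  rintro ⟨v, w⟩ x ⟨hx1, hx2⟩
  refine ContDiffAt.contDiffWithinAt ?_
  have i1 : ContDiffAt ℝ ∞ (fun x : ℍ[ℝ] × ℍ[ℝ] => x.1⁻¹) x :=
    (contDiffAt_quaternion_inv hx1).comp x contDiffAt_fst
  have i2 : ContDiffAt ℝ ∞ (fun x : ℍ[ℝ] × ℍ[ℝ] => x.2⁻¹) x :=
    (contDiffAt_quaternion_inv hx2).comp x contDiffAt_snd
  have i3 : ContDiffAt ℝ ∞ (fun x : ℍ[ℝ] × ℍ[ℝ] => S.A₃ ‖x.2‖) x :=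
    (S.contDiffAt_A₃ (norm_pos_iff.2 hx2)).comp x ((contDiffAt_norm ℝ hx2).comp x contDiffAt_snd)
  have i4 : ContDiffAt ℝ ∞ (fun x : ℍ[ℝ] × ℍ[ℝ] => (x.1⁻¹ * v).im) x :=
    contDiff_im.contDiffAt.comp x (i1.mul contDiffAt_const)
  have i5 : ContDiffAt ℝ ∞ (fun x : ℍ[ℝ] × ℍ[ℝ] => (x.2⁻¹ * w).im) x :=
    contDiff_im.contDiffAt.comp x (i2.mul contDiffAt_const)
  have i6 : ContDiffAt ℝ ∞ (fun x : ℍ[ℝ] × ℍ[ℝ] => (x.2⁻¹ * (x.1⁻¹ * v).im * x.2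
      + (x.2⁻¹ * w).im + (x.2⁻¹ * w).im).imK) x :=
    contDiff_imK.contDiffAt.comp x ((((i2.mul i4).mul contDiffAt_snd).add i5).add i5)
  exact ((contDiffAt_const.mul (contDiffAt_const.mul (i3.pow 2))).mul i6).smul contDiffAt_const

lemma solvesInstantonEq_abelian : (abelian S g₁).SolvesInstantonEq S (Ioi 0) := by
  intro t ht
  have ht0 : 0 < t := ht
  refine ((abelian S g₁).instanton_iff S ht0).2 ?_
  obtain ⟨h0, h1, h2, h3⟩ := abelian_coeffs S g₁
  simp only [h0, h2, h3]
  have := (((S.hasDerivAt_A₃ ht0).pow 2).const_mul (2 * g₁)).deriv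
  refine ⟨by simp [Pi.zero_def], by simp [Pi.zero_def], this.trans ?_, by simp [Pi.zero_def]⟩
  simp
  ring

lemma _root_.B7.Metric.A₃_div_A₁_sq {t : ℝ} (ht : 0 < t) :
    S.A₃ t / S.A₁ t ^ 2 = deriv S.b t / S.v t ∧ S.A₃ t / S.B₁ t ^ 2 = deriv S.b t / S.w t := by
  have h1 := S.deriv_a_pos ht
  have h2 := S.deriv_b_pos ht
  have hu := S.u_pos ht
  have hv := S.v_pos ht
  have hw := S.w_pos ht
  rw [S.A₁_sq ht, S.B₁_sq ht, show S.A₃ t = S.u t / deriv S.a t from rfl]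
  constructor <;> field_simp

/-- The quotients are `uḃ/(ȧv)` and `uḃ/(ȧw)`. The inequalities `b < a` and `ḃ < ȧ` give `u ≤ v`, `u
≤ w` and the bound. -/
lemma _root_.B7.Metric.A₃_sq_div_le {t : ℝ} (ht : 0 < t) :
    S.A₃ t ^ 2 / S.A₁ t ^ 2 ≤ 1 ∧ S.A₃ t ^ 2 / S.B₁ t ^ 2 ≤ 1 := by
  have h1 := S.deriv_a_pos ht
  have h2 := S.deriv_b_pos ht
  have hu := S.u_pos ht
  have hv := S.v_pos ht
  have hw := S.w_pos ht
  obtain ⟨h3, h4⟩ := S.a_gt_b_and ht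
  have h5 : S.u t ≤ S.v t := by simp only [Metric.u, Metric.v]; linarith
  have h6 : S.u t ≤ S.w t := by
    have := S.p_pos
    have := S.a_pos ht
    simp only [Metric.u, Metric.w]; linarith
  have key : ∀ z, 0 < z → S.u t ≤ z → S.u t * deriv S.b t ≤ deriv S.a t * z := fun z hz hle => by
    rw [mul_comm]
    exact mul_le_mul h4.le hle hu.le h1.le
  rw [S.A₁_sq ht, S.B₁_sq ht, show S.A₃ t = S.u t / deriv S.a t from rfl]
  constructor
  · rw [show (S.u t / deriv S.a t) ^ 2 / (S.u t * S.v t / (deriv S.a t * deriv S.b t))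
      = S.u t * deriv S.b t / (deriv S.a t * S.v t) by field_simp, div_le_one (by positivity)]
    exact key _ hv h5
  · rw [show (S.u t / deriv S.a t) ^ 2 / (S.u t * S.w t / (deriv S.a t * deriv S.b t))
      = S.u t * deriv S.b t / (deriv S.a t * S.w t) by field_simp, div_le_one (by positivity)]
    exact key _ hw h6

lemma hasBoundedCurvature_abelian : (abelian S g₁).HasBoundedCurvature S := by
  -- With `x = A₃²/A₁²` and `y = A₃²/B₁²` in `[0, 1]`, the squared norm is `4g₁²((x - y)² + x² +
  -- y²)`, and the bracket is at most `4`.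
  refine ⟨16 * g₁ ^ 2, fun t ht => ?_⟩
  obtain ⟨h0, h1, h2, h3⟩ := abelian_coeffs S g₁
  rw [curvatureNormSq_eq _ _ (by simp [h3]) (by simp [h3]) (by simp [h3, Pi.zero_def])
    (by simp [h3, Pi.zero_def])]
  have hd := (((S.hasDerivAt_A₃ ht).pow 2).const_mul (2 * g₁)).deriv
  have hd' : deriv (fun t => 2 * g₁ * S.A₃ t ^ 2) t = 2 * g₁ * S.A₃ t
      * (S.A₃ t ^ 2 / S.A₁ t ^ 2 - S.A₃ t ^ 2 / S.B₁ t ^ 2) := by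
    refine hd.trans ?_
    have e1 : S.A₃ t ^ 2 / S.A₁ t ^ 2 = S.A₃ t * (deriv S.b t / S.v t) := by
      rw [← (S.A₃_div_A₁_sq ht).1]; ring
    have e2 : S.A₃ t ^ 2 / S.B₁ t ^ 2 = S.A₃ t * (deriv S.b t / S.w t) := by
      rw [← (S.A₃_div_A₁_sq ht).2]; ring
    rw [e1, e2]
    simp
    ring
  obtain ⟨hx, hy⟩ := S.A₃_sq_div_le ht
  have hx0 : 0 ≤ S.A₃ t ^ 2 / S.A₁ t ^ 2 := by positivity
  have hy0 : 0 ≤ S.A₃ t ^ 2 / S.B₁ t ^ 2 := by positivity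
  have h3p := S.A₃_pos ht
  rw [h0, h2, hd']
  have e : 2 * (deriv (0 : ℝ → ℝ) t ^ 2 / S.A₁ t ^ 2
        + ((0 : ℝ → ℝ) t * (2 * g₁ * S.A₃ t ^ 2) - (0 : ℝ → ℝ) t) ^ 2
          / (S.A₁ t ^ 2 * S.A₃ t ^ 2)
        + (0 : ℝ → ℝ) t ^ 2 / (S.B₁ t ^ 2 * S.B₃ t ^ 2))
      + ((2 * g₁ * S.A₃ t * (S.A₃ t ^ 2 / S.A₁ t ^ 2 - S.A₃ t ^ 2 / S.B₁ t ^ 2)) ^ 2 / S.A₃ t ^ 2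
        + ((0 : ℝ → ℝ) t ^ 2 - 2 * g₁ * S.A₃ t ^ 2) ^ 2 / (S.A₁ t ^ 2 * S.A₁ t ^ 2)
        + (2 * g₁ * S.A₃ t ^ 2) ^ 2 / (S.B₁ t ^ 2 * S.B₁ t ^ 2))
      = 4 * g₁ ^ 2 * ((S.A₃ t ^ 2 / S.A₁ t ^ 2 - S.A₃ t ^ 2 / S.B₁ t ^ 2) ^ 2
        + (S.A₃ t ^ 2 / S.A₁ t ^ 2) ^ 2 + (S.A₃ t ^ 2 / S.B₁ t ^ 2) ^ 2) := by
    simp [Pi.zero_def]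
    field_simp
    ring
  rw [e]
  generalize S.A₃ t ^ 2 / S.A₁ t ^ 2 = x at *
  generalize S.A₃ t ^ 2 / S.B₁ t ^ 2 = y at *
  have : (x - y) ^ 2 + x ^ 2 + y ^ 2 ≤ 4 := by nlinarith
  nlinarith [sq_nonneg g₁, mul_le_mul_of_nonneg_left this (sq_nonneg g₁)]

variable {C S g₁}

/-- If `f₁⁺ = 0`, then the instanton extends. -/
lemma IsInstantonOnP₁.extendsGlobally {T : ℝ} (hT : 0 < T) (hC : C.IsInstantonOnP₁ S (Ioo 0 T))
    (hf : C.fPlus =O[𝓝[>] 0] (fun t => t ^ 3))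
    (hg : (fun t => C.gPlus t - g₁ * t) =O[𝓝[>] 0] (fun t => t ^ 3)) :
    C.ExtendsGlobally S T := by
  have hI : Ioo 0 T ⊆ Ioi 0 := fun t ht => ht.1
  have hP := hC.coeffPlus_zero_eq_zero hI isOpen_Ioo (Ioo_mem_nhdsGT hT) (convex_Ioo 0 T) hf
  have hM := hC.coeffMinus_eq_zero hI isOpen_Ioo (Ioo_mem_nhdsGT hT) (convex_Ioo 0 T)
  have hQ := hC.coeffPlus_two_eq hT hf hg
  have hagree : C.AgreeOn (abelian S g₁) (Ioo 0 T) := by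
    refine ⟨fun t ht => ?_, fun t ht => ?_, fun t ht => ?_, fun t ht => ?_⟩
    · exact (mul_eq_zero.1 (hP t ht)).resolve_left (S.A₁_pos ht.1).ne'
    · exact (mul_eq_zero.1 (hM t ht).1).resolve_left (S.B₁_pos ht.1).ne'
    · have h1 : S.A₃ t * C.gPlus t = 2 * g₁ * S.A₃ t ^ 2 := hQ t ht
      refine mul_left_cancel₀ (S.A₃_pos ht.1).ne' (h1.trans ?_)
      simp only [abelian]; ring
    · exact (mul_eq_zero.1 (hM t ht).2).resolve_left (S.B₃_pos ht.1).ne'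
  refine ⟨abelian S g₁, hagree, ⟨?_, solvesInstantonEq_abelian S g₁⟩,
    hasBoundedCurvature_abelian S g₁⟩
  obtain ⟨𝒜, h1, h2⟩ := hC.1
  have heq : ∀ x : ℍ[ℝ] × ℍ[ℝ], x.1 ≠ 0 → x.2 ≠ 0 → ‖x.2‖ < T →
      𝒜 x = abelianForm S g₁ x := by
    intro x hx1 hx2 hxT
    have hmem : ‖x.2‖ ∈ Ioo 0 T := ⟨norm_pos_iff.2 hx2, hxT⟩
    refine ContinuousLinearMap.ext fun z => ?_
    have h3 := h2 x.1 x.2 hx1 hx2 hmem z.1 z.2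
    refine h3.trans ?_
    have e1 : ∀ k, C.coeffPlus S k ‖x.2‖ = (abelian S g₁).coeffPlus S k ‖x.2‖ := fun k => by
      simp only [coeffPlus, hagree.1 hmem, hagree.2.2.1 hmem]
    have e2 : ∀ k, C.coeffMinus S k ‖x.2‖ = (abelian S g₁).coeffMinus S k ‖x.2‖ := fun k => by
      simp only [coeffMinus, hagree.2.1 hmem, hagree.2.2.2 hmem]
    rw [← formOnM_abelian]
    simp only [formOnM, e1, e2]
    rfl
  classical
  -- The given smooth form supplies the values on the singular orbit. It agrees with the abelian
  -- formula for `0 < ‖y‖ < T`, so smoothness there needs no separate proof.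
  refine ⟨fun x => if x.2 = 0 then 𝒜 x else abelianForm S g₁ x, ?_,
    fun p y hp hy _ v w => by
      simp only [hy, if_false]
      exact (formOnM_abelian S g₁ (p, y) (v, w)).symm⟩
  rintro x ⟨hx1, -⟩
  refine ContDiffAt.contDiffWithinAt ?_
  have ho1 : IsOpen {x : ℍ[ℝ] × ℍ[ℝ] | x.1 ≠ 0} := isOpen_ne_fun continuous_fst continuous_const
  have ho2 : IsOpen {x : ℍ[ℝ] × ℍ[ℝ] | x.2 ≠ 0} := isOpen_ne_fun continuous_snd continuous_const
  have ho3 : IsOpen {x : ℍ[ℝ] × ℍ[ℝ] | ‖x.2‖ < T} :=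
    isOpen_lt continuous_snd.norm continuous_const
  by_cases hx2 : x.2 = 0
  · have hxT : ‖x.2‖ < T := by rw [hx2, norm_zero]; exact hT
    have hnhds := (ho1.inter ho3).mem_nhds ⟨hx1, hxT⟩
    refine (h1.contDiffAt (mem_of_superset hnhds ?_)).congr_of_eventuallyEq
      (eventually_of_mem hnhds ?_)
    · rintro y ⟨hy1, hy2⟩
      refine ⟨hy1, or_iff_not_imp_left.2 fun h => ⟨norm_pos_iff.2 h, hy2⟩⟩
    · rintro y ⟨hy1, hy2⟩
      by_cases hy : y.2 = 0
      · simp [hy]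
      · simp only [hy, if_false]
        exact (heq y hy1 hy hy2).symm
  · have hnhds := (ho1.inter ho2).mem_nhds ⟨hx1, hx2⟩
    refine ((contDiffOn_abelianForm S g₁).contDiffAt hnhds).congr_of_eventuallyEq
      (eventually_of_mem hnhds ?_)
    rintro y ⟨-, hy2⟩
    exact if_neg hy2

end Connection

/-! ### Growth of the metric coefficients at infinity -/

namespace Metric
variable (S : Metric)

lemma monotoneOn_A₃ : MonotoneOn S.A₃ (Ioi 0) :=
  monotoneOn_of_hasDerivAt (convex_Ioi 0) (fun _ ht => S.hasDerivAt_A₃ ht) (fun t ht => by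
    have h1 := S.A₃_pos ht
    have h2 := S.deriv_b_pos ht
    have hv := S.v_pos ht
    have hvw : S.v t ≤ S.w t := by
      have := S.b_gt ht
      have := S.p_pos
      simp only [v, w]; linarith
    have h3 := one_div_le_one_div_of_le hv hvw
    exact mul_nonneg h1.le (mul_nonneg (by positivity) (sub_nonneg.2 h3)))

/-- A positive lower bound of `ȧ` away from the singular orbit. -/
lemma exists_deriv_a_ge : ∃ c, 0 < c ∧ ∀ t, 1 ≤ t → c ≤ deriv S.a t := by
  refine ⟨√(deriv S.a 1 * deriv S.b 1), Real.sqrt_pos.2 (S.x₁_pos one_pos), fun t ht => ?_⟩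
  have ht0 : 0 < t := one_pos.trans_le ht
  have h1 := S.monotoneOn_x₁ (mem_Ioi.2 one_pos) (mem_Ioi.2 ht0) ht
  have h2 := S.deriv_a_pos ht0
  refine Real.sqrt_le_iff.2 ⟨h2.le, h1.trans ?_⟩
  rw [sq]
  exact mul_le_mul_of_nonneg_left (S.a_gt_b_and ht0).2.le h2.le

lemma tendsto_a_atTop : Tendsto S.a atTop atTop := by
  obtain ⟨c, hc, h⟩ := S.exists_deriv_a_ge
  have hm : MonotoneOn (fun t => S.a t - c * t) (Ici 1) :=
    monotoneOn_of_hasDerivAt (convex_Ici 1)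
      (fun t ht => (S.hasDerivAt_a (one_pos.trans_le ht)).sub ((hasDerivAt_id t).const_mul c))
      (fun t ht => by have := h t ht; simp; linarith)
  have hlin : Tendsto (fun t => (S.a 1 - c * 1) + c * t) atTop atTop :=
    tendsto_atTop_add_const_left _ _ (tendsto_id.const_mul_atTop hc)
  refine tendsto_atTop_mono' _ ?_ hlin
  filter_upwards [eventually_ge_atTop 1] with t ht
  have := hm (mem_Ici.2 le_rfl) (mem_Ici.2 ht) ht
  simp only at this
  linarith

variable {S} {ℓ : ℝ}

lemma IsCircleLength.tendsto (h : S.IsCircleLength ℓ) :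
    Tendsto (fun t => 2 * S.b t ^ 3 / (3 * S.a t ^ 2)) atTop (𝓝 (ℓ ^ 3)) := by
  refine (h.2.pow 3).congr' ?_
  filter_upwards [eventually_gt_atTop 0] with t ht
  have h1 := S.a_pos ht
  have h2 := S.p_pos.trans (S.b_gt ht)
  rw [← Real.rpow_natCast, ← Real.rpow_mul (by positivity)]
  norm_num

/-- `(b/a)³` is the convergent quantity `b³/a²` divided by `a → ∞`. -/
lemma IsCircleLength.tendsto_b_div_a (h : S.IsCircleLength ℓ) :
    Tendsto (fun t => S.b t / S.a t) atTop (𝓝 0) := by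
  have h1 := (h.tendsto.const_mul (3 / 2)).mul S.tendsto_a_atTop.inv_tendsto_atTop
  rw [mul_zero] at h1
  have h2 := h1.rpow_const (p := (1 / 3 : ℝ)) (Or.inr (by norm_num))
  rw [Real.zero_rpow (by norm_num)] at h2
  refine h2.congr' ?_
  filter_upwards [eventually_gt_atTop 0] with t ht
  have h3 := S.a_pos ht
  have h4 := S.p_pos.trans (S.b_gt ht)
  have e : 3 / 2 * (2 * S.b t ^ 3 / (3 * S.a t ^ 2)) * S.a⁻¹ t = (S.b t / S.a t) ^ 3 := by
    simp only [Pi.inv_apply]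
    field_simp
  rw [e, ← Real.rpow_natCast, ← Real.rpow_mul (by positivity)]
  norm_num

/-- `√F = u√(vw)` and `vw = 4a² - (b + p)²`. As `b/a → 0`, the bound is asymptotically sharp, which
`eventually_sqrtF_ge` records. -/
lemma sqrtF_le {t : ℝ} (ht : 0 < t) : S.sqrtF t ≤ 2 * S.a t * S.u t := by
  have h1 := S.a_pos ht
  have h2 := S.u_pos ht
  refine (sq_le_sq₀ (S.sqrtF_pos ht).le (by positivity)).1 ?_
  rw [S.sqrtF_sq ht, mul_assoc, mul_comm (2 * S.a t), mul_pow]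
  refine mul_le_mul_of_nonneg_left ?_ (by positivity)
  simp only [v, w]
  nlinarith [sq_nonneg (S.b t + S.p)]

lemma IsCircleLength.eventually_sqrtF_ge (h : S.IsCircleLength ℓ) {θ : ℝ} (hθ0 : 0 < θ)
    (hθ : θ < 1) : ∀ᶠ t in atTop, θ * (2 * S.a t * S.u t) ≤ S.sqrtF t := by
  have h1 : Tendsto (fun t => 1 - ((S.b t / S.a t + S.p / S.a t) / 2) ^ 2) atTop (𝓝 1) := by
    have := (((h.tendsto_b_div_a.add (tendsto_const_nhds.div_atTop S.tendsto_a_atTop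
      (a := S.p))).div_const 2).pow 2).const_sub 1
    simpa using this
  have hθ2 : θ ^ 2 < 1 := by nlinarith
  filter_upwards [h1.eventually_const_lt hθ2, eventually_gt_atTop 0] with t h2 ht
  have h3 := S.a_pos ht
  have h4 := S.u_pos ht
  refine (sq_le_sq₀ (by positivity) (S.sqrtF_pos ht).le).1 ?_
  rw [S.sqrtF_sq ht]
  have e : S.u t ^ 2 * S.v t * S.w t
      = (1 - ((S.b t / S.a t + S.p / S.a t) / 2) ^ 2) * (2 * S.a t * S.u t) ^ 2 := by
    simp only [v, w]
    field_simp
    ring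
  rw [e, mul_pow]
  exact mul_le_mul_of_nonneg_right h2.le (by positivity)

/-- The circle fibre is never longer than its asymptotic length. -/
lemma IsCircleLength.A₃_le (h : S.IsCircleLength ℓ) {t₁ : ℝ} (ht₁ : 0 < t₁) : S.A₃ t₁ ≤ ℓ := by
  have hm0 := S.A₃_pos ht₁
  have key : ∀ θ, 0 < θ → θ < 1 → S.A₃ t₁ ^ 3 * θ ≤ ℓ ^ 3 := by
    intro θ hθ0 hθ1
    obtain ⟨t₂, ht₂⟩ := eventually_atTop.1 (h.eventually_sqrtF_ge hθ0 hθ1)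
    set r := max t₁ t₂ with hr
    have hr0 : 0 < r := ht₁.trans_le (le_max_left _ _)
    -- One has `(u³)˙ = (3/2)A₃³(ȧ/u)√F`. Monotonicity of `A₃` and `√F ≥ 2θau` bound it below by
    -- `(3/2)A₃(t₁)³θ(a²)˙`. Integrating and dividing by `a² → ∞` compares `A₃(t₁)³θ` with `ℓ³`.
    have hmono : MonotoneOn (fun t => S.u t ^ 3 - 3 / 2 * (S.A₃ t₁ ^ 3 * θ) * S.a t ^ 2)
        (Ici r) := by
      refine monotoneOn_of_hasDerivAt (convex_Ici r) (fun t ht =>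
        ((S.hasDerivAt_u (hr0.trans_le ht)).pow 3).sub
          (((S.hasDerivAt_a (hr0.trans_le ht)).pow 2).const_mul _)) (fun t ht => ?_)
      have ht0 : 0 < t := hr0.trans_le ht
      have h1 := S.deriv_a_pos ht0
      have h3 := S.a_pos ht0
      have h4 := S.u_pos ht0
      have h5 := ht₂ t ((le_max_right _ _).trans ht)
      have h6p := S.A₃_pos ht0
      have h6 : S.A₃ t₁ ≤ S.A₃ t := S.monotoneOn_A₃ ht₁ ht0 ((le_max_left _ _).trans ht)
      have h7 : S.A₃ t₁ ^ 3 ≤ S.A₃ t ^ 3 := pow_le_pow_left₀ hm0.le h6 3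
      have e : 3 * S.u t ^ 2 * deriv S.b t
          = 3 / 2 * S.A₃ t ^ 3 * (deriv S.a t / S.u t) * S.sqrtF t := by
        rw [S.sqrtF_eq ht0, show S.A₃ t = S.u t / deriv S.a t from rfl]
        field_simp
      simp only [Nat.cast_ofNat, Nat.add_one_sub_one, pow_one]
      rw [e]
      have h8 : 3 / 2 * S.A₃ t₁ ^ 3 * (deriv S.a t / S.u t) * (θ * (2 * S.a t * S.u t))
          ≤ 3 / 2 * S.A₃ t ^ 3 * (deriv S.a t / S.u t) * S.sqrtF t := by
        gcongr
      have h9 : 3 / 2 * S.A₃ t₁ ^ 3 * (deriv S.a t / S.u t) * (θ * (2 * S.a t * S.u t))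
          = 3 / 2 * (S.A₃ t₁ ^ 3 * θ) * (2 * S.a t * deriv S.a t) := by
        field_simp
      linarith
    set c := S.u r ^ 3 - 3 / 2 * (S.A₃ t₁ ^ 3 * θ) * S.a r ^ 2 with hc
    have hlim : Tendsto (fun t => S.A₃ t₁ ^ 3 * θ + 2 / 3 * (c / S.a t ^ 2)) atTop
        (𝓝 (S.A₃ t₁ ^ 3 * θ)) := by
      have := ((tendsto_const_nhds (x := c)).div_atTop
        ((tendsto_pow_atTop two_ne_zero).comp S.tendsto_a_atTop)).const_mul (2 / 3)
      simpa using this.const_add (S.A₃ t₁ ^ 3 * θ)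
    refine le_of_tendsto_of_tendsto hlim h.tendsto ?_
    filter_upwards [eventually_ge_atTop r] with t ht
    have ht0 : 0 < t := hr0.trans_le ht
    have h1 := hmono (mem_Ici.2 le_rfl) (mem_Ici.2 ht) ht
    simp only at h1
    have h3 := S.a_pos ht0
    have h4 : S.u t ^ 3 ≤ S.b t ^ 3 := pow_le_pow_left₀ (S.u_pos ht0).le
      (by have := S.p_pos; simp only [u]; linarith) 3
    rw [le_div_iff₀ (by positivity)]
    have e : (S.A₃ t₁ ^ 3 * θ + 2 / 3 * (c / S.a t ^ 2)) * (3 * S.a t ^ 2)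
        = 2 * (3 / 2 * (S.A₃ t₁ ^ 3 * θ) * S.a t ^ 2 + c) := by
      field_simp
    rw [e]
    linarith
  by_contra! hlt
  have h1 : ℓ ^ 3 < S.A₃ t₁ ^ 3 := pow_lt_pow_left₀ hlt h.1.le (by norm_num)
  have h2 : 0 < S.A₃ t₁ ^ 3 := pow_pos hm0 3
  have h3 : 0 < ℓ ^ 3 := pow_pos h.1 3
  -- If `ℓ < A₃(t₁)`, this `θ` lies strictly between `ℓ³/A₃(t₁)³` and `1`, which contradicts `key`.
  have h4 := key ((ℓ ^ 3 / S.A₃ t₁ ^ 3 + 1) / 2) (by positivity) (by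
    have := (div_lt_one h2).2 h1
    linarith)
  have e : S.A₃ t₁ ^ 3 * ((ℓ ^ 3 / S.A₃ t₁ ^ 3 + 1) / 2) = (ℓ ^ 3 + S.A₃ t₁ ^ 3) / 2 := by
    field_simp
  linarith

/-- `ȧ / a → 0`. -/
lemma IsCircleLength.tendsto_deriv_a_div_a (h : S.IsCircleLength ℓ) :
    Tendsto (fun t => deriv S.a t / S.a t) atTop (𝓝 0) := by
  have h1 := h.tendsto_b_div_a.const_mul (S.A₃ 1)⁻¹
  rw [mul_zero] at h1
  refine squeeze_zero' ?_ ?_ h1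
  · filter_upwards [eventually_gt_atTop 0] with t ht
    exact (div_pos (S.deriv_a_pos ht) (S.a_pos ht)).le
  · filter_upwards [eventually_ge_atTop 1] with t ht
    have ht0 : 0 < t := one_pos.trans_le ht
    have h2 := S.a_pos ht0
    have h3 := S.A₃_pos one_pos
    have h4 : S.A₃ 1 ≤ S.A₃ t := S.monotoneOn_A₃ (mem_Ioi.2 one_pos) (mem_Ioi.2 ht0) ht
    rw [show S.A₃ t = S.u t / deriv S.a t from rfl, le_div_iff₀ (S.deriv_a_pos ht0)] at h4
    have h5 : S.u t ≤ S.b t := by have := S.p_pos; simp only [u]; linarith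
    rw [← mul_div_assoc]
    refine div_le_div_of_nonneg_right ?_ h2.le
    rw [inv_mul_eq_div, le_div_iff₀ h3]
    linarith

lemma IsCircleLength.eventually_deriv_a_small (h : S.IsCircleLength ℓ) {ε : ℝ} (hε : 0 < ε) :
    ∀ᶠ t in atTop, deriv S.a t / S.w t + deriv S.a t / S.a t ≤ ε := by
  filter_upwards [h.tendsto_deriv_a_div_a.eventually_lt_const (half_pos hε),
    eventually_gt_atTop 0] with t h1 ht
  have h2 := S.a_pos ht
  have h3 : deriv S.a t / S.w t ≤ deriv S.a t / S.a t := by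
    refine div_le_div_of_nonneg_left (S.deriv_a_pos ht).le h2 ?_
    have := S.p_pos
    have := S.b_gt ht
    simp only [w]; linarith
  linarith

/-- The left side is `2w√F/(uȧ)`, with `w ≤ 4a` and `√F ≤ 2au`. It turns growth of `P/a` into growth
of curvature. -/
lemma B₁_sq_mul_B₃_sq_le {t c : ℝ} (ht : 0 < t) (hc : 0 < c) (hX : c ≤ deriv S.a t) :
    S.B₁ t ^ 2 * S.B₃ t ^ 2 ≤ 16 / c * S.a t ^ 2 := by
  have h1 := S.deriv_a_pos ht
  have h2 := S.deriv_b_pos ht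
  have hu := S.u_pos ht
  have hw := S.w_pos ht
  have ha := S.a_pos ht
  have e : S.B₁ t ^ 2 * S.B₃ t ^ 2 = 2 * S.w t * (S.sqrtF t / S.u t) / deriv S.a t := by
    rw [S.B₁_sq ht, show S.B₃ t = 2 * deriv S.a t * deriv S.b t / S.u t from rfl, S.sqrtF_eq ht]
    field_simp
  have hw4 : S.w t ≤ 4 * S.a t := by
    have := S.v_pos ht
    simp only [v, w] at *; linarith
  have hs : S.sqrtF t / S.u t ≤ 2 * S.a t := (div_le_iff₀ hu).2 (sqrtF_le ht)
  have hs0 := S.sqrtF_pos ht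
  rw [e]
  calc 2 * S.w t * (S.sqrtF t / S.u t) / deriv S.a t
      ≤ 2 * (4 * S.a t) * (2 * S.a t) / c := by gcongr
    _ = _ := by ring

variable (S) in
-- This is where `H` comes from: the logarithmic derivative of `P/(A₁A₃) = f⁺/A₃`, with the `Q`-term
-- removed, equals `A₃H`.
lemma deriv_combination_eq {t : ℝ} (ht : 0 < t) :
    deriv S.a t / S.u t - deriv S.a t / S.w t
      - 1 / 2 * (deriv S.b t / S.u t + (2 * deriv S.a t - deriv S.b t) / S.v t
      - 4 * S.a t * deriv S.a t / (S.v t * S.w t))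
      - deriv S.b t / 2 * (1 / S.v t - 1 / S.w t) = S.A₃ t * S.H t := by
  have h1 := S.deriv_a_pos ht
  have hu := S.u_pos ht
  have hv := S.v_pos ht
  have hw := S.w_pos ht
  have hb : S.b t = (S.w t - S.v t) / 2 - S.p := S.b_eq t
  have hp : S.p = ((S.w t - S.v t) / 2 - S.u t) / 2 := by rw [S.u_eq]; ring
  rw [S.H_eq ht, show S.A₃ t = S.u t / deriv S.a t from rfl, hb, hp, S.a_eq]
  field_simp
  ring

end Metric
end B7

/-! ### Comparison arguments on half-lines -/

lemma hasDerivAt_min_zero_sq (x : ℝ) :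
    HasDerivAt (fun x : ℝ => min x 0 ^ 2) (2 * min x 0) x := by
  rcases lt_trichotomy x 0 with hx | rfl | hx
  · rw [min_eq_left hx.le]
    have h : HasDerivAt (fun x : ℝ => x ^ 2) (2 * x) x := by simpa using hasDerivAt_pow 2 x
    refine h.congr_of_eventuallyEq ?_
    filter_upwards [Iio_mem_nhds hx] with y hy
    rw [min_eq_left (le_of_lt hy)]
  · rw [hasDerivAt_iff_isLittleO_nhds_zero]
    simp only [zero_add, min_self, mul_zero, smul_zero, sub_zero, ne_eq, OfNat.ofNat_ne_zero,
      not_false_eq_true, zero_pow]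
    have h1 : (fun h : ℝ => min h 0 ^ 2) =O[𝓝 0] (fun h => h ^ 2) :=
      IsBigO.of_bound 1 (Eventually.of_forall fun y => by
        rw [one_mul, norm_pow, norm_pow]
        refine pow_le_pow_left₀ (norm_nonneg _) ?_ 2
        rw [Real.norm_eq_abs, Real.norm_eq_abs]
        rcases le_total y 0 with hy | hy
        · rw [min_eq_left hy]
        · rw [min_eq_right hy, abs_zero]; exact abs_nonneg _)
    have h2 : (fun h : ℝ => h ^ 2) =o[𝓝 0] (fun h => h) := by
      simpa using Asymptotics.isLittleO_pow_pow (𝕜 := ℝ) (show 1 < 2 by norm_num)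
    exact h1.trans_isLittleO h2
  · rw [min_eq_right hx.le, mul_zero]
    refine (hasDerivAt_const x (0 : ℝ)).congr_of_eventuallyEq ?_
    filter_upwards [Ioi_mem_nhds hx] with y hy
    rw [min_eq_right (le_of_lt hy)]; simp

/-- A solution of `Z' ≥ f Z` with nonnegative initial value stays nonnegative, if `f` is bounded
above near the singular initial time. -/
lemma nonneg_of_deriv_ge {Z Z' f : ℝ → ℝ} (hZ : ∀ t, 0 < t → HasDerivAt Z (Z' t) t)
    (hle : ∀ t, 0 < t → f t * Z t ≤ Z' t) (hf : ContinuousOn f (Ioi 0)) {F : ℝ}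
    (hf0 : ∀ᶠ t in 𝓝[>] 0, f t ≤ F) {z : ℝ} (hz : Tendsto Z (𝓝[>] 0) (𝓝 z)) (hz0 : 0 ≤ z)
    {t₁ : ℝ} (ht₁ : 0 < t₁) : 0 ≤ Z t₁ := by
  obtain ⟨δ, hδ, hδ'⟩ := mem_nhdsGT_iff_exists_Ioo_subset.1 hf0
  have hδ0 : (0 : ℝ) < δ := hδ
  obtain ⟨K, hK⟩ := (isCompact_Icc (a := δ / 2) (b := t₁ + 1)).exists_bound_of_continuousOn
    (hf.mono fun t ht => lt_of_lt_of_le (half_pos hδ0) ht.1)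
  have hbound : ∀ t ∈ Ioo 0 (t₁ + 1), f t ≤ max F K := by
    intro t ht
    rcases lt_or_ge t δ with h | h
    · exact (hδ' ⟨ht.1, h⟩).trans (le_max_left _ _)
    · exact ((le_abs_self _).trans (hK t ⟨by linarith, ht.2.le⟩)).trans (le_max_right _ _)
  set G := max F K
  have hexp : ∀ t : ℝ, HasDerivAt (fun s => Real.exp (-2 * G * s))
      (Real.exp (-2 * G * t) * (-2 * G)) t :=
    fun t => by simpa using ((hasDerivAt_id t).const_mul (-2 * G)).exp
  -- The squared negative part is differentiable, and multiplying `Z' ≥ fZ` by the nonpositive `min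
  -- Z 0` gives a Grönwall inequality for it. An upper bound `G` of `f` suffices.
  have hanti : AntitoneOn (fun t => min (Z t) 0 ^ 2 * Real.exp (-2 * G * t)) (Ioo 0 (t₁ + 1)) := by
    refine antitoneOn_of_hasDerivAt (convex_Ioo _ _)
      (fun t ht => ((hasDerivAt_min_zero_sq (Z t)).comp t (hZ t ht.1)).mul (hexp t))
      (fun t ht => ?_)
    have h1 := Real.exp_pos (-2 * G * t)
    have h2 : min (Z t) 0 * Z t = min (Z t) 0 ^ 2 := by
      rcases le_total (Z t) 0 with h | h
      · rw [min_eq_left h]; ring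
      · rw [min_eq_right h]; ring
    have h3 : min (Z t) 0 * Z' t ≤ min (Z t) 0 * (f t * Z t) :=
      mul_le_mul_of_nonpos_left (hle t ht.1) (min_le_right _ _)
    have h4 : f t * min (Z t) 0 ^ 2 ≤ G * min (Z t) 0 ^ 2 :=
      mul_le_mul_of_nonneg_right (hbound t ht) (sq_nonneg _)
    have h5 : 2 * min (Z t) 0 * Z' t - 2 * G * min (Z t) 0 ^ 2 ≤ 0 := by
      have : min (Z t) 0 * (f t * Z t) = f t * min (Z t) 0 ^ 2 := by rw [← h2]; ring
      linarith
    have := mul_nonpos_of_nonpos_of_nonneg h5 h1.le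
    simp only [Function.comp_apply]
    linarith
  have hlim : Tendsto (fun t => min (Z t) 0 ^ 2 * Real.exp (-2 * G * t)) (𝓝[>] 0) (𝓝 0) := by
    have h1 : Tendsto (fun t => Real.exp (-2 * G * t)) (𝓝[>] 0) (𝓝 (Real.exp (-2 * G * 0))) :=
      tendsto_nhdsWithin_of_tendsto_nhds (hexp 0).continuousAt
    have h2 := ((hz.min (tendsto_const_nhds (x := (0 : ℝ)))).pow 2).mul h1
    rwa [min_eq_right hz0, zero_pow two_ne_zero, zero_mul] at h2
  have h := nonpos_of_antitoneOn_of_tendsto hanti hlim t₁ ⟨ht₁, lt_add_one t₁⟩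
  have h2 : min (Z t₁) 0 = 0 := pow_eq_zero_iff two_ne_zero |>.1
    (le_antisymm (nonpos_of_mul_nonpos_left h (Real.exp_pos _)) (sq_nonneg _))
  rw [← h2]; exact min_le_left _ _

/-- There is no function on a half-line that is bounded below by `0` with derivative bounded away
from `0` from above. -/
lemma exists_lt_of_deriv_le {h h' : ℝ → ℝ} {c r m : ℝ} (hc : 0 < c)
    (hd : ∀ t ∈ Ici r, HasDerivAt h (h' t) t) (hle : ∀ t ∈ Ici r, h' t ≤ -c) :
    ∃ t ∈ Ici r, h t < m := by
  by_contra! hge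
  have hanti : AntitoneOn (fun t => h t + c * t) (Ici r) :=
    antitoneOn_of_hasDerivAt (convex_Ici r)
      (fun t ht => (hd t ht).add ((hasDerivAt_id t).const_mul c))
      (fun t ht => by have := hle t ht; simp; linarith)
  -- At this `s` the affine upper bound `h r - c(s - r)` is at most `m - 1`.
  set s := max r ((h r + c * r - m + 1) / c) with hs
  have hrs : r ≤ s := le_max_left _ _
  have h1 := hanti (mem_Ici.2 le_rfl) (mem_Ici.2 hrs) hrs
  have h2 := hge s hrs
  have h3 : (h r + c * r - m + 1) / c ≤ s := le_max_right _ _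
  rw [div_le_iff₀ hc] at h3
  simp only at h1
  linarith

/-! ### Unbounded curvature when `f₁⁺ ≠ 0` -/

namespace B7
namespace Connection
variable {D : Connection} {S : Metric} {ℓ : ℝ}

/-- If `A₃ g⁺` stays below `1 - ε` and `f⁺` does not vanish, the curvature is unbounded. -/
lemma IsInstantonOnP₁.not_hasBoundedCurvature (hD : D.IsInstantonOnP₁ S (Ioi 0))
    (hℓ : S.IsCircleLength ℓ) (hP : ∀ t, 0 < t → D.coeffPlus S 0 t ≠ 0) {ε t₁ : ℝ} (hε : 0 < ε)
    (hQ : ∀ t, t₁ ≤ t → D.coeffPlus S 2 t ≤ 1 - ε) : ¬ D.HasBoundedCurvature S := by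
  rintro ⟨K, hK⟩
  have hℓ0 : 0 < ℓ := hℓ.1
  obtain ⟨c, hc, hX⟩ := S.exists_deriv_a_ge
  have hminus := hD.coeffMinus_eq_zero subset_rfl isOpen_Ioi self_mem_nhdsWithin (convex_Ioi 0)
  have hode := fun t (ht : 0 < t) => hD.hasDerivAt subset_rfl isOpen_Ioi self_mem_nhdsWithin
    (convex_Ioi 0) (mem_Ioi.2 ht)
  obtain ⟨t₂, ht₂⟩ := eventually_atTop.1
    (hℓ.eventually_deriv_a_small (half_pos (div_pos hε hℓ0)))
  set r := max 1 (max t₁ t₂) with hr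
  have hr0 : 0 < r := one_pos.trans_le (le_max_left _ _)
  have hr1 : 1 ≤ r := le_max_left _ _
  let E : ℝ → ℝ := fun t => D.coeffPlus S 0 t ^ 2 / S.a t ^ 2
  let E' : ℝ → ℝ := fun t => 2 * E t * (deriv S.a t * ((1 - D.coeffPlus S 2 t) / S.u t
    - 1 / S.w t) - deriv S.a t / S.a t)
  have hE : ∀ t ∈ Ici r, HasDerivAt E (E' t) t := by
    intro t ht
    have ht0 : 0 < t := hr0.trans_le ht
    have ha := S.a_pos ht0
    refine (((hode t ht0).1.pow 2).div ((S.hasDerivAt_a ht0).pow 2) (pow_ne_zero 2 ha.ne')).congr_deriv ?_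
    simp only [E', E, Pi.pow_apply]
    simp
    field_simp
  have hE0 : ∀ t, 0 < t → 0 < E t := fun t ht => by
    have := S.a_pos ht
    have := hP t ht
    positivity
  -- The growth rate of `P` contains `(1 - Q)/A₃ ≥ ε/ℓ`. The terms `ȧ/w` and `ȧ/a` take at most half
  -- of it, and squaring restores the factor `2`.
  have hE' : ∀ t ∈ Ici r, ε / ℓ * E t ≤ E' t := by
    intro t ht
    have ht0 : 0 < t := hr0.trans_le ht
    have h1 := hQ t (((le_max_left _ _).trans (le_max_right _ _)).trans ht)
    have h2 := ht₂ t (((le_max_right _ _).trans (le_max_right _ _)).trans ht)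
    have h3 : ε / ℓ ≤ deriv S.a t * ((1 - D.coeffPlus S 2 t) / S.u t) := by
      have h4 : deriv S.a t * ((1 - D.coeffPlus S 2 t) / S.u t)
          = (1 - D.coeffPlus S 2 t) / S.A₃ t := by
        rw [show S.A₃ t = S.u t / deriv S.a t from rfl]
        have := S.deriv_a_pos ht0
        have := S.u_pos ht0
        field_simp
      rw [h4]
      exact div_le_div₀ (by linarith) (by linarith) (S.A₃_pos ht0) (hℓ.A₃_le ht0)
    have h5 := hE0 t ht0
    have e : E' t = 2 * E t * (deriv S.a t * ((1 - D.coeffPlus S 2 t) / S.u t)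
        - (deriv S.a t / S.w t + deriv S.a t / S.a t)) := by simp only [E']; ring
    rw [e]
    have h6 : ε / ℓ / 2 ≤ deriv S.a t * ((1 - D.coeffPlus S 2 t) / S.u t)
        - (deriv S.a t / S.w t + deriv S.a t / S.a t) := by linarith
    have h7 := mul_le_mul_of_nonneg_left h6 (show 0 ≤ 2 * E t by positivity)
    linarith
  have hEr := hE0 r hr0
  have hmono : MonotoneOn E (Ici r) := monotoneOn_of_hasDerivAt (convex_Ici r) hE
    (fun t ht => le_trans (by
      have := hE0 t (hr0.trans_le ht)
      positivity) (hE' t ht))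
  obtain ⟨t, ht, hlt⟩ := exists_lt_of_deriv_le (h := fun t => -E t) (h' := fun t => -E' t)
    (c := ε / ℓ * E r) (r := r) (m := -(|K| * (16 / c))) (by positivity)
    (fun t ht => (hE t ht).neg) (fun t ht => by
      have h1 := hmono (mem_Ici.2 le_rfl) ht ht
      have h2 := mul_le_mul_of_nonneg_left h1 (show 0 ≤ ε / ℓ by positivity)
      have := hE' t ht
      simp only [neg_le_neg_iff]
      linarith)
  have ht0 : 0 < t := hr0.trans_le ht
  have hcurv := hK t ht0
  have hzero : ∀ k : Fin 3, ∀ g : ℝ → ℝ, (∀ t ∈ Ioi (0 : ℝ), g t = 0) → deriv g t = 0 :=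
    fun _ g hg => by
      have : g =ᶠ[𝓝 t] fun _ => 0 := eventually_of_mem (Ioi_mem_nhds ht0) hg
      rw [this.deriv_eq]; simp
  rw [curvatureNormSq_eq _ _ (hminus t ht0).1 (hminus t ht0).2
    (hzero 0 _ fun t ht => (hminus t ht).1) (hzero 0 _ fun t ht => (hminus t ht).2)] at hcurv
  have hB := S.B₁_sq_mul_B₃_sq_le ht0 hc (hX t (hr1.trans ht))
  have hBpos : 0 < S.B₁ t ^ 2 * S.B₃ t ^ 2 := by
    have := S.B₁_pos ht0
    have := S.B₃_pos ht0
    positivity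
  -- All summands of `|F_A|²` are nonnegative, so this one alone is bounded.
  have hle : D.coeffPlus S 0 t ^ 2 / (S.B₁ t ^ 2 * S.B₃ t ^ 2) ≤ |K| := by
    have h1 : 0 ≤ deriv (D.coeffPlus S 0) t ^ 2 / S.A₁ t ^ 2 := by positivity
    have h2 : 0 ≤ (D.coeffPlus S 0 t * D.coeffPlus S 2 t - D.coeffPlus S 0 t) ^ 2
          / (S.A₁ t ^ 2 * S.A₃ t ^ 2) := by positivity
    have h3 : 0 ≤ deriv (D.coeffPlus S 2) t ^ 2 / S.A₃ t ^ 2 := by positivity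
    have h4 : 0 ≤ (D.coeffPlus S 0 t ^ 2 - D.coeffPlus S 2 t) ^ 2
      / (S.A₁ t ^ 2 * S.A₁ t ^ 2) := by positivity
    have h5 : 0 ≤ D.coeffPlus S 2 t ^ 2 / (S.B₁ t ^ 2 * S.B₁ t ^ 2) := by positivity
    have h6 : 0 ≤ D.coeffPlus S 0 t ^ 2 / (S.B₁ t ^ 2 * S.B₃ t ^ 2) := by positivity
    linarith [le_abs_self K]
  rw [div_le_iff₀ hBpos] at hle
  have ha := S.a_pos ht0
  have hfin : E t ≤ |K| * (16 / c) := by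
    refine (div_le_iff₀ (by positivity)).2 (hle.trans ?_)
    rw [mul_assoc]
    exact mul_le_mul_of_nonneg_left hB (abs_nonneg K)
  linarith

/-- The same conclusion if `g⁺ / A₃` drops below `ℓ⁻²`. -/
lemma IsInstantonOnP₁.not_hasBoundedCurvature_of_lt (hD : D.IsInstantonOnP₁ S (Ioi 0))
    (hℓ : S.IsCircleLength ℓ) (hP : ∀ t, 0 < t → D.coeffPlus S 0 t ≠ 0) {t₁ : ℝ} (ht₁ : 0 < t₁)
    (h : D.coeffPlus S 2 t₁ / S.A₃ t₁ ^ 2 < (ℓ ^ 2)⁻¹) : ¬ D.HasBoundedCurvature S := by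
  have hℓ0 : 0 < ℓ := hℓ.1
  set m := D.coeffPlus S 2 t₁ / S.A₃ t₁ ^ 2 with hm
  have hanti : AntitoneOn (fun t => D.coeffPlus S 2 t / S.A₃ t ^ 2) (Ioi 0) :=
    antitoneOn_of_hasDerivAt (convex_Ioi 0) (fun t ht => hD.hasDerivAt_div subset_rfl isOpen_Ioi
      self_mem_nhdsWithin (convex_Ioi 0) ht) (fun t ht => by
        have h1 := S.deriv_b_pos ht
        have h2 := S.v_pos ht
        have : 0 ≤ deriv S.b t * D.coeffPlus S 0 t ^ 2 / (S.v t * S.A₃ t ^ 2) := by positivity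
        linarith)
  have h1 : m * ℓ ^ 2 < 1 := by
    have := mul_lt_mul_of_pos_right h (pow_pos hℓ0 2)
    rwa [inv_mul_cancel₀ (pow_pos hℓ0 2).ne'] at this
  -- Since `Q/A₃²` is nonincreasing, `Q ≤ mA₃²` afterwards. This is at most `0` if `m ≤ 0`, and at
  -- most `mℓ² < 1` if `m ≥ 0`.
  refine hD.not_hasBoundedCurvature hℓ hP (ε := min 1 (1 - m * ℓ ^ 2)) (t₁ := t₁)
    (lt_min one_pos (by linarith)) (fun t ht => ?_)
  have ht0 : 0 < t := ht₁.trans_le ht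
  have h2 := hanti (mem_Ioi.2 ht₁) (mem_Ioi.2 ht0) ht
  simp only [← hm] at h2
  have h3 := S.A₃_pos ht0
  rw [div_le_iff₀ (by positivity)] at h2
  rcases le_total m 0 with hm0 | hm0
  · have h4 : m * S.A₃ t ^ 2 ≤ 0 := mul_nonpos_of_nonpos_of_nonneg hm0 (by positivity)
    have := min_le_left 1 (1 - m * ℓ ^ 2)
    linarith
  · have h4 : S.A₃ t ^ 2 ≤ ℓ ^ 2 := pow_le_pow_left₀ h3.le (hℓ.A₃_le ht0) 2
    have h5 := mul_le_mul_of_nonneg_left h4 hm0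
    have := min_le_right 1 (1 - m * ℓ ^ 2)
    linarith

/-- If `0 < f⁺` and `g₁⁺ ≤ f₁⁺`, then `g⁺ ≤ f⁺`. -/
lemma IsInstantonOnP₁.gPlus_le_fPlus (hD : D.IsInstantonOnP₁ S (Ioi 0))
    (hP : ∀ t, 0 < t → 0 < D.coeffPlus S 0 t) {f₁ g₁ : ℝ}
    (hf : (fun t => D.fPlus t - f₁ * t) =O[𝓝[>] 0] (fun t => t ^ 3))
    (hg : (fun t => D.gPlus t - g₁ * t) =O[𝓝[>] 0] (fun t => t ^ 3)) (hfg : g₁ ≤ f₁)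
    {t : ℝ} (ht : 0 < t) : D.gPlus t ≤ D.fPlus t := by
  let f : ℝ → ℝ := fun t => D.coeffPlus S 0 t / S.A₁ t
  let Z : ℝ → ℝ := fun t => D.coeffPlus S 0 t / (S.A₁ t * S.A₃ t) - D.coeffPlus S 2 t / S.A₃ t ^ 2
  have hode := fun t (ht : 0 < t) => (hD.hasDerivAt subset_rfl isOpen_Ioi self_mem_nhdsWithin
    (convex_Ioi 0) (mem_Ioi.2 ht)).1
  have hodeQ := fun t (ht : 0 < t) => hD.hasDerivAt_div subset_rfl isOpen_Ioi self_mem_nhdsWithin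
    (convex_Ioi 0) (mem_Ioi.2 ht)
  -- Here `f = f⁺` and `Z = (f⁺ - g⁺)/A₃`. The derivative of `f⁺/A₃` is `f⁺H - f⁺g⁺/A₃`, and that of
  -- `-Q/A₃²` is `(f⁺)²/A₃`.
  have hZ : ∀ t, 0 < t → HasDerivAt Z (f t * Z t + f t * S.H t) t := by
    intro t ht
    have h1 := S.A₁_pos ht
    have h3 := S.A₃_pos ht
    have hu := S.u_pos ht
    have hX := S.deriv_a_pos ht
    refine (((hode t ht).div ((S.hasDerivAt_A₁ ht).mul (S.hasDerivAt_A₃ ht))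
      (mul_pos h1 h3).ne').sub (hodeQ t ht)).congr_deriv ?_
    have e1 : deriv S.b t * D.coeffPlus S 0 t ^ 2 / (S.v t * S.A₃ t ^ 2)
        = D.coeffPlus S 0 t ^ 2 / (S.A₁ t ^ 2 * S.A₃ t) := by
      have : deriv S.b t * D.coeffPlus S 0 t ^ 2 / (S.v t * S.A₃ t ^ 2)
        = deriv S.b t / S.v t * (D.coeffPlus S 0 t ^ 2 / S.A₃ t ^ 2) := by ring
      rw [this, ← (S.A₃_div_A₁_sq ht).1]
      field_simp
    have e2 : S.H t = (deriv S.a t / S.u t - deriv S.a t / S.w t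
      - 1 / 2 * (deriv S.b t / S.u t + (2 * deriv S.a t - deriv S.b t) / S.v t
      - 4 * S.a t * deriv S.a t / (S.v t * S.w t))
      - deriv S.b t / 2 * (1 / S.v t - 1 / S.w t)) / S.A₃ t := by
      rw [S.deriv_combination_eq ht]; field_simp
    have e3 : 1 / S.A₃ t = deriv S.a t / S.u t := by
      rw [show S.A₃ t = S.u t / deriv S.a t from rfl]; field_simp
    have e4 : deriv S.a t * ((1 - D.coeffPlus S 2 t) / S.u t - 1 / S.w t)
        = (1 - D.coeffPlus S 2 t) * (deriv S.a t / S.u t) - deriv S.a t / S.w t := by ring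
    rw [e1, e2, e4, ← e3]
    simp only [f, Z, Pi.mul_apply]
    generalize 1 / 2 * (deriv S.b t / S.u t + (2 * deriv S.a t - deriv S.b t) / S.v t
      - 4 * S.a t * deriv S.a t / (S.v t * S.w t)) = α
    generalize deriv S.b t / 2 * (1 / S.v t - 1 / S.w t) = β
    generalize deriv S.a t / S.w t = γ
    field_simp
    ring
  have hcont : ContinuousOn f (Ioi 0) := fun t ht =>
    ((hode t ht).continuousAt.div (S.hasDerivAt_A₁ ht).continuousAt
      (S.A₁_pos ht).ne').continuousWithinAt
  have hf' : ∀ t, 0 < t → f t = D.fPlus t := fun t ht => by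
    simp only [f, coeffPlus_zero_apply]
    exact mul_div_cancel_left₀ _ (S.A₁_pos ht).ne'
  have hZ' : ∀ t, 0 < t → Z t = (D.fPlus t - D.gPlus t) / S.A₃ t := fun t ht => by
    have h1 := S.A₁_pos ht
    have h3 := S.A₃_pos ht
    simp only [Z, coeffPlus_zero_apply, coeffPlus_two_apply]
    field_simp
  have hid : Tendsto (fun t : ℝ => t) (𝓝[>] 0) (𝓝 0) :=
    tendsto_nhdsWithin_of_tendsto_nhds tendsto_id
  have hf0 : ∀ᶠ t in 𝓝[>] 0, f t ≤ 1 := by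
    have h1 := (tendsto_fPlus_div hf).mul hid
    rw [mul_zero] at h1
    filter_upwards [h1.eventually_lt_const one_pos, self_mem_nhdsWithin] with t h2 ht
    have h0 : t ≠ 0 := ne_of_gt ht
    rw [div_mul_cancel₀ _ h0] at h2
    rw [hf' t ht]; exact h2.le
  have hz : Tendsto Z (𝓝[>] 0) (𝓝 ((f₁ - g₁) / (1 / 2))) := by
    refine (((tendsto_fPlus_div hf).sub (tendsto_fPlus_div hg)).div S.tendsto_A₃_div
      (by norm_num)).congr' ?_
    filter_upwards [self_mem_nhdsWithin] with t ht
    have h0 : t ≠ 0 := ne_of_gt ht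
    have h3 := S.A₃_pos ht
    rw [hZ' t ht]
    simp only [Pi.div_apply]
    field_simp
  have h := nonneg_of_deriv_ge hZ (fun t ht => by
      have h1 := S.H_pos ht
      have h2 : 0 < f t := div_pos (hP t ht) (S.A₁_pos ht)
      have := mul_pos h2 h1
      linarith) hcont hf0 hz (div_nonneg (sub_nonneg.2 hfg) (by norm_num)) ht
  rw [hZ' t ht] at h
  have := mul_nonneg h (S.A₃_pos ht).le
  rw [div_mul_cancel₀ _ (S.A₃_pos ht).ne'] at this
  linarith

/-- If `f₁⁺ ≠ 0`, then a global instanton has unbounded curvature. -/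
lemma IsInstantonOnP₁.not_hasBoundedCurvature_of_ne_zero (hD : D.IsInstantonOnP₁ S (Ioi 0))
    (hℓ : S.IsCircleLength ℓ) {f₁ g₁ : ℝ}
    (hf : (fun t => D.fPlus t - f₁ * t) =O[𝓝[>] 0] (fun t => t ^ 3))
    (hg : (fun t => D.gPlus t - g₁ * t) =O[𝓝[>] 0] (fun t => t ^ 3))
    (hfg : g₁ ≤ 1 / 2 * (ℓ ^ 2)⁻¹ ∨ (0 ≤ f₁ ∧ g₁ ≤ f₁)) (hf₁ : f₁ ≠ 0) :
    ¬ D.HasBoundedCurvature S := by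
  have hℓ0 : 0 < ℓ := hℓ.1
  have hode := fun t (ht : 0 < t) => (hD.hasDerivAt subset_rfl isOpen_Ioi self_mem_nhdsWithin
    (convex_Ioi 0) (mem_Ioi.2 ht)).1
  have hodeQ := fun t (ht : 0 < t) => hD.hasDerivAt_div subset_rfl isOpen_Ioi self_mem_nhdsWithin
    (convex_Ioi 0) (mem_Ioi.2 ht)
  have hP : ∀ t, 0 < t → D.coeffPlus S 0 t ≠ 0 := by
    intro r hr h0
    have hz := hD.coeffPlus_eq_zero_of_eq_zero subset_rfl isOpen_Ioi self_mem_nhdsWithin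
      (convex_Ioi 0) (mem_Ioi.2 hr) h0
    refine hf₁ (tendsto_nhds_unique (tendsto_fPlus_div hf) ?_)
    refine tendsto_const_nhds.congr' ?_
    filter_upwards [self_mem_nhdsWithin] with t ht
    have h1 : D.fPlus t = 0 := (mul_eq_zero.1 (hz t ht)).resolve_left (S.A₁_pos ht).ne'
    rw [h1, zero_div]
  have hneg : ∀ t, 0 < t →
      -(deriv S.b t * D.coeffPlus S 0 t ^ 2 / (S.v t * S.A₃ t ^ 2)) < 0 := fun t ht => by
    have h1 := S.deriv_b_pos ht
    have h2 := S.v_pos ht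
    have h3 := S.A₃_pos ht
    have h4 := hP t ht
    have : 0 < deriv S.b t * D.coeffPlus S 0 t ^ 2 / (S.v t * S.A₃ t ^ 2) := by positivity
    linarith
  have hanti : StrictAntiOn (fun t => D.coeffPlus S 2 t / S.A₃ t ^ 2) (Ioi 0) := by
    refine strictAntiOn_of_deriv_neg (convex_Ioi 0)
      (fun t ht => (hodeQ t ht).continuousAt.continuousWithinAt) (fun t ht => ?_)
    rw [interior_Ioi] at ht
    rw [(hodeQ t ht).deriv]
    exact hneg t ht
  -- Crossing the threshold `ℓ⁻²` once is enough.
  suffices h : ∃ t₁, 0 < t₁ ∧ D.coeffPlus S 2 t₁ / S.A₃ t₁ ^ 2 < (ℓ ^ 2)⁻¹ by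
    obtain ⟨t₁, h1, h2⟩ := h
    exact hD.not_hasBoundedCurvature_of_lt hℓ hP h1 h2
  rcases hfg with hg₁ | ⟨hf0, hle⟩
  -- The limit of `Q/A₃²` at `0` is `2g₁ ≤ ℓ⁻²`; strict decrease between `1` and `2` makes the
  -- inequality strict, including when `2g₁ = ℓ⁻²`.
  · have h1 := nonpos_of_antitoneOn_of_tendsto (δ := 2) (hanti.antitoneOn.mono Ioo_subset_Ioi_self)
      (tendsto_coeffPlus_two_div (S := S) hg) 1 ⟨one_pos, by norm_num⟩
    have h2 := hanti (mem_Ioi.2 one_pos) (mem_Ioi.2 (by norm_num : (0 : ℝ) < 2))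
      (by norm_num : (1 : ℝ) < 2)
    exact ⟨2, by norm_num, by simp only at h1 h2; linarith⟩
  · by_contra! hge
    have hf₁' : 0 < f₁ := hf0.lt_of_ne hf₁.symm
    have hPpos : ∀ t, 0 < t → 0 < D.coeffPlus S 0 t := by
      intro t ht
      by_contra! hneg
      have h1 := Metric.eventually_pos_of_tendsto_div (n := 1) hf₁' (by simpa using tendsto_fPlus_div hf)
      obtain ⟨s, h2, h3⟩ := (h1.and (Ioo_mem_nhdsGT ht)).exists
      obtain ⟨r, hr, hr0⟩ := intermediate_value_Icc' h3.2.le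
        (fun x hx => (hode x (h3.1.trans_le hx.1)).continuousAt.continuousWithinAt)
        (show (0 : ℝ) ∈ Icc (D.coeffPlus S 0 t) (D.coeffPlus S 0 s) from
          ⟨hneg, (mul_pos (S.A₁_pos h3.1) h2).le⟩)
      exact hP r (h3.1.trans_le hr.1) hr0
    have hA1 := S.A₃_pos one_pos
    -- If `g⁺/A₃ ≥ ℓ⁻²` always held, then `f⁺ ≥ g⁺ ≥ ℓ⁻²A₃`, so for `t ≥ 1` the derivative
    -- `-(f⁺)²/A₃` would be at most `-ℓ⁻⁴A₃(1)`.
    obtain ⟨t, ht, hlt⟩ := exists_lt_of_deriv_le (m := (ℓ ^ 2)⁻¹)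
      (c := S.A₃ 1 * ((ℓ ^ 2)⁻¹) ^ 2) (by positivity)
      (fun t (ht : 1 ≤ t) => hodeQ t (one_pos.trans_le ht)) (fun t ht => by
        have ht0 : 0 < t := one_pos.trans_le ht
        have hA1' := S.A₁_pos ht0
        have hA3 := S.A₃_pos ht0
        have h1 : S.A₃ 1 ≤ S.A₃ t := S.monotoneOn_A₃ (mem_Ioi.2 one_pos) (mem_Ioi.2 ht0) ht
        have h2 := hge t ht0
        have h3 := hD.gPlus_le_fPlus hPpos hf hg hle ht0
        have e : deriv S.b t * D.coeffPlus S 0 t ^ 2 / (S.v t * S.A₃ t ^ 2)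
            = D.fPlus t ^ 2 / S.A₃ t := by
          have : deriv S.b t * D.coeffPlus S 0 t ^ 2 / (S.v t * S.A₃ t ^ 2)
            = deriv S.b t / S.v t * (D.coeffPlus S 0 t ^ 2 / S.A₃ t ^ 2) := by ring
          rw [this, ← (S.A₃_div_A₁_sq ht0).1, coeffPlus_zero_apply]
          field_simp
        rw [e, neg_le_neg_iff, le_div_iff₀ hA3]
        have h4 : (ℓ ^ 2)⁻¹ * S.A₃ t ≤ D.gPlus t := by
          rw [coeffPlus_two_apply, le_div_iff₀ (by positivity)] at h2
          refine le_of_mul_le_mul_left ?_ hA3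
          linarith
        have h5 : ((ℓ ^ 2)⁻¹ * S.A₃ t) ^ 2 ≤ D.fPlus t ^ 2 :=
          pow_le_pow_left₀ (by positivity) (h4.trans h3) 2
        refine le_trans ?_ h5
        have h6 := mul_le_mul_of_nonneg_right h1
          (show 0 ≤ ((ℓ ^ 2)⁻¹) ^ 2 * S.A₃ t by positivity)
        linarith)
    exact absurd hlt (not_lt.2 (hge t (one_pos.trans_le ht)))

end Connection
end B7

end

theorem mainTheorem6 (S : B7.Metric) :
    ((∀ t, 0 < t → 0 < S.H t) ∧ (∃ H₀, 0 < H₀ ∧ Tendsto S.H (𝓝[>] 0) (𝓝 H₀))) ∧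
    ∀ (ℓ : ℝ), S.IsCircleLength ℓ →
    ∀ (T : ℝ), 0 < T →
    ∀ (C : B7.Connection), C.IsInstantonOnP₁ S (Ioo 0 T) →
    ∀ (f₁ g₁ : ℝ),
      (fun t => C.fPlus t - f₁ * t) =O[𝓝[>] 0] (fun t => t ^ 3) →
      (fun t => C.gPlus t - g₁ * t) =O[𝓝[>] 0] (fun t => t ^ 3) →
      (g₁ ≤ 1 / 2 * (ℓ ^ 2)⁻¹ ∨ (0 ≤ f₁ ∧ g₁ ≤ f₁)) →
      (C.ExtendsGlobally S T ↔ f₁ = 0) := by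
  refine ⟨⟨fun t ht => S.H_pos ht, _, ?_, S.tendsto_H⟩, ?_⟩
  · have h1 := S.r₀_pos
    have h2 := sub_pos.2 S.bBar_lt_aBar
    positivity
  intro ℓ hℓ T hT C hC f₁ g₁ hf hg hfg
  constructor
  · rintro ⟨D, hagree, hD, hbdd⟩
    by_contra hne
    have hmem : Ioo 0 T ∈ 𝓝[>] (0 : ℝ) := Ioo_mem_nhdsGT hT
    -- The extension agrees with `C` on `(0, T)`, so it has the same expansions at the singular
    -- orbit.
    have hf' : (fun t => D.fPlus t - f₁ * t) =O[𝓝[>] 0] (fun t => t ^ 3) :=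
      hf.congr' (eventually_of_mem hmem fun t ht => by simp only [hagree.1 ht]) EventuallyEq.rfl
    have hg' : (fun t => D.gPlus t - g₁ * t) =O[𝓝[>] 0] (fun t => t ^ 3) :=
      hg.congr' (eventually_of_mem hmem fun t ht => by simp only [hagree.2.2.1 ht])
        EventuallyEq.rfl
    exact hD.not_hasBoundedCurvature_of_ne_zero hℓ hf' hg' hfg hne hbdd
  · rintro rfl
    exact hC.extendsGlobally hT (by simpa using hf) hg
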